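/- Let $d \ge 3$, and let $P_x$ be the law of simple random walk $(X_n)_{n\ge 0}$ on $\mathbb Z^d$ started at $x$, with Green function $g(x,y)=\sum_{n\ge 0}P_x[X_n=y]$. Let $\mathbb P$ be the law on $\mathbb R^{\mathbb Z^d}$ of the Gaussian free field, i.e. under $\mathbb P$ the canonical field $\varphi$ is a centered Gaussian field with covariance $\mathbb E[\varphi_x\varphi_y]=g(x,y)$. For a finite set $A\subset\mathbb Z^d$ let $e_A(x)=P_x[X_n\notin A\text{ for all } n\ge 1]\,1_A(x)$ be its equilibrium measure and $\mathrm{cap}(A)=\sum_{x\in A}e_A(x)$ its capacity. For integers $L\ge 1$, $K\ge 100$ and $z\in L\mathbb Z^d$ consider the boxes in $\mathbb Z^d$ $$B_z=z+[0,L)^d,\quad D_z=z+[-3L,4L)^d,\quad U_z=z+[-KL+1,\,L+KL-1)^d,$$ and the harmonic average $h_{B_z}(x)=\sum_{y}P_x[X_{T_{U_z}}=y]\,\varphi_y$, where $T_{U}=\inf\{n\ge 0: X_n\notin U\}$. Let $\mathcal C$ range over the non-empty finite subsets of $L\mathbb Z^d$ whose points are at mutual $\ell^\infty$-distance at least $L+2KL$,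 and set $C=\bigcup_{z\in\mathcal C}B_z$ and $\lambda(z)=e_C(B_z)/\mathrm{cap}(C)$. Let $\mathcal F$ be the set of functions $f$ on $\mathcal C$ with $f(z)\in D_z$ for all $z\in\mathcal C$, and put $Z_f=\sum_{z\in\mathcal C}\lambda(z)\,h_{B_z}(f(z))$ and $Z=\inf_{f\in\mathcal F}Z_f$. Then there are a constant $c_4>0$ and numbers $\alpha(K)>1$ ($K\ge 100$) with $\lim_{K\to\infty}\alpha(K)=1$, depending only on $d$ (and on $K$ for $\alpha(K)$), such that for all $K\ge 100$ $$\limsup_{L\to\infty}\ \sup_{\mathcal C}\ \sup_{f\in\mathcal F}\ \mathrm{var}(Z_f)\,\mathrm{cap}(C)<\alpha(K),\qquad \sup_{\mathcal C}\,|\mathbb E[Z]|\Big(\frac{|\mathcal C|}{\mathrm{cap}(C)}\Big)^{-1/2}\le\frac{c_4}{K}\ \text{ for all } L\ge 1,$$ and, with these same constants, for all $a>0$ and $K\ge 100$, $$\limsup_{L\to\infty}\ \sup_{\mathcal C}\ \Big\{\log\mathbb P\Big[\bigcap_{z\in\mathcal C}\Big\{\inf_{x\in D_z}h_{B_z}(x)\le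 -a\Big\}\Big]+\frac12\Big(a-\frac{c_4}{K}\sqrt{\frac{|\mathcal C|}{\mathrm{cap}(C)}}\Big)_+^2\,\frac{\mathrm{cap}(C)}{\alpha(K)}\Big\}\le 0 .$$ -/

import Mathlib

open MeasureTheory ProbabilityTheory Filter Topology

namespace LatticeGFF

/-- The law of one step of simple random walk on `ℤ^d`: uniform on the `2 d` nearest neighbours of
the origin. -/
noncomputable def stepLaw (d : ℕ) : Measure (Fin d → ℤ) :=
  uniformOn {e : Fin d → ℤ | ∑ i, |e i| = 1}

/-- The canonical law `P_x` of simple random walk on `ℤ^d` started at `x`, on the space of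
trajectories: the law of `n ↦ x + ξ_0 + ⋯ + ξ_{n-1}` with `ξ` i.i.d. of law `stepLaw d`. -/
noncomputable def srw {d : ℕ} (x : Fin d → ℤ) : Measure (ℕ → Fin d → ℤ) :=
  (Measure.infinitePi (fun _ : ℕ => stepLaw d)).map
    (fun ξ n => x + ∑ k ∈ Finset.range n, ξ k)

/-- The Green function `g(x,y) = ∑_{n ≥ 0} P_x[X_n = y]` (finite when `d ≥ 3`). -/
noncomputable def green {d : ℕ} (x y : Fin d → ℤ) : ℝ :=
  ∑' n : ℕ, (srw x).real {X | X n = y}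

/-- The equilibrium measure `e_A(x) = P_x[X_n ∉ A for all n ≥ 1] 1_A(x)` of a finite set `A`. -/
noncomputable def equilibrium {d : ℕ} (A : Finset (Fin d → ℤ)) (x : Fin d → ℤ) : ℝ :=
  if x ∈ A then (srw x).real {X | ∀ n : ℕ, 1 ≤ n → X n ∉ A} else 0

/-- The capacity of a finite set: the total mass of its equilibrium measure. -/
noncomputable def capacity {d : ℕ} (A : Finset (Fin d → ℤ)) : ℝ :=
  ∑ x ∈ A, equilibrium A x

/-- `P_x[T_U < ∞, X_{T_U} = y]`, where `T_U` is the first time `n ≥ 0` at which the walk is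
outside `U`. -/
noncomputable def exitLaw {d : ℕ} (U : Finset (Fin d → ℤ)) (x y : Fin d → ℤ) : ℝ :=
  (srw x).real {X | ∃ n : ℕ, X n ∉ U ∧ (∀ m < n, X m ∈ U) ∧ X n = y}

/-- The harmonic average `h^U_x = E_x[φ(X_{T_U})] = ∑_y P_x[X_{T_U} = y] φ_y` of `φ` in the finite
set `U` (only finitely many terms of the sum are nonzero). -/
noncomputable def harmonicAverage {d : ℕ} (U : Finset (Fin d → ℤ)) (φ : (Fin d → ℤ) → ℝ)
    (x : Fin d → ℤ) : ℝ :=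
  ∑' y : Fin d → ℤ, exitLaw U x y * φ y

/-- `P` is the law on `ℝ^{ℤ^d}` of the Gaussian free field on `ℤ^d`: under `P` the canonical field
is a centered Gaussian field with covariance `g`. -/
structure IsGaussianFreeField {d : ℕ} (P : Measure ((Fin d → ℤ) → ℝ)) : Prop where
  gaussian : IsGaussianProcess (fun (x : Fin d → ℤ) (φ : (Fin d → ℤ) → ℝ) => φ x) P
  centered : ∀ x : Fin d → ℤ, ∫ φ, φ x ∂P = 0
  covariance : ∀ x y : Fin d → ℤ, ∫ φ, φ x * φ y ∂P = green x y

/-- `B_z = z + [0, L)^d`. -/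
noncomputable def boxB {d : ℕ} (L : ℕ) (z : Fin d → ℤ) : Finset (Fin d → ℤ) :=
  Fintype.piFinset fun i => Finset.Ico (z i) (z i + L)

/-- `D_z = z + [-3L, 4L)^d`. -/
noncomputable def boxD {d : ℕ} (L : ℕ) (z : Fin d → ℤ) : Finset (Fin d → ℤ) :=
  Fintype.piFinset fun i => Finset.Ico (z i - 3 * L) (z i + 4 * L)

/-- `U_z = z + [-KL + 1, L + KL - 1)^d`. -/
noncomputable def boxU {d : ℕ} (L K : ℕ) (z : Fin d → ℤ) : Finset (Fin d → ℤ) :=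
  Fintype.piFinset fun i => Finset.Ico (z i - K * L + 1) (z i + L + K * L - 1)

/-- The harmonic average `h_B = h^{U_z}` attached to the box `B = B_z`. -/
noncomputable def boxAverage {d : ℕ} (L K : ℕ) (z : Fin d → ℤ) (φ : (Fin d → ℤ) → ℝ)
    (x : Fin d → ℤ) : ℝ :=
  harmonicAverage (boxU L K z) φ x

/-- `𝒞` is a nonempty finite subset of the lattice `L ℤ^d` whose points are at mutual
`ℓ^∞`-distance at least `L + 2 K L` (the norm on `Fin d → ℤ` is the sup norm). -/
structure IsBoxCollection {d : ℕ} (L K : ℕ) (𝒞 : Finset (Fin d → ℤ)) : Prop where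
  nonempty : 𝒞.Nonempty
  lattice : ∀ z ∈ 𝒞, ∀ i, (L : ℤ) ∣ z i
  separated : ∀ z ∈ 𝒞, ∀ z' ∈ 𝒞, z ≠ z' → (L : ℝ) + 2 * K * L ≤ ‖z - z'‖

/-- `C = ⋃_{z ∈ 𝒞} B_z`. -/
noncomputable def boxUnion {d : ℕ} (L : ℕ) (𝒞 : Finset (Fin d → ℤ)) : Finset (Fin d → ℤ) :=
  𝒞.biUnion (boxB L)

/-- The set `ℱ` of functions `f` on `𝒞` with `f(z) ∈ D_z` for each `z ∈ 𝒞`. -/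
abbrev Selection {d : ℕ} (L : ℕ) (𝒞 : Finset (Fin d → ℤ)) : Type :=
  ∀ z : {z : Fin d → ℤ // z ∈ 𝒞}, {x : Fin d → ℤ // x ∈ boxD L z.1}

/-- The weight `λ(z)` of `B_z` under the normalized equilibrium measure of `C`. -/
noncomputable def boxWeight {d : ℕ} (L : ℕ) (𝒞 : Finset (Fin d → ℤ)) (z : Fin d → ℤ) : ℝ :=
  (∑ x ∈ boxB L z, equilibrium (boxUnion L 𝒞) x) / capacity (boxUnion L 𝒞)

/-- `Z_f = ∑_{z ∈ 𝒞} λ(z) h_{B_z}(f(z))`. -/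
noncomputable def weightedAverage {d : ℕ} (L K : ℕ) (𝒞 : Finset (Fin d → ℤ)) (f : Selection L 𝒞)
    (φ : (Fin d → ℤ) → ℝ) : ℝ :=
  ∑ z : {z : Fin d → ℤ // z ∈ 𝒞}, boxWeight L 𝒞 z.1 * boxAverage L K z.1 φ (f z).1

/-- The event that `inf_{D_z} h_{B_z} ≤ -a` for every `z ∈ 𝒞`. -/
def lowEvent {d : ℕ} (L K : ℕ) (𝒞 : Finset (Fin d → ℤ)) (a : ℝ) : Set ((Fin d → ℤ) → ℝ) :=
  {φ | ∀ z ∈ 𝒞, (⨅ x : {x : Fin d → ℤ // x ∈ boxD L z}, boxAverage L K z φ x.1) ≤ -a}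

end LatticeGFF

open LatticeGFF

open MeasureTheory ProbabilityTheory Filter Topology

/-! The weights `λ(z)` form a probability vector, so if every box satisfies `inf_{D_z} h_{B_z} ≤
-a`, then `Z ≤ -a`. Since `Z` is the infimum of a finite family of centred Gaussians `Z_f`, the
Borell–TIS inequality bounds the probability of this event by `exp(-(a - |E Z|)_+² / (2 sup_f var
Z_f))`. Everything thus reduces to one variance bound and one mean bound, each valid for all `L ≥ 1`
and uniform in the collection.

Variance (`IsGaussianFreeField.integral_sq_weightedAverage_le`). For distinct boxes the domains
`U_z` are well separated, and `g` is harmonic off its pole, so the covariance of the two harmonic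
averages is exactly `g(f(z), f(z'))`. Boxes are at distance at least `2KL`, while passing from `D_z`
to `B_z` moves a point by at most `4L`; hence this covariance is at most `(1 + O(1/K)) g(x, x')` for
all `x` in `B_z` and `x'` in `B_{z'}`. A diagonal term costs only `O(1/K)` relative to `e_C(B_z)`,
because the variance of one average is `O((KL)^{2-d})` and `e_C(B_z) ≤ cap(B_z) = O(L^{d-2})`. As
`∑_y g(x,y) e_C(y) = 1` on `C`, the energy of `e_C` is `cap(C)`, and `var(Z_f) cap(C) ≤ 1 + O(1/K)`
follows.

Mean (`IsGaussianFreeField.integral_iInf_weightedAverage_bounds`). The infimum over selections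
separates: `Z = ∑ λ(z) inf_{D_z} h_{B_z}`. The increments of `h_{B_z}` on `D_z` have variance `O(‖x
- y‖ / (KL)^{d-1})`, so dyadic chaining gives a mean of order at most `K^{-1} L^{-(d-2)/2}`, and
`cap(C) ≤ c |𝒞| L^{d-2}` turns this into the stated form.

The analytic inputs are two-sided and gradient bounds on the Green function, read off from the
Fourier integral of the Poissonized walk; the identity between the potential of the equilibrium
measure and the hitting probability, from the maximum principle; and Borell–TIS with the sharp
constant, obtained by running the Gaussian semigroup on a log-sum-exp smoothing of the maximum. -/

namespace LatticeGFF

/-! ### Simple random walk and its first step decomposition -/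

/-- The average of `f` over the `2 d` nearest neighbours of `x`. -/
noncomputable def stepAverage {d : ℕ} (f : (Fin d → ℤ) → ℝ) (x : Fin d → ℤ) : ℝ :=
  (∑ i, (f (x + Pi.single i 1) + f (x - Pi.single i 1))) / (2 * d)

/-- The steps of simple random walk, indexed by direction and sign. -/
def unitStep {d : ℕ} (p : Fin d × Bool) : Fin d → ℤ :=
  Pi.single p.1 (if p.2 then 1 else -1)

lemma unitStep_injective {d : ℕ} : Function.Injective (unitStep (d := d)) := by
  rintro ⟨i, a⟩ ⟨j, b⟩ h
  have hi := congrFun h i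
  have hj := congrFun h j
  by_cases hij : i = j
  · subst hij
    cases a <;> cases b <;> simp_all [unitStep]
  · simp only [unitStep, Pi.single_eq_same, Pi.single_apply, hij, if_false] at hi
    split_ifs at hi
    omega

lemma range_unitStep {d : ℕ} :
    Set.range (unitStep (d := d)) = {e : Fin d → ℤ | ∑ i, |e i| = 1} := by
  ext e
  constructor
  · rintro ⟨⟨i, a⟩, rfl⟩
    simp only [Set.mem_ofPred_eq, unitStep]
    rw [Finset.sum_eq_single i]
    · cases a <;> simp
    · intro j _ hj
      simp [hj]
    · simp
  · intro he
    simp only [Set.mem_ofPred_eq] at he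
    obtain ⟨i, hi⟩ : ∃ i, e i ≠ 0 := by
      by_contra! h
      simp [h] at he
    have h1 := Finset.add_sum_erase Finset.univ (fun j => |e j|) (Finset.mem_univ i)
    have h2 : 0 < |e i| := abs_pos.2 hi
    have h3 : 0 ≤ ∑ j ∈ Finset.univ.erase i, |e j| := Finset.sum_nonneg fun j _ => abs_nonneg _
    have h4 : ∑ j ∈ Finset.univ.erase i, |e j| = 0 := by omega
    have h5 : |e i| = 1 := by omega
    have h6 : ∀ j, j ≠ i → e j = 0 := fun j hj =>
      abs_eq_zero.1 ((Finset.sum_eq_zero_iff_of_nonneg fun j _ => abs_nonneg _).1 h4 j (by simp [hj]))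
    refine ⟨(i, decide (0 < e i)), ?_⟩
    ext j
    by_cases hj : j = i
    · subst hj
      rcases abs_eq zero_le_one |>.1 h5 with h | h <;> simp [unitStep, h]
    · simp [unitStep, hj, h6 j hj]

lemma stepLaw_eq_sum_dirac {d : ℕ} :
    stepLaw d = (2 * d : ENNReal)⁻¹ • ∑ p : Fin d × Bool, Measure.dirac (unitStep p) := by
  classical
  have hS : {e : Fin d → ℤ | ∑ i, |e i| = 1} = ((Finset.univ.image (unitStep (d := d)) : Finset _) : Set _) := by
    rw [← range_unitStep]; simp
  have hc : (Finset.univ.image (unitStep (d := d))).card = d * 2 := by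
    rw [Finset.card_image_of_injective _ unitStep_injective]; simp
  ext t ht
  rw [stepLaw, hS, uniformOn, cond_apply (Finset.measurableSet _), Measure.count_apply_finset, hc]
  simp only [Measure.smul_apply, Measure.coe_finsetSum, Finset.sum_apply, smul_eq_mul]
  have : ((Finset.univ.image (unitStep (d := d)) : Finset _) : Set _) ∩ t
      = (((Finset.univ.image (unitStep (d := d))).filter (· ∈ t) : Finset _) : Set _) := by
    ext; simp
  rw [this, Measure.count_apply_finset, Finset.filter_image,
    Finset.card_image_of_injective _ unitStep_injective, Finset.card_filter]
  push_cast
  rw [mul_comm (d : ENNReal) 2]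
  congr 1
  refine Finset.sum_congr rfl fun p _ => ?_
  rw [Measure.dirac_apply' _ ht]
  by_cases h : unitStep p ∈ t <;> simp [h]

instance isProbabilityMeasure_stepLaw {d : ℕ} [NeZero d] : IsProbabilityMeasure (stepLaw d) := by
  constructor
  rw [stepLaw_eq_sum_dirac]
  simp only [Measure.smul_apply, Measure.coe_finsetSum, Finset.sum_apply, measure_univ, smul_eq_mul]
  simp only [Finset.sum_const, Finset.card_univ, Fintype.card_prod, Fintype.card_fin,
    Fintype.card_bool, nsmul_eq_mul, mul_one]
  push_cast
  rw [mul_comm (d : ENNReal) 2]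
  refine ENNReal.inv_mul_cancel (by simp [NeZero.ne d]) (by finiteness)

/-- Cylinder sets split at coordinate zero, and they determine the product measure. This is the
Markov property at time one in the form used for the first step decomposition. -/
lemma infinitePi_map_cons {Y : Type*} [MeasurableSpace Y] (μ : Measure Y) [IsProbabilityMeasure μ] :
    (μ.prod (Measure.infinitePi fun _ : ℕ => μ)).map (fun q n => Nat.casesOn n q.1 q.2)
      = Measure.infinitePi fun _ : ℕ => μ := by
  have hm : Measurable (fun (q : Y × (ℕ → Y)) (n : ℕ) => (Nat.casesOn n q.1 q.2 : Y)) := by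
    refine measurable_pi_iff.2 fun n => ?_
    cases n with
    | zero => exact measurable_fst
    | succ n => exact (measurable_pi_apply n).comp measurable_snd
  refine Measure.eq_infinitePi _ fun s t ht => ?_
  rw [Measure.map_apply hm (MeasurableSet.pi s.countable_toSet fun i _ => ht i)]
  classical
  set s' : Finset ℕ := s.preimage Nat.succ (Nat.succ_injective.injOn)
  have hpre : (fun (q : Y × (ℕ → Y)) (n : ℕ) => (Nat.casesOn n q.1 q.2 : Y)) ⁻¹' (Set.pi s t)
      = (if 0 ∈ s then t 0 else Set.univ) ×ˢ Set.pi s' (fun n => t (n + 1)) := by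
    ext q
    simp only [Set.mem_preimage, Set.mem_pi, Set.mem_prod, Finset.mem_coe]
    constructor
    · intro h
      refine ⟨?_, fun n hn => h (n + 1) (by simpa [s'] using hn)⟩
      split_ifs with h0
      · exact h 0 h0
      · trivial
    · rintro ⟨h0, h1⟩ n hn
      cases n with
      | zero => simpa [hn] using h0
      | succ n => exact h1 n (by simpa [s'] using hn)
  rw [hpre, Measure.prod_prod, Measure.infinitePi_pi _ fun i _ => ht _]
  have hs : s = if 0 ∈ s then insert 0 (s'.image Nat.succ) else s'.image Nat.succ := by
    ext n
    cases n with
    | zero => by_cases h : 0 ∈ s <;> simp [h]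
    | succ n => by_cases h : 0 ∈ s <;> simp [h, s']
  have himg : ∏ i ∈ s'.image Nat.succ, μ (t i) = ∏ i ∈ s', μ (t (i + 1)) :=
    Finset.prod_image fun a _ b _ h => Nat.succ_injective h
  conv_rhs => rw [hs]
  split_ifs with h0
  · rw [Finset.prod_insert (by simp), himg]
  · rw [himg]; simp

lemma measurable_path {d : ℕ} (x : Fin d → ℤ) :
    Measurable (fun (ξ : ℕ → Fin d → ℤ) (n : ℕ) => x + ∑ k ∈ Finset.range n, ξ k) := by
  refine measurable_pi_iff.2 fun n => ?_
  fun_prop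

instance {d : ℕ} [NeZero d] (x : Fin d → ℤ) : IsProbabilityMeasure (srw x) :=
  Measure.isProbabilityMeasure_map (measurable_path x).aemeasurable

/-- The first step decomposition of simple random walk. -/
lemma srw_real_shift {d : ℕ} [NeZero d] (x : Fin d → ℤ) {E : Set (ℕ → Fin d → ℤ)}
    (hE : MeasurableSet E) :
    (srw x).real {X | (fun n => X (n + 1)) ∈ E} = stepAverage (fun y => (srw y).real E) x := by
  set I := Measure.infinitePi (fun _ : ℕ => stepLaw d) with hI
  have hshift : Measurable (fun (X : ℕ → Fin d → ℤ) (n : ℕ) => X (n + 1)) := by fun_prop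
  have hcons : Measurable (fun (q : (Fin d → ℤ) × (ℕ → Fin d → ℤ)) (n : ℕ) =>
      (Nat.casesOn n q.1 q.2 : Fin d → ℤ)) := by
    refine measurable_pi_iff.2 fun n => ?_
    cases n with
    | zero => exact measurable_fst
    | succ n => exact (measurable_pi_apply n).comp measurable_snd
  have key : srw x {X | (fun n => X (n + 1)) ∈ E} = ∫⁻ e, srw (x + e) E ∂(stepLaw d) := by
    have h1 : MeasurableSet {X : ℕ → Fin d → ℤ | (fun n => X (n + 1)) ∈ E} := hshift hE
    rw [srw, Measure.map_apply (measurable_path x) h1, ← infinitePi_map_cons (stepLaw d), ← hI,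
      Measure.map_apply hcons (measurable_path x h1),
      Measure.prod_apply (hcons (measurable_path x h1))]
    refine lintegral_congr fun e => ?_
    rw [srw, Measure.map_apply (measurable_path _) hE]
    congr 1
    ext ξ
    simp only [Set.mem_preimage, Set.mem_ofPred_eq]
    have : (fun n : ℕ => x + ∑ k ∈ Finset.range (n + 1), (Nat.casesOn k e ξ : Fin d → ℤ))
        = fun n => x + e + ∑ k ∈ Finset.range n, ξ k := by
      funext n
      rw [Finset.sum_range_succ', add_comm (∑ k ∈ Finset.range n, _), add_assoc]
      rfl
    rw [this]
  rw [Measure.real, key, stepLaw_eq_sum_dirac, lintegral_smul_measure, lintegral_finsetSum_measure]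
  simp only [lintegral_dirac, smul_eq_mul]
  rw [ENNReal.toReal_mul, ENNReal.toReal_sum (fun _ _ => measure_ne_top _ _), ENNReal.toReal_inv,
    stepAverage, Fintype.sum_prod_type, div_eq_inv_mul]
  have h2 : ((2 * d : ENNReal).toReal)⁻¹ = (2 * d : ℝ)⁻¹ := by simp
  rw [h2]
  congr 1
  · refine Finset.sum_congr rfl fun i _ => ?_
    simp [unitStep, Measure.real, sub_eq_add_neg, Pi.single_neg]

lemma srw_real_zero {d : ℕ} [NeZero d] (x : Fin d → ℤ) {s : Set (Fin d → ℤ)} :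
    (srw x).real {X | X 0 ∈ s} = s.indicator 1 x := by
  have h : MeasurableSet {X : ℕ → Fin d → ℤ | X 0 ∈ s} :=
    (measurable_pi_apply 0) (Set.to_countable s).measurableSet
  rw [Measure.real, srw, Measure.map_apply (measurable_path x) h]
  by_cases hx : x ∈ s
  · have : (fun (ξ : ℕ → Fin d → ℤ) (n : ℕ) => x + ∑ k ∈ Finset.range n, ξ k) ⁻¹' {X | X 0 ∈ s}
        = Set.univ := by ext; simp [hx]
    rw [this]; simp [hx]
  · have : (fun (ξ : ℕ → Fin d → ℤ) (n : ℕ) => x + ∑ k ∈ Finset.range n, ξ k) ⁻¹' {X | X 0 ∈ s}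
        = ∅ := by ext; simp [hx]
    rw [this]; simp [hx]

lemma srw_ae_zero {d : ℕ} [NeZero d] (x : Fin d → ℤ) : ∀ᵐ X ∂(srw x), X 0 = x := by
  have h : MeasurableSet {X : ℕ → Fin d → ℤ | X 0 = x} :=
    measurableSet_eq_fun (measurable_pi_apply 0) measurable_const
  rw [srw, ae_map_iff (measurable_path x).aemeasurable h]
  simp

/-- The `n`-step transition probability of simple random walk. -/
noncomputable def transition {d : ℕ} (n : ℕ) (x y : Fin d → ℤ) : ℝ :=
  (srw x).real {X | X n = y}

lemma transition_nonneg {d : ℕ} (n : ℕ) (x y : Fin d → ℤ) : 0 ≤ transition n x y :=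
  measureReal_nonneg

lemma transition_zero {d : ℕ} [NeZero d] (x y : Fin d → ℤ) :
    transition 0 x y = if x = y then 1 else 0 := by
  classical
  have := srw_real_zero x (s := {y})
  simp only [Set.mem_singleton_iff] at this
  rw [transition, this]
  simp [Set.indicator_apply]

lemma transition_succ {d : ℕ} [NeZero d] (n : ℕ) (x y : Fin d → ℤ) :
    transition (n + 1) x y = stepAverage (fun w => transition n w y) x :=
  srw_real_shift x (E := {X | X n = y}) (measurableSet_eq_fun (measurable_pi_apply n) measurable_const)

/-! ### Neighbour averages and the maximum principle -/

section StepAverage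

variable {d : ℕ} (f g : (Fin d → ℤ) → ℝ) (x : Fin d → ℤ)

lemma stepAverage_congr {f g : (Fin d → ℤ) → ℝ} {x : Fin d → ℤ}
    (h : ∀ i, f (x + Pi.single i 1) = g (x + Pi.single i 1) ∧
      f (x - Pi.single i 1) = g (x - Pi.single i 1)) :
    stepAverage f x = stepAverage g x := by
  simp only [stepAverage]
  congr 1
  exact Finset.sum_congr rfl fun i _ => by rw [(h i).1, (h i).2]

lemma stepAverage_sub : stepAverage (fun y => f y - g y) x = stepAverage f x - stepAverage g x := by
  simp only [stepAverage]
  rw [← sub_div, ← Finset.sum_sub_distrib]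
  congr 1
  exact Finset.sum_congr rfl fun i _ => by ring

lemma stepAverage_mul_const (c : ℝ) :
    stepAverage (fun y => f y * c) x = stepAverage f x * c := by
  simp only [stepAverage]
  rw [div_mul_eq_mul_div, Finset.sum_mul]
  congr 1
  exact Finset.sum_congr rfl fun i _ => by ring

lemma stepAverage_sum {ι : Type*} (s : Finset ι) (F : ι → (Fin d → ℤ) → ℝ) :
    stepAverage (fun y => ∑ j ∈ s, F j y) x = ∑ j ∈ s, stepAverage (F j) x := by
  simp only [stepAverage]
  rw [← Finset.sum_div, Finset.sum_comm]
  congr 1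
  exact Finset.sum_congr rfl fun i _ => by rw [Finset.sum_add_distrib]

lemma stepAverage_const [NeZero d] (c : ℝ) : stepAverage (fun _ => c) x = c := by
  have : (d : ℝ) ≠ 0 := by exact_mod_cast NeZero.ne d
  simp only [stepAverage, Finset.sum_const, Finset.card_univ, Fintype.card_fin, nsmul_eq_mul]
  field_simp
  ring

end StepAverage

/-- The maximum principle on `ℤ^d`. -/
lemma nonpos_of_le_stepAverage {d : ℕ} [NeZero d] {v : (Fin d → ℤ) → ℝ}
    (hfin : ∀ ε > 0, {x | ε ≤ v x}.Finite) (hv : ∀ x, 0 < v x → v x ≤ stepAverage v x)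
    (x : Fin d → ℤ) : v x ≤ 0 := by
  by_contra! hx
  obtain ⟨m, hm, hmax⟩ := (hfin (v x) hx).exists_maximalFor v _ ⟨x, le_refl (v x)⟩
  have hm' : ∀ y, v y ≤ v m := fun y => by
    by_contra! h
    exact absurd (hmax (le_trans hm h.le) h.le) (not_le.2 h)
  have hmpos : 0 < v m := hx.trans_le hm
  let i₀ : Fin d := 0
  -- Among the maximizers, take one that is extreme in the direction `i₀`: its neighbour `p +
  -- e_{i₀}` is then strictly below the maximum, which makes the average at `p` too small.
  obtain ⟨p, hp, hpmax⟩ := (hfin (v m) hmpos).exists_maximalFor (fun y => y i₀) _ ⟨m, le_refl (v m)⟩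
  have hpm : v p = v m := le_antisymm (hm' p) hp
  have h1 : v (p + Pi.single i₀ 1) < v m := by
    by_contra! h
    have := hpmax h (by simp)
    simp at this
  have hd : (0 : ℝ) < d := by exact_mod_cast Nat.pos_of_ne_zero (NeZero.ne d)
  have h2 : ∑ i, (v (p + Pi.single i 1) + v (p - Pi.single i 1)) < ∑ _i : Fin d, (v m + v m) := by
    refine Finset.sum_lt_sum (fun i _ => add_le_add (hm' _) (hm' _)) ⟨i₀, Finset.mem_univ _, ?_⟩
    exact add_lt_add_of_lt_of_le h1 (hm' _)
  have h3 := hv p (hpm ▸ hmpos)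
  rw [hpm, stepAverage, le_div_iff₀ (by positivity)] at h3
  simp only [Finset.sum_const, Finset.card_univ, Fintype.card_fin, nsmul_eq_mul] at h2
  linarith

/-! ### One-dimensional heat kernel: bounds by shifting the contour -/

/-- The integrand of the Fourier representation of the heat kernel on `ℤ`. -/
noncomputable def kernelIntegrand (s : ℝ) (m : ℤ) (z : ℂ) : ℂ :=
  Complex.exp (-s * (1 - Complex.cos z) + Complex.I * m * z)

/-- The heat kernel at time `s` of continuous time simple random walk on `ℤ`. -/
noncomputable def kernel (s : ℝ) (m : ℤ) : ℂ :=
  (2 * Real.pi : ℂ)⁻¹ * ∫ θ in (-Real.pi)..Real.pi, kernelIntegrand s m θ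

/-- Cauchy's theorem on a rectangle of width one period: the two vertical sides cancel. -/
lemma integral_shift_of_periodic {f : ℂ → ℂ} (hf : Differentiable ℂ f)
    (hp : ∀ z, f (z + 2 * Real.pi) = f z) (l : ℝ) :
    ∫ θ in (-Real.pi)..Real.pi, f θ = ∫ θ in (-Real.pi)..Real.pi, f (θ + l * Complex.I) := by
  have h := Complex.integral_boundary_rect_eq_zero_of_differentiableOn f (-Real.pi : ℂ)
    (Real.pi + l * Complex.I) hf.differentiableOn
  simp only [Complex.neg_re, Complex.ofReal_re, Complex.neg_im, Complex.ofReal_im, neg_zero,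
    Complex.ofReal_zero, zero_mul, add_zero, Complex.add_re, Complex.mul_re, Complex.I_re, mul_zero,
    Complex.I_im, mul_one, sub_self, Complex.add_im, Complex.mul_im, zero_add,
    smul_eq_mul] at h
  have h2 : ∀ y : ℝ, f (Real.pi + y * Complex.I) = f (((-Real.pi : ℝ) : ℂ) + y * Complex.I) := by
    intro y
    rw [← hp (((-Real.pi : ℝ) : ℂ) + y * Complex.I)]
    congr 1
    push_cast
    ring
  simp only [h2, add_sub_cancel_right] at h
  exact sub_eq_zero.1 h

lemma differentiable_kernelIntegrand (s : ℝ) (m : ℤ) : Differentiable ℂ (kernelIntegrand s m) := by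
  unfold kernelIntegrand
  fun_prop

lemma exp_int_mul_add_two_pi (m : ℤ) (z : ℂ) :
    Complex.exp (Complex.I * m * (z + 2 * Real.pi)) = Complex.exp (Complex.I * m * z) := by
  rw [show Complex.I * m * (z + 2 * Real.pi) = Complex.I * m * z + m * (2 * Real.pi * Complex.I) by
    ring]
  exact Complex.exp_periodic.int_mul m _

lemma kernelIntegrand_periodic (s : ℝ) (m : ℤ) (z : ℂ) :
    kernelIntegrand s m (z + 2 * Real.pi) = kernelIntegrand s m z := by
  rw [kernelIntegrand, kernelIntegrand, Complex.exp_add, Complex.exp_add, exp_int_mul_add_two_pi,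
    Complex.cos_add_two_pi]

lemma norm_kernelIntegrand (s : ℝ) (m : ℤ) (θ l : ℝ) :
    ‖kernelIntegrand s m (θ + l * Complex.I)‖
      = Real.exp (-s * (1 - Real.cos θ * Real.cosh l) - m * l) := by
  rw [kernelIntegrand, Complex.norm_exp, Complex.cos_add_mul_I]
  congr 1
  simp [← Complex.ofReal_cos, ← Complex.ofReal_cosh, ← Complex.ofReal_sin, ← Complex.ofReal_sinh]
  ring

lemma two_mul_sq_div_le_one_sub_cos {θ : ℝ} (h : |θ| ≤ Real.pi) :
    2 * θ ^ 2 / Real.pi ^ 2 ≤ 1 - Real.cos θ := by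
  have := Real.cos_le_one_sub_mul_cos_sq h
  have h2 : 2 * θ ^ 2 / Real.pi ^ 2 = 2 / Real.pi ^ 2 * θ ^ 2 := by ring
  linarith

/-- With a shift of size `σ^{-1/2}` the loss `s (cosh l - 1)` is at most `1`, and replacing `s` by
`σ = max 1 s` in the Gaussian factor loses at most `2`; together these give the constant `exp 3`. -/
lemma norm_kernelIntegrand_le {s : ℝ} (hs : 0 ≤ s) {m : ℤ} {θ l σ : ℝ} (hσ : σ = max 1 s)
    (hl : l ^ 2 * σ = 1) (hθ : |θ| ≤ Real.pi) :
    ‖kernelIntegrand s m (θ + l * Complex.I)‖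
      ≤ Real.exp 3 * Real.exp (-(m * l)) * Real.exp (-(2 * σ / Real.pi ^ 2) * θ ^ 2) := by
  rw [norm_kernelIntegrand, ← Real.exp_add, ← Real.exp_add]
  refine Real.exp_le_exp.2 ?_
  have hσ1 : 1 ≤ σ := hσ ▸ le_max_left _ _
  have hσs : s ≤ σ := hσ ▸ le_max_right _ _
  have hl1 : l ^ 2 ≤ 1 := by nlinarith [sq_nonneg l]
  have h1 : Real.cosh l ≤ 1 + l ^ 2 := by
    refine (Real.cosh_le_exp_half_sq l).trans ?_
    have := Real.abs_exp_sub_one_sub_id_le (x := l ^ 2 / 2) (by rw [abs_of_nonneg (by positivity)]; linarith)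
    have := (abs_le.1 this).2
    nlinarith [sq_nonneg l]
  have h2 : 1 ≤ Real.cosh l := Real.one_le_cosh l
  have h3 := two_mul_sq_div_le_one_sub_cos hθ
  have h4 : s * (Real.cosh l - 1) ≤ 1 := by
    calc s * (Real.cosh l - 1) ≤ σ * l ^ 2 := by gcongr; linarith
      _ = 1 := by rw [mul_comm]; exact hl
  have h5 : 0 ≤ s * (Real.cosh l - 1) * (1 - Real.cos θ) :=
    mul_nonneg (mul_nonneg hs (by linarith)) (by linarith [Real.cos_le_one θ])
  have hpi : 2 * θ ^ 2 / Real.pi ^ 2 ≤ 2 := by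
    rw [div_le_iff₀ (by positivity)]
    have : θ ^ 2 ≤ Real.pi ^ 2 := sq_le_sq.2 (by rwa [abs_of_pos Real.pi_pos])
    linarith
  have h6 : (σ - s) * (2 * θ ^ 2 / Real.pi ^ 2) ≤ 1 * 2 := by
    have : σ - s ≤ 1 := by
      rcases le_total s 1 with h | h
      · rw [hσ, max_eq_left h]; linarith
      · rw [hσ, max_eq_right h]; linarith
    have h0 : 0 ≤ 2 * θ ^ 2 / Real.pi ^ 2 := by positivity
    exact mul_le_mul this hpi h0 zero_le_one
  have h7 : s * (2 * θ ^ 2 / Real.pi ^ 2) ≤ s * (1 - Real.cos θ) := by gcongr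
  have h8 : (2 * σ / Real.pi ^ 2) * θ ^ 2 = σ * (2 * θ ^ 2 / Real.pi ^ 2) := by ring
  nlinarith

lemma integral_gaussian_interval_le {b : ℝ} (hb : 0 < b) :
    ∫ θ in (-Real.pi)..Real.pi, Real.exp (-b * θ ^ 2) ≤ √(Real.pi / b) := by
  rw [← integral_gaussian, intervalIntegral.integral_of_le (by linarith [Real.pi_pos])]
  exact setIntegral_le_integral (integrable_exp_neg_mul_sq hb) (Eventually.of_forall fun _ => by positivity)

/-- A weighted Fourier integral bound after a complex shift. -/
lemma norm_kernel_weighted_le {s : ℝ} (hs : 0 ≤ s) (m : ℤ) {w : ℂ → ℂ} (hw : Differentiable ℂ w)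
    (hwp : ∀ z, w (z + 2 * Real.pi) = w z) {D : ℝ}
    (hD : ∀ θ l : ℝ, |θ| ≤ Real.pi → |l| = (√(max 1 s))⁻¹ →
      ‖w (θ + l * Complex.I)‖ ≤ D * Real.exp (max 1 s / Real.pi ^ 2 * θ ^ 2)) :
    ‖(2 * Real.pi : ℂ)⁻¹ * ∫ θ in (-Real.pi)..Real.pi, kernelIntegrand s m θ * w θ‖
      ≤ D * Real.exp 4 * (√(max 1 s))⁻¹ * Real.exp (-(|m| / √(max 1 s))) := by
  set σ := max 1 s with hσ
  have hσ1 : 1 ≤ σ := le_max_left _ _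
  have hρ : 0 < √σ := Real.sqrt_pos.2 (by linarith)
  -- The contour is shifted in the direction of the sign of `m`, which turns `exp(-m l)` into
  -- spatial decay.
  obtain ⟨l, hl, hml⟩ : ∃ l : ℝ, |l| = (√σ)⁻¹ ∧ m * l = |m| / √σ := by
    rcases le_total 0 m with h | h
    · refine ⟨(√σ)⁻¹, abs_of_pos (by positivity), ?_⟩
      rw [abs_of_nonneg h]; rfl
    · refine ⟨-(√σ)⁻¹, by rw [abs_neg, abs_of_pos (by positivity)], ?_⟩
      rw [abs_of_nonpos h]; push_cast; ring
  have hl2 : l ^ 2 * σ = 1 := by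
    rw [← sq_abs, hl, inv_pow, Real.sq_sqrt (by linarith), inv_mul_cancel₀ (by linarith)]
  have hsh := integral_shift_of_periodic (f := fun z => kernelIntegrand s m z * w z)
    ((differentiable_kernelIntegrand s m).mul hw)
    (fun z => by rw [kernelIntegrand_periodic, hwp]) l
  rw [hsh, norm_mul]
  have hpi := Real.pi_pos
  have hb : 0 < σ / Real.pi ^ 2 := by positivity
  -- The weight may grow at half the rate of the Gaussian in the kernel, so the other half is left
  -- to integrate and supplies the factor `σ^{-1/2}`.
  have hint : ‖∫ θ in (-Real.pi)..Real.pi,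
      kernelIntegrand s m (θ + l * Complex.I) * w (θ + l * Complex.I)‖
      ≤ ∫ θ in (-Real.pi)..Real.pi, (Real.exp 3 * Real.exp (-(|m| / √σ)) * D)
          * Real.exp (-(σ / Real.pi ^ 2) * θ ^ 2) := by
    refine intervalIntegral.norm_integral_le_of_norm_le (by linarith) ?_ ?_
    · refine Eventually.of_forall fun θ hθ => ?_
      have hθ' : |θ| ≤ Real.pi := abs_le.2 ⟨hθ.1.le, hθ.2⟩
      rw [norm_mul]
      calc _ ≤ (Real.exp 3 * Real.exp (-(m * l)) * Real.exp (-(2 * σ / Real.pi ^ 2) * θ ^ 2))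
            * (D * Real.exp (σ / Real.pi ^ 2 * θ ^ 2)) :=
          mul_le_mul (norm_kernelIntegrand_le hs hσ hl2 hθ') (hD θ l hθ' hl) (norm_nonneg _)
            (by positivity)
        _ = _ := by
          rw [hml, show -(σ / Real.pi ^ 2) * θ ^ 2 = -(2 * σ / Real.pi ^ 2) * θ ^ 2
            + σ / Real.pi ^ 2 * θ ^ 2 by ring, Real.exp_add]
          ring
    · exact Continuous.intervalIntegrable (by fun_prop) _ _
  have hD0 : 0 ≤ D := by
    have := (norm_nonneg _).trans (hD 0 l (by simp [hpi.le]) hl)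
    simpa using this
  rw [intervalIntegral.integral_const_mul] at hint
  have hg := integral_gaussian_interval_le hb
  have hsq : √(Real.pi / (σ / Real.pi ^ 2)) = √Real.pi * Real.pi * (√σ)⁻¹ := by
    rw [show Real.pi / (σ / Real.pi ^ 2) = Real.pi * (Real.pi ^ 2) * σ⁻¹ by field_simp,
      Real.sqrt_mul (by positivity), Real.sqrt_mul (by positivity), Real.sqrt_sq hpi.le, Real.sqrt_inv]
  have hn : ‖(2 * Real.pi : ℂ)⁻¹‖ = (2 * Real.pi)⁻¹ := by
    rw [norm_inv]; simp [abs_of_pos hpi]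
  rw [hn]
  have hsp : √Real.pi ≤ 2 := by
    rw [Real.sqrt_le_left (by norm_num)]; linarith [Real.pi_le_four]
  have he : Real.exp 4 = Real.exp 3 * Real.exp 1 := by rw [← Real.exp_add]; norm_num
  calc _ ≤ (2 * Real.pi)⁻¹ * ((Real.exp 3 * Real.exp (-(|m| / √σ)) * D)
        * (2 * Real.pi * (√σ)⁻¹)) := by
        refine mul_le_mul_of_nonneg_left (hint.trans ?_) (by positivity)
        refine mul_le_mul_of_nonneg_left (hg.trans (hsq ▸ ?_)) (by positivity)
        gcongr
    _ = D * Real.exp 3 * (√σ)⁻¹ * Real.exp (-(|m| / √σ)) := by field_simp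
    _ ≤ _ := by
        rw [he]
        have : (1 : ℝ) ≤ Real.exp 1 := Real.one_le_exp zero_le_one
        gcongr
        nlinarith [Real.exp_pos 3]

lemma norm_kernel_le {s : ℝ} (hs : 0 ≤ s) (m : ℤ) :
    ‖kernel s m‖ ≤ Real.exp 4 * (√(max 1 s))⁻¹ * Real.exp (-(|m| / √(max 1 s))) := by
  have := norm_kernel_weighted_le hs m (w := fun _ => 1) (D := 1) (by fun_prop) (fun _ => rfl) ?_
  · simpa [kernel] using this
  · intro θ l _ _
    simp only [norm_one, one_mul]
    exact Real.one_le_exp (by positivity)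

lemma kernel_succ_sub (s : ℝ) (m : ℤ) : kernel s (m + 1) - kernel s m =
    (2 * Real.pi : ℂ)⁻¹ * ∫ θ in (-Real.pi)..Real.pi,
      kernelIntegrand s m θ * (Complex.exp (Complex.I * θ) - 1) := by
  have hc : ∀ k, Continuous fun θ : ℝ => kernelIntegrand s k θ := fun k =>
    (differentiable_kernelIntegrand s k).continuous.comp Complex.continuous_ofReal
  rw [kernel, kernel, ← mul_sub, ← intervalIntegral.integral_sub
    ((hc _).intervalIntegrable _ _) ((hc _).intervalIntegrable _ _)]
  congr 2
  funext θ
  rw [mul_sub, mul_one, kernelIntegrand, kernelIntegrand, ← Complex.exp_add]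
  congr 2
  push_cast
  ring

/-- A difference puts the weight `exp(iθ) - 1`, of size `|θ| + |l|`, into the integral. Both terms
are of order `σ^{-1/2}` once `|θ| √σ` is absorbed by the allowed Gaussian growth, so a difference
gains one inverse power of the diffusive scale. -/
lemma norm_kernel_succ_sub_le {s : ℝ} (hs : 0 ≤ s) (m : ℤ) :
    ‖kernel s (m + 1) - kernel s m‖
      ≤ Real.exp 11 * (√(max 1 s))⁻¹ ^ 2 * Real.exp (-(|m| / √(max 1 s))) := by
  have hpi := Real.pi_pos
  set σ := max 1 s with hσ
  have hσ1 : 1 ≤ σ := le_max_left _ _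
  have hρ : 1 ≤ √σ := Real.one_le_sqrt.2 hσ1
  have := norm_kernel_weighted_le hs m (w := fun z => Complex.exp (Complex.I * z) - 1)
    (D := Real.exp 7 * (√σ)⁻¹) (by fun_prop) ?_ ?_
  · rw [kernel_succ_sub]
    refine this.trans (le_of_eq ?_)
    rw [show (11 : ℝ) = 7 + 4 by norm_num, Real.exp_add]
    ring
  · intro z
    have := exp_int_mul_add_two_pi 1 z
    simp only [Int.cast_one, mul_one] at this
    rw [this]
  · intro θ l hθ hl
    rw [← hσ] at hl
    set z : ℂ := Complex.I * (θ + l * Complex.I) with hz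
    have hz1 : ‖z‖ ≤ |θ| + (√σ)⁻¹ := by
      rw [hz, norm_mul, Complex.norm_I, one_mul]
      refine (norm_add_le _ _).trans ?_
      simp [hl]
    have hz2 : ‖z‖ ≤ 5 := by
      have : (√σ)⁻¹ ≤ 1 := inv_le_one_of_one_le₀ hρ
      linarith [Real.pi_le_four]
    have h1 : ‖Complex.exp z - 1‖ ≤ ‖z‖ * Real.exp ‖z‖ := by
      simpa using Complex.norm_exp_sub_sum_le_norm_mul_exp z 1
    have h2 : |θ| * √σ ≤ Real.pi * Real.exp (σ / Real.pi ^ 2 * θ ^ 2) := by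
      set u := |θ| * √σ / Real.pi with hu
      have hu2 : u ^ 2 = σ / Real.pi ^ 2 * θ ^ 2 := by
        rw [hu, div_pow, mul_pow, sq_abs, Real.sq_sqrt (by linarith)]; ring
      have : |θ| * √σ = Real.pi * u := by rw [hu]; field_simp
      rw [this, ← hu2]
      have : u ≤ Real.exp (u ^ 2) := by
        have := Real.add_one_le_exp (u ^ 2)
        nlinarith [sq_nonneg (u - 1)]
      gcongr
    have h3 : (1 : ℝ) ≤ Real.exp (σ / Real.pi ^ 2 * θ ^ 2) := Real.one_le_exp (by positivity)
    have h4 : |θ| + (√σ)⁻¹ ≤ 5 * (√σ)⁻¹ * Real.exp (σ / Real.pi ^ 2 * θ ^ 2) := by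
      have : |θ| + (√σ)⁻¹ = (√σ)⁻¹ * (|θ| * √σ + 1) := by field_simp
      rw [this, mul_comm (5 : ℝ), mul_assoc]
      gcongr
      nlinarith [Real.pi_le_four]
    have h5 : 5 * Real.exp 5 ≤ Real.exp 7 := by
      rw [show (7 : ℝ) = 2 + 5 by norm_num, Real.exp_add]
      have : (5 : ℝ) ≤ Real.exp 2 := by
        have := Real.quadratic_le_exp_of_nonneg (x := 2) (by norm_num)
        linarith
      gcongr
    calc _ ≤ ‖z‖ * Real.exp ‖z‖ := h1
      _ ≤ (5 * (√σ)⁻¹ * Real.exp (σ / Real.pi ^ 2 * θ ^ 2)) * Real.exp 5 := by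
          gcongr
          exact hz1.trans h4
      _ = (5 * Real.exp 5) * (√σ)⁻¹ * Real.exp (σ / Real.pi ^ 2 * θ ^ 2) := by ring
      _ ≤ _ := by gcongr

lemma kernel_neg (s : ℝ) (m : ℤ) : kernel s (-m) = kernel s m := by
  rw [kernel, kernel]
  congr 1
  have := intervalIntegral.integral_comp_neg (a := -Real.pi) (b := Real.pi)
    (fun θ : ℝ => kernelIntegrand s m θ)
  rw [neg_neg] at this
  rw [← this]
  congr 1
  funext θ
  simp [kernelIntegrand]

/-- At `m = 0` the integrand is positive, so one may keep only `0 ≤ θ ≤ s^{-1/2}`, where `s (1 - cos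
θ) ≤ 1/2`. -/
lemma kernel_zero_lower {s : ℝ} (hs : 1 ≤ s) : (√s)⁻¹ / 20 ≤ ‖kernel s 0‖ := by
  have hpi := Real.pi_pos
  have hρ : 1 ≤ √s := Real.one_le_sqrt.2 hs
  have hr : kernel s 0 = (((2 * Real.pi)⁻¹ *
      ∫ θ in (-Real.pi)..Real.pi, Real.exp (-s * (1 - Real.cos θ)) : ℝ) : ℂ) := by
    rw [kernel]
    push_cast
    rw [← intervalIntegral.integral_ofReal]
    congr 2
    funext θ
    simp [kernelIntegrand]
  have hcont : Continuous fun θ : ℝ => Real.exp (-s * (1 - Real.cos θ)) := by fun_prop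
  have h1 : ∫ _θ in (0 : ℝ)..(√s)⁻¹, Real.exp (-(1 / 2))
      ≤ ∫ θ in (0 : ℝ)..(√s)⁻¹, Real.exp (-s * (1 - Real.cos θ)) := by
    refine intervalIntegral.integral_mono_on (by positivity) (by simp) (hcont.intervalIntegrable _ _)
      fun θ hθ => Real.exp_le_exp.2 ?_
    have h2 := Real.one_sub_sq_div_two_le_cos (x := θ)
    have h3 : s * θ ^ 2 ≤ 1 := by
      have : θ ^ 2 ≤ (√s)⁻¹ ^ 2 := pow_le_pow_left₀ hθ.1 hθ.2 2
      rw [inv_pow, Real.sq_sqrt (by linarith)] at this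
      calc s * θ ^ 2 ≤ s * s⁻¹ := by gcongr
        _ = 1 := mul_inv_cancel₀ (by linarith)
    nlinarith
  have h2 : ∫ θ in (0 : ℝ)..(√s)⁻¹, Real.exp (-s * (1 - Real.cos θ))
      ≤ ∫ θ in (-Real.pi)..Real.pi, Real.exp (-s * (1 - Real.cos θ)) := by
    refine intervalIntegral.integral_mono_interval (by linarith) (by positivity) ?_
      (Eventually.of_forall fun _ => by positivity) (hcont.intervalIntegrable _ _)
    have : (√s)⁻¹ ≤ 1 := inv_le_one_of_one_le₀ hρ
    linarith [Real.pi_gt_three]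
  rw [intervalIntegral.integral_const, sub_zero, smul_eq_mul] at h1
  have he : (1 / 2 : ℝ) ≤ Real.exp (-(1 / 2)) := by
    have := Real.add_one_le_exp (-(1 / 2) : ℝ)
    linarith
  rw [hr, Complex.norm_real, Real.norm_of_nonneg (by
    have := (by positivity : 0 ≤ (√s)⁻¹ * Real.exp (-(1 / 2))).trans (h1.trans h2)
    positivity)]
  calc (√s)⁻¹ / 20 ≤ (2 * Real.pi)⁻¹ * ((√s)⁻¹ * (1 / 2)) := by
        rw [show (2 * Real.pi)⁻¹ * ((√s)⁻¹ * (1 / 2)) = (√s)⁻¹ * (4 * Real.pi)⁻¹ by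
          field_simp; norm_num, div_eq_mul_inv]
        gcongr
        linarith [Real.pi_le_four]
    _ ≤ _ := by
        gcongr
        exact le_trans (by gcongr) (h1.trans h2)

lemma norm_kernel_sub_zero_le {s : ℝ} (hs : 1 ≤ s) (m : ℤ) :
    ‖kernel s m - kernel s 0‖ ≤ |m| * (Real.exp 11 * (√s)⁻¹ ^ 2) := by
  have hnat : ∀ n : ℕ, ‖kernel s n - kernel s 0‖ ≤ n * (Real.exp 11 * (√s)⁻¹ ^ 2) := by
    intro n
    induction n with
    | zero => simp
    | succ n ih =>
      have h := norm_kernel_succ_sub_le (by linarith : 0 ≤ s) n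
      rw [max_eq_right hs] at h
      have h1 : Real.exp (-(|(n : ℤ)| / √s) : ℝ) ≤ 1 := Real.exp_le_one_iff.2 (by
        have : 0 ≤ ((|(n : ℤ)| : ℤ) : ℝ) / √s := by positivity
        linarith)
      have h2 : ‖kernel s (n + 1) - kernel s n‖ ≤ Real.exp 11 * (√s)⁻¹ ^ 2 :=
        h.trans (mul_le_of_le_one_right (by positivity) h1)
      calc _ = ‖(kernel s (n + 1) - kernel s n) + (kernel s n - kernel s 0)‖ := by
            push_cast; congr 1; ring
        _ ≤ _ := norm_add_le _ _
        _ ≤ _ := by push_cast; linarith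
  rcases le_total 0 m with h | h
  · obtain ⟨n, rfl⟩ := Int.eq_ofNat_of_zero_le h
    simpa using hnat n
  · obtain ⟨n, hn⟩ := Int.eq_ofNat_of_zero_le (neg_nonneg.2 h)
    obtain rfl : m = -n := by omega
    rw [kernel_neg]
    simpa using hnat n

/-- In this range of `m` the gradient bound changes the kernel by at most half of its lower bound at
the origin. -/
lemma kernel_lower {s : ℝ} (hs : 1 ≤ s) {m : ℤ} (hm : |m| * (40 * Real.exp 11) ≤ √s) :
    (√s)⁻¹ / 40 ≤ ‖kernel s m‖ := by
  have h1 := kernel_zero_lower hs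
  have h2 := norm_kernel_sub_zero_le hs m
  have h3 : ‖kernel s 0‖ - ‖kernel s m‖ ≤ ‖kernel s m - kernel s 0‖ := by
    rw [norm_sub_rev]; exact norm_sub_norm_le _ _
  have hρ : 0 < √s := Real.sqrt_pos.2 (by linarith)
  have h4 : |m| * (Real.exp 11 * (√s)⁻¹ ^ 2) ≤ (√s)⁻¹ / 40 := by
    calc |m| * (Real.exp 11 * (√s)⁻¹ ^ 2) = (|m| * (40 * Real.exp 11)) * ((√s)⁻¹ ^ 2 / 40) := by ring
      _ ≤ √s * ((√s)⁻¹ ^ 2 / 40) := by gcongr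
      _ = _ := by field_simp
  linarith

/-! ### Fourier representation of the walk and Poissonization -/

/-- Lebesgue measure on a period. -/
noncomputable abbrev periodMeasure : Measure ℝ := volume.restrict (Set.Ioc (-Real.pi) Real.pi)

/-- Lebesgue measure on the torus. -/
noncomputable abbrev torusMeasure (d : ℕ) : Measure (Fin d → ℝ) :=
  Measure.pi fun _ : Fin d => periodMeasure

/-- The character `θ ↦ exp (i m ⬝ θ)`. -/
noncomputable def character {d : ℕ} (m : Fin d → ℤ) (θ : Fin d → ℝ) : ℂ :=
  ∏ i, Complex.exp (Complex.I * m i * θ i)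

/-- The characteristic function of one step of simple random walk. -/
noncomputable def stepChar {d : ℕ} (θ : Fin d → ℝ) : ℂ := (∑ i, Complex.cos (θ i)) / d

lemma continuous_character {d : ℕ} (m : Fin d → ℤ) : Continuous (character m) := by
  unfold character; fun_prop

lemma continuous_stepChar {d : ℕ} : Continuous (stepChar (d := d)) := by
  unfold stepChar; fun_prop

lemma norm_character {d : ℕ} (m : Fin d → ℤ) (θ : Fin d → ℝ) : ‖character m θ‖ = 1 := by
  rw [character, norm_prod]
  refine Finset.prod_eq_one fun i _ => ?_
  rw [Complex.norm_exp]
  simp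

lemma norm_stepChar_le {d : ℕ} (θ : Fin d → ℝ) : ‖stepChar θ‖ ≤ 1 := by
  rw [stepChar, norm_div, Complex.norm_natCast]
  refine div_le_one_of_le₀ ((norm_sum_le _ _).trans ?_) (by positivity)
  calc _ ≤ ∑ _i : Fin d, (1 : ℝ) := by
        refine Finset.sum_le_sum fun i _ => ?_
        rw [← Complex.ofReal_cos, Complex.norm_real]
        exact Real.abs_cos_le_one _
    _ = d := by simp

lemma integrable_torus {d : ℕ} {f : (Fin d → ℝ) → ℂ} (hf : Continuous f) {C : ℝ}
    (hC : ∀ θ, ‖f θ‖ ≤ C) : Integrable f (torusMeasure d) :=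
  Integrable.of_bound hf.aestronglyMeasurable C (Eventually.of_forall hC)

lemma character_add_single {d : ℕ} (m : Fin d → ℤ) (i : Fin d) (a : ℤ) (θ : Fin d → ℝ) :
    character (m + Pi.single i a) θ = character m θ * Complex.exp (Complex.I * a * θ i) := by
  have : ∀ j, Complex.exp (Complex.I * ((m + Pi.single i a : Fin d → ℤ) j : ℤ) * θ j)
      = Complex.exp (Complex.I * m j * θ j)
        * (if j = i then Complex.exp (Complex.I * a * θ i) else 1) := by
    intro j
    split_ifs with h
    · subst h
      rw [← Complex.exp_add]
      simp only [Pi.add_apply, Pi.single_eq_same]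
      push_cast
      ring_nf
    · simp [h]
  simp only [character]
  rw [Finset.prod_congr rfl fun j _ => this j, Finset.prod_mul_distrib]
  simp

lemma integral_exp_int_period (m : ℤ) :
    ∫ θ, Complex.exp (Complex.I * m * θ) ∂periodMeasure = if m = 0 then 2 * (Real.pi : ℂ) else 0 := by
  rw [← intervalIntegral.integral_of_le (by linarith [Real.pi_pos])]
  split_ifs with h
  · subst h
    simp
    ring
  · have h0 : Complex.I * m ≠ 0 := mul_ne_zero Complex.I_ne_zero (by exact_mod_cast h)
    rw [integral_exp_mul_complex h0]
    have := exp_int_mul_add_two_pi m (-Real.pi)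
    rw [show (-Real.pi : ℂ) + 2 * Real.pi = Real.pi by ring] at this
    rw [this]
    simp

/-- Averaging over neighbours multiplies the integrand by `stepChar`, since the two neighbours in
direction `i` contribute `2 cos θ_i`; the case `n = 0` is orthogonality of characters. -/
lemma transition_fourier {d : ℕ} [NeZero d] (n : ℕ) (x y : Fin d → ℤ) :
    (transition n x y : ℂ) = (2 * Real.pi : ℂ)⁻¹ ^ d *
      ∫ θ, stepChar θ ^ n * character (x - y) θ ∂(torusMeasure d) := by
  have hpi : (2 * Real.pi : ℂ) ≠ 0 := by simp [Real.pi_ne_zero]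
  have hd : (d : ℂ) ≠ 0 := by exact_mod_cast NeZero.ne d
  induction n generalizing x with
  | zero =>
    simp only [pow_zero, one_mul, character]
    rw [integral_fintype_prod_eq_prod (fun i (θ : ℝ) => Complex.exp (Complex.I * (x - y) i * θ))]
    simp only [integral_exp_int_period, transition_zero]
    split_ifs with h
    · subst h
      simp only [sub_self, Pi.zero_apply, if_true, Finset.prod_const, Finset.card_univ,
        Fintype.card_fin]
      rw [← mul_pow, inv_mul_cancel₀ hpi]
      simp
    · obtain ⟨i, hi⟩ := Function.ne_iff.1 h
      rw [Finset.prod_eq_zero (Finset.mem_univ i)]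
      · simp
      · simp [sub_eq_zero, hi]
  | succ n ih =>
    have hint : ∀ m : Fin d → ℤ,
        Integrable (fun θ => stepChar θ ^ n * character m θ) (torusMeasure d) := fun m =>
      integrable_torus (C := 1) ((continuous_stepChar.pow n).mul (continuous_character m)) fun θ => by
        rw [norm_mul, norm_character, mul_one, norm_pow]
        exact pow_le_one₀ (norm_nonneg _) (norm_stepChar_le θ)
    rw [transition_succ, stepAverage]
    push_cast
    simp only [ih]
    have hsum : ∀ i : Fin d, (2 * Real.pi : ℂ)⁻¹ ^ d *
        (∫ θ, stepChar θ ^ n * character (x + Pi.single i 1 - y) θ ∂(torusMeasure d))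
        + (2 * Real.pi : ℂ)⁻¹ ^ d *
        (∫ θ, stepChar θ ^ n * character (x - Pi.single i 1 - y) θ ∂(torusMeasure d))
        = (2 * Real.pi : ℂ)⁻¹ ^ d * ∫ θ, stepChar θ ^ n * character (x - y) θ
            * (2 * Complex.cos (θ i)) ∂(torusMeasure d) := by
      intro i
      rw [← mul_add, ← integral_add (hint _) (hint _)]
      congr 2
      funext θ
      rw [show x + Pi.single i 1 - y = (x - y) + Pi.single i 1 by abel,
        show x - Pi.single i 1 - y = (x - y) + Pi.single i (-1) by rw [Pi.single_neg]; abel,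
        character_add_single, character_add_single, Complex.two_cos]
      push_cast
      ring_nf
    rw [Finset.sum_congr rfl fun i _ => hsum i, ← Finset.mul_sum, ← integral_finsetSum]
    · rw [mul_div_assoc, ← integral_div]
      congr 2
      funext θ
      rw [← Finset.mul_sum, ← Finset.mul_sum, pow_succ, stepChar]
      field_simp
    · intro i _
      refine integrable_torus (C := 2) (((continuous_stepChar.pow n).mul
        (continuous_character _)).mul (by fun_prop)) fun θ => ?_
      rw [norm_mul, norm_mul, norm_character, mul_one, norm_pow, norm_mul, ← Complex.ofReal_cos,
        Complex.norm_real]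
      have h1 := pow_le_one₀ (n := n) (norm_nonneg _) (norm_stepChar_le θ)
      have h2 := Real.abs_cos_le_one (θ i)
      calc _ ≤ 1 * (2 * 1 : ℝ) := by
            gcongr
            · simp
            · exact h2
        _ = 2 := by norm_num

/-- The product of one-dimensional heat kernels. -/
noncomputable def heatProd {d : ℕ} (t : ℝ) (m : Fin d → ℤ) : ℂ := ∏ i, kernel (t / d) (m i)

/-- Poissonization makes the coordinates independent: `e^{-t} ∑ t^n stepChar^n / n!` is `exp(-t (1 -
stepChar))`, which factors over coordinates, each running at speed `1/d`. All `d`-dimensional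
estimates then follow from the one-dimensional kernel. -/
lemma hasSum_poisson_transition {d : ℕ} [NeZero d] (t : ℝ) (x y : Fin d → ℤ) :
    HasSum (fun n : ℕ => ((Real.exp (-t) * (t ^ n / n.factorial) * transition n x y : ℝ) : ℂ))
      (heatProd t (x - y)) := by
  have hd : (d : ℂ) ≠ 0 := by exact_mod_cast NeZero.ne d
  set F : ℕ → (Fin d → ℝ) → ℂ := fun n θ =>
    (t ^ n / n.factorial : ℝ) * (stepChar θ ^ n * character (x - y) θ) with hF
  have hFn : ∀ n θ, ‖F n θ‖ ≤ |t| ^ n / n.factorial := fun n θ => by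
    rw [hF]
    simp only [norm_mul, norm_character, mul_one, norm_pow, Complex.norm_real, Real.norm_eq_abs,
      abs_div, abs_pow, Nat.abs_cast]
    exact mul_le_of_le_one_right (by positivity) (pow_le_one₀ (norm_nonneg _) (norm_stepChar_le θ))
  have hcont : ∀ n, Continuous (F n) := fun n =>
    continuous_const.mul ((continuous_stepChar.pow n).mul (continuous_character _))
  have hint : ∀ n, Integrable (F n) (torusMeasure d) := fun n => integrable_torus (hcont n) (hFn n)
  have hsummable : Summable fun n => ∫ θ, ‖F n θ‖ ∂(torusMeasure d) := by
    refine Summable.of_nonneg_of_le (fun n => integral_nonneg fun _ => norm_nonneg _)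
      (fun n => ?_) ((Real.summable_pow_div_factorial |t|).mul_left
        ((torusMeasure d).real Set.univ))
    calc _ ≤ ∫ _θ, |t| ^ n / n.factorial ∂(torusMeasure d) :=
          integral_mono (hint n).norm (integrable_const _) (hFn n)
      _ = _ := by simp
  have h := hasSum_integral_of_summable_integral_norm hint hsummable
  have h2 := (h.mul_left ((2 * Real.pi : ℂ)⁻¹ ^ d)).mul_left (Complex.exp (-t))
  convert! h2 using 1
  · funext n
    push_cast
    rw [transition_fourier, hF]
    simp only
    rw [integral_const_mul]
    push_cast
    ring
  · rw [← integral_const_mul, ← integral_const_mul, heatProd]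
    simp only [kernel]
    rw [Finset.prod_mul_distrib]
    simp only [Finset.prod_const, Finset.card_univ, Fintype.card_fin]
    rw [integral_const_mul, integral_const_mul, ← mul_assoc, mul_comm (Complex.exp (-t)), mul_assoc]
    congr 1
    rw [← integral_const_mul]
    have : ∀ i : Fin d, ∫ θ in (-Real.pi)..Real.pi, kernelIntegrand (t / d) ((x - y) i) θ
        = ∫ θ : ℝ, kernelIntegrand (t / d) ((x - y) i) θ ∂periodMeasure := fun i =>
      intervalIntegral.integral_of_le (by linarith [Real.pi_pos])
    rw [Finset.prod_congr rfl fun i _ => this i, ← integral_fintype_prod_eq_prod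
      (fun i (θ : ℝ) => kernelIntegrand (t / d) ((x - y) i) θ)]
    congr 1
    funext θ
    have hexp : ∑' n, F n θ = Complex.exp (t * stepChar θ) * character (x - y) θ := by
      rw [Complex.exp_eq_exp_ℂ, NormedSpace.exp_eq_tsum_div, ← tsum_mul_right]
      refine tsum_congr fun n => ?_
      rw [hF]
      simp only
      push_cast
      rw [mul_pow]
      ring
    rw [hexp, ← mul_assoc, ← Complex.exp_add]
    simp only [kernelIntegrand, Complex.exp_add]
    rw [Finset.prod_mul_distrib, ← Complex.exp_sum, character]
    congr 1
    rw [← Complex.exp_add]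
    congr 1
    rw [← Finset.mul_sum, Finset.sum_sub_distrib, stepChar]
    simp only [Finset.sum_const, Finset.card_univ, Fintype.card_fin, nsmul_eq_mul, mul_one]
    push_cast
    field_simp
    ring

lemma hasSum_heat {d : ℕ} [NeZero d] (t : ℝ) (x y : Fin d → ℤ) :
    HasSum (fun n : ℕ => Real.exp (-t) * (t ^ n / n.factorial) * transition n x y)
      (heatProd t (x - y)).re := by
  exact Complex.reCLM.hasSum (hasSum_poisson_transition t x y)

/-- As a Poisson mixture of probabilities the kernel is real and nonnegative. Integrating its norm
therefore recovers the Green function exactly, which the lower bound needs. -/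
lemma heatProd_re_eq_norm {d : ℕ} [NeZero d] {t : ℝ} (ht : 0 ≤ t) (m : Fin d → ℤ) :
    (heatProd t m).re = ‖heatProd t m‖ := by
  have h1 := hasSum_heat t m 0
  have h2 := Complex.imCLM.hasSum (hasSum_poisson_transition t m 0)
  simp only [Complex.imCLM_apply, Complex.ofReal_im, sub_zero] at h1 h2
  have h3 : (heatProd t m).im = 0 := h2.unique hasSum_zero
  have h4 : 0 ≤ (heatProd t m).re := h1.nonneg fun n => by
    have := transition_nonneg n m 0
    positivity
  rw [← Complex.re_add_im (heatProd t m), h3]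
  simp [abs_of_nonneg h4]

lemma lintegral_poisson (n : ℕ) :
    ∫⁻ t in Set.Ioi (0 : ℝ), ENNReal.ofReal (Real.exp (-t) * (t ^ n / n.factorial)) = 1 := by
  have hn : (n.factorial : ℝ) ≠ 0 := by exact_mod_cast n.factorial_ne_zero
  have hi := Real.GammaIntegral_convergent (s := n + 1) (by positivity)
  simp only [add_sub_cancel_right, Real.rpow_natCast] at hi
  have heq : ∀ t : ℝ, Real.exp (-t) * (t ^ n / n.factorial)
      = Real.exp (-t) * t ^ n * (n.factorial : ℝ)⁻¹ := fun t => by ring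
  simp only [heq]
  rw [← ofReal_integral_eq_lintegral_ofReal (hi.mul_const _), integral_mul_const]
  · have := Real.Gamma_eq_integral (s := n + 1) (by positivity)
    simp only [add_sub_cancel_right, Real.rpow_natCast] at this
    rw [← this, Real.Gamma_nat_eq_factorial, mul_inv_cancel₀ hn, ENNReal.ofReal_one]
  · filter_upwards [self_mem_ae_restrict measurableSet_Ioi] with t ht
    have : (0 : ℝ) < t := ht
    positivity

/-- Every Poisson weight `e^{-t} t^n / n!` has total time integral `1`. The identity is stated for
extended nonnegative values because finiteness is deduced from it. -/
lemma tsum_transition_eq_lintegral {d : ℕ} [NeZero d] (x y : Fin d → ℤ) :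
    ∑' n, ENNReal.ofReal (transition n x y)
      = ∫⁻ t in Set.Ioi (0 : ℝ), ENNReal.ofReal ‖heatProd t (x - y)‖ := by
  have h1 : ∀ t ∈ Set.Ioi (0 : ℝ), ENNReal.ofReal ‖heatProd t (x - y)‖
      = ∑' n : ℕ, ENNReal.ofReal (Real.exp (-t) * (t ^ n / n.factorial))
          * ENNReal.ofReal (transition n x y) := by
    intro t ht
    have ht' : (0 : ℝ) < t := ht
    have h := hasSum_heat t x y
    rw [← heatProd_re_eq_norm ht'.le, ← h.tsum_eq, ENNReal.ofReal_tsum_of_nonneg _ h.summable]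
    · exact tsum_congr fun n => ENNReal.ofReal_mul (by positivity)
    · intro n
      have := transition_nonneg n x y
      positivity
  rw [setLIntegral_congr_fun measurableSet_Ioi h1, lintegral_tsum]
  · refine tsum_congr fun n => ?_
    rw [lintegral_mul_const _ (by fun_prop), lintegral_poisson, one_mul]
  · intro n
    fun_prop

/-! ### Heat kernel bounds at the diffusive scale and their time integrals -/

/-- The diffusive length scale at time `t`. -/
noncomputable def heatScale (d : ℕ) (t : ℝ) : ℝ := √(max 1 (t / d))

lemma one_le_heatScale (d : ℕ) (t : ℝ) : 1 ≤ heatScale d t :=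
  Real.one_le_sqrt.2 (le_max_left _ _)

lemma heatScale_pos (d : ℕ) (t : ℝ) : 0 < heatScale d t := zero_lt_one.trans_le (one_le_heatScale d t)

/-- The sup norm on `ℤ^d`, bounded below by `1`. -/
noncomputable def radius {d : ℕ} (m : Fin d → ℤ) : ℝ := max 1 ‖m‖

lemma one_le_radius {d : ℕ} (m : Fin d → ℤ) : 1 ≤ radius m := le_max_left _ _

lemma norm_le_radius {d : ℕ} (m : Fin d → ℤ) : ‖m‖ ≤ radius m := le_max_right _ _

lemma radius_pos {d : ℕ} (m : Fin d → ℤ) : 0 < radius m := zero_lt_one.trans_le (one_le_radius m)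

lemma norm_le_sum_abs {d : ℕ} (m : Fin d → ℤ) : ‖m‖ ≤ ∑ i, (|m i| : ℝ) := by
  refine (pi_norm_le_iff_of_nonneg (by positivity)).2 fun i => ?_
  rw [Int.norm_eq_abs]
  exact Finset.single_le_sum (f := fun i => (|m i| : ℝ)) (fun i _ => abs_nonneg _) (Finset.mem_univ i)

lemma prod_exp_le {d : ℕ} (t : ℝ) (m : Fin d → ℤ) :
    ∏ i, Real.exp (-(|m i| / heatScale d t : ℝ))
      ≤ Real.exp 1 * Real.exp (-(radius m / heatScale d t)) := by
  have hρ := one_le_heatScale d t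
  rw [← Real.exp_sum, ← Real.exp_add, Finset.sum_neg_distrib, ← Finset.sum_div]
  refine Real.exp_le_exp.2 ?_
  have h : radius m ≤ 1 + ∑ i, (|m i| : ℝ) :=
    max_le (by have : 0 ≤ ∑ i, (|m i| : ℝ) := by positivity
               linarith) (by linarith [norm_le_sum_abs m])
  have h2 : radius m / heatScale d t ≤ (1 + ∑ i, (|m i| : ℝ)) / heatScale d t := by gcongr
  have h3 : 1 / heatScale d t ≤ 1 := (div_le_one (by linarith)).2 hρ
  rw [add_div] at h2
  simp only [Int.cast_abs]
  linarith

lemma norm_kernel_le_heatScale {d : ℕ} {t : ℝ} (ht : 0 ≤ t) (m : ℤ) :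
    ‖kernel (t / d) m‖
      ≤ Real.exp 11 * (heatScale d t)⁻¹ * Real.exp (-(|m| / heatScale d t)) := by
  refine (norm_kernel_le (by positivity) m).trans ?_
  have := heatScale_pos d t
  rw [heatScale] at *
  gcongr
  norm_num

lemma norm_heatProd_le {d : ℕ} {t : ℝ} (ht : 0 ≤ t) (m : Fin d → ℤ) :
    ‖heatProd t m‖ ≤ Real.exp 11 ^ (d + 1) *
      ((heatScale d t)⁻¹ ^ d * Real.exp (-(radius m / heatScale d t))) := by
  have hρ := heatScale_pos d t
  rw [heatProd, norm_prod]
  calc _ ≤ ∏ i, (Real.exp 11 * (heatScale d t)⁻¹ * Real.exp (-(|m i| / heatScale d t))) :=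
        Finset.prod_le_prod (fun _ _ => norm_nonneg _) fun i _ => norm_kernel_le_heatScale ht _
    _ = (Real.exp 11 * (heatScale d t)⁻¹) ^ d * ∏ i, Real.exp (-(|m i| / heatScale d t : ℝ)) := by
        rw [Finset.prod_mul_distrib]; simp
    _ ≤ (Real.exp 11 * (heatScale d t)⁻¹) ^ d *
          (Real.exp 11 * Real.exp (-(radius m / heatScale d t))) := by
        gcongr
        refine (prod_exp_le t m).trans ?_
        gcongr
        norm_num
    _ = _ := by rw [mul_pow]; ring

/-- Only the factor in direction `i` changes, and its difference carries the extra inverse power of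
the diffusive scale. -/
lemma norm_heatProd_sub_le {d : ℕ} {t : ℝ} (ht : 0 ≤ t) (m : Fin d → ℤ) (i : Fin d) :
    ‖heatProd t (m + Pi.single i 1) - heatProd t m‖ ≤ Real.exp 11 ^ (d + 1) *
      ((heatScale d t)⁻¹ ^ (d + 1) * Real.exp (-(radius m / heatScale d t))) := by
  have hρ := heatScale_pos d t
  have h1 : heatProd t (m + Pi.single i 1) - heatProd t m
      = (kernel (t / d) (m i + 1) - kernel (t / d) (m i))
        * ∏ j ∈ Finset.univ.erase i, kernel (t / d) (m j) := by
    rw [heatProd, heatProd, ← Finset.mul_prod_erase _ _ (Finset.mem_univ i),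
      ← Finset.mul_prod_erase Finset.univ (fun j => kernel (t / d) (m j)) (Finset.mem_univ i)]
    rw [sub_mul]
    congr 2
    · simp
    · refine Finset.prod_congr rfl fun j hj => ?_
      simp [Finset.ne_of_mem_erase hj]
  rw [h1, norm_mul, norm_prod]
  set E : Fin d → ℝ := fun j => Real.exp (-(|m j| / heatScale d t : ℝ)) with hE
  calc _ ≤ (Real.exp 11 * (heatScale d t)⁻¹ ^ 2 * E i)
        * ∏ j ∈ Finset.univ.erase i, (Real.exp 11 * (heatScale d t)⁻¹ * E j) := by
        refine mul_le_mul ?_ (Finset.prod_le_prod (fun _ _ => norm_nonneg _)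
          fun j _ => norm_kernel_le_heatScale ht _) (by positivity) (by positivity)
        exact norm_kernel_succ_sub_le (by positivity) _
    _ = (heatScale d t)⁻¹ * ((Real.exp 11 * (heatScale d t)⁻¹ * E i)
        * ∏ j ∈ Finset.univ.erase i, (Real.exp 11 * (heatScale d t)⁻¹ * E j)) := by ring
    _ = (heatScale d t)⁻¹ * ((Real.exp 11 * (heatScale d t)⁻¹) ^ d * ∏ j, E j) := by
        rw [Finset.mul_prod_erase Finset.univ (fun j => Real.exp 11 * (heatScale d t)⁻¹ * E j)
          (Finset.mem_univ i), Finset.prod_mul_distrib]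
        simp
    _ ≤ (heatScale d t)⁻¹ * ((Real.exp 11 * (heatScale d t)⁻¹) ^ d *
          (Real.exp 11 * Real.exp (-(radius m / heatScale d t)))) := by
        gcongr
        refine (prod_exp_le t m).trans ?_
        gcongr
        norm_num
    _ = _ := by rw [mul_pow]; ring

lemma continuous_heatScale (d : ℕ) : Continuous (heatScale d) := by
  unfold heatScale; fun_prop

/-- The time integral of `ρ^{-(b+2)} exp(-r/ρ)`, with `ρ` the diffusive scale, is of order `r^{-b}`. -/
lemma integral_heatScale_le (d b : ℕ) [NeZero d] (hb : 1 ≤ b) : ∃ C : ℝ, 0 < C ∧ ∀ r : ℝ, 1 ≤ r →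
    IntegrableOn (fun t => (heatScale d t)⁻¹ ^ (b + 2) * Real.exp (-(r / heatScale d t)))
      (Set.Ioi 0) ∧
    ∫ t in Set.Ioi 0, (heatScale d t)⁻¹ ^ (b + 2) * Real.exp (-(r / heatScale d t)) ≤ C / r ^ b := by
  have hd : (1 : ℝ) ≤ d := by exact_mod_cast Nat.one_le_iff_ne_zero.2 (NeZero.ne d)
  have hb' : (1 : ℝ) ≤ b := by exact_mod_cast hb
  refine ⟨(b + 2).factorial + d ^ (b + 2) * 2, by positivity, fun r hr => ?_⟩
  set f : ℝ → ℝ := fun t => (heatScale d t)⁻¹ ^ (b + 2) * Real.exp (-(r / heatScale d t)) with hf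
  have hρ := heatScale_pos d
  have hr0 : 0 < r := by linarith
  have hcont : Continuous f := by
    have := continuous_heatScale d
    have h0 : ∀ t, heatScale d t ≠ 0 := fun t => (hρ t).ne'
    exact (((this.inv₀ h0).pow _).mul (Real.continuous_exp.comp (continuous_const.div this h0).neg))
  have hf0 : ∀ t, 0 ≤ f t := fun t => by have := hρ t; positivity
  -- For times up to `r²` the exponential factor decides: `exp(-u) ≤ (b+2)! / u^{b+2}` at `u = r/ρ`
  -- cancels the powers of `ρ`.
  have h1 : ∀ t, f t ≤ (b + 2).factorial / r ^ (b + 2) := by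
    intro t
    have h := Real.pow_div_factorial_le_exp (x := r / heatScale d t) (by have := hρ t; positivity) (b + 2)
    rw [hf]
    simp only
    rw [Real.exp_neg, le_div_iff₀ (by positivity)]
    rw [div_le_iff₀ (by positivity), div_pow] at h
    have he := Real.exp_pos (r / heatScale d t)
    have := hρ t
    rw [div_eq_mul_inv, ← inv_pow] at h
    calc _ = (r ^ (b + 2) * (heatScale d t)⁻¹ ^ (b + 2)) * (Real.exp (r / heatScale d t))⁻¹ := by ring
      _ ≤ (Real.exp (r / heatScale d t) * (b + 2).factorial) * (Real.exp (r / heatScale d t))⁻¹ := by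
        gcongr
      _ = _ := by field_simp
  set p : ℝ := -(b / 2 + 1 : ℝ) with hp
  -- For times beyond `r²` the exponential is dropped and `ρ ≥ √(t/d)` leaves the power `-(b/2 +
  -- 1)`, integrable at infinity because `b ≥ 1`. In the Green function upper bound `b = d - 2`, so
  -- this is transience.
  have h2 : ∀ t : ℝ, 0 < t → f t ≤ d ^ (b + 2) * t ^ p := by
    intro t ht
    have hs : √(t / d) ≤ heatScale d t := Real.sqrt_le_sqrt (le_max_right _ _)
    have hs0 : 0 < √(t / d) := Real.sqrt_pos.2 (by positivity)
    have he : Real.exp (-(r / heatScale d t)) ≤ 1 := Real.exp_le_one_iff.2 (by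
      have : 0 ≤ r / heatScale d t := by have := hρ t; positivity
      linarith)
    calc f t ≤ (heatScale d t)⁻¹ ^ (b + 2) := mul_le_of_le_one_right (by have := hρ t; positivity) he
      _ ≤ (√(t / d))⁻¹ ^ (b + 2) := by
        have := hρ t
        gcongr
      _ = (√d) ^ (b + 2) * (√t)⁻¹ ^ (b + 2) := by
        rw [Real.sqrt_div ht.le, inv_div, div_eq_mul_inv, mul_pow]
      _ ≤ d ^ (b + 2) * (√t)⁻¹ ^ (b + 2) := by
        gcongr
        rw [Real.sqrt_le_left (by positivity)]
        nlinarith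
      _ = d ^ (b + 2) * t ^ p := by
        congr 1
        rw [Real.sqrt_eq_rpow, ← Real.rpow_neg ht.le, ← Real.rpow_natCast, ← Real.rpow_mul ht.le]
        congr 1
        rw [hp]; push_cast; ring
  have hp1 : p < -1 := by rw [hp]; linarith
  have hr2 : 0 < r ^ 2 := by positivity
  have hi1 : IntegrableOn f (Set.Ioc 0 (r ^ 2)) :=
    (hcont.integrableOn_Icc (a := 0) (b := r ^ 2)).mono_set Set.Ioc_subset_Icc_self
  have hipow := (integrableOn_Ioi_rpow_of_lt hp1 hr2).const_mul ((d : ℝ) ^ (b + 2))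
  have hi2 : IntegrableOn f (Set.Ioi (r ^ 2)) := by
    refine Integrable.mono' hipow hcont.aestronglyMeasurable ?_
    filter_upwards [self_mem_ae_restrict measurableSet_Ioi] with t ht
    rw [Real.norm_of_nonneg (hf0 t)]
    exact h2 t (hr2.trans ht)
  have hu : Set.Ioi (0 : ℝ) = Set.Ioc 0 (r ^ 2) ∪ Set.Ioi (r ^ 2) :=
    (Set.Ioc_union_Ioi_eq_Ioi hr2.le).symm
  refine ⟨hu ▸ hi1.union hi2, ?_⟩
  rw [hu, setIntegral_union (Set.Ioc_disjoint_Ioi le_rfl) measurableSet_Ioi hi1 hi2]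
  have hI1 : ∫ t in Set.Ioc 0 (r ^ 2), f t ≤ (b + 2).factorial / r ^ b := by
    calc _ ≤ ∫ _t in Set.Ioc 0 (r ^ 2), ((b + 2).factorial / r ^ (b + 2) : ℝ) :=
          setIntegral_mono hi1 (integrableOn_const (by simp)) h1
      _ = _ := by
        rw [setIntegral_const, measureReal_def, Real.volume_Ioc, sub_zero,
          ENNReal.toReal_ofReal hr2.le, smul_eq_mul]
        field_simp
        ring
  have hI2 : ∫ t in Set.Ioi (r ^ 2), f t ≤ d ^ (b + 2) * 2 / r ^ b := by
    calc _ ≤ ∫ t in Set.Ioi (r ^ 2), (d ^ (b + 2) * t ^ p : ℝ) :=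
          setIntegral_mono_on hi2 hipow measurableSet_Ioi fun t ht => h2 t (hr2.trans ht)
      _ = d ^ (b + 2) * ((r ^ b)⁻¹ * (2 / b)) := by
        rw [integral_const_mul, integral_Ioi_rpow_of_lt hp1 hr2]
        congr 1
        have e1 : p + 1 = -(b / 2 : ℝ) := by rw [hp]; ring
        rw [e1, Real.rpow_neg hr2.le, ← Real.rpow_natCast r 2, ← Real.rpow_mul hr0.le]
        rw [show ((2 : ℕ) : ℝ) * (b / 2) = (b : ℝ) by push_cast; ring, Real.rpow_natCast]
        field_simp
      _ ≤ d ^ (b + 2) * ((r ^ b)⁻¹ * 2) := by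
        gcongr
        exact div_le_self (by norm_num) hb'
      _ = _ := by ring
  rw [add_div]
  exact add_le_add hI1 hI2

/-! ### The Green function: upper, lower and gradient bounds -/

section Green

variable {d : ℕ} [NeZero d]

lemma measurable_kernel (m : ℤ) : Measurable fun s => kernel s m := by
  refine Measurable.const_mul ?_ _
  have hm : Measurable (Function.uncurry fun (s θ : ℝ) => kernelIntegrand s m θ) := by
    unfold kernelIntegrand
    fun_prop
  simp only [intervalIntegral.integral_of_le (show -Real.pi ≤ Real.pi by linarith [Real.pi_pos])]
  exact (hm.stronglyMeasurable.integral_prod_right).measurable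

omit [NeZero d] in
lemma measurable_heatProd (m : Fin d → ℤ) : Measurable fun t => heatProd t m := by
  unfold heatProd
  exact Finset.measurable_prod _ fun i _ => (measurable_kernel _).comp (by fun_prop)

lemma integrable_heatProd (hd : 3 ≤ d) (m : Fin d → ℤ) :
    IntegrableOn (fun t => heatProd t m) (Set.Ioi 0) := by
  obtain ⟨b, rfl⟩ : ∃ b, d = b + 2 := ⟨d - 2, by omega⟩
  obtain ⟨C, -, hC⟩ := integral_heatScale_le (b + 2) b (by omega)
  refine Integrable.mono' ((hC (radius m) (one_le_radius m)).1.const_mul (Real.exp 11 ^ (b + 2 + 1)))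
    (measurable_heatProd m).aestronglyMeasurable ?_
  filter_upwards [self_mem_ae_restrict measurableSet_Ioi] with t ht
  exact norm_heatProd_le (le_of_lt ht) m

/-- The time integral of the heat kernel converges in dimension at least three. The real `tsum` in
`green` is therefore a genuine sum and not the default value `0`. -/
lemma hasSum_transition (hd : 3 ≤ d) (x y : Fin d → ℤ) :
    HasSum (fun n => transition n x y) (green x y) ∧
      green x y = ∫ t in Set.Ioi (0 : ℝ), ‖heatProd t (x - y)‖ := by
  have h := tsum_transition_eq_lintegral x y
  have hi := (integrable_heatProd hd (x - y)).norm
  rw [← ofReal_integral_eq_lintegral_ofReal hi (Eventually.of_forall fun _ => norm_nonneg _)] at h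
  have hs : Summable fun n => transition n x y := by
    have := ENNReal.summable_toReal (f := fun n => ENNReal.ofReal (transition n x y))
      (by rw [h]; exact ENNReal.ofReal_ne_top)
    refine this.congr fun n => ENNReal.toReal_ofReal (transition_nonneg n x y)
  refine ⟨hs.hasSum, ?_⟩
  rw [← ENNReal.ofReal_tsum_of_nonneg (fun n => transition_nonneg n x y) hs] at h
  exact (ENNReal.ofReal_eq_ofReal_iff (tsum_nonneg fun n => transition_nonneg n x y)
    (integral_nonneg fun _ => norm_nonneg _)).1 h

omit [NeZero d] in
lemma heatProd_neg (t : ℝ) (m : Fin d → ℤ) : heatProd t (-m) = heatProd t m :=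
  Finset.prod_congr rfl fun _ _ => kernel_neg _ _

lemma green_comm (hd : 3 ≤ d) (x y : Fin d → ℤ) : green x y = green y x := by
  rw [(hasSum_transition hd x y).2, (hasSum_transition hd y x).2]
  simp only [← heatProd_neg _ (x - y), neg_sub]

omit [NeZero d] in
lemma green_nonneg (x y : Fin d → ℤ) : 0 ≤ green x y :=
  tsum_nonneg fun n => transition_nonneg n x y

lemma green_eq (hd : 3 ≤ d) (x y : Fin d → ℤ) :
    green x y = (if x = y then 1 else 0) + stepAverage (fun w => green w y) x := by
  have h0 := (hasSum_transition hd x y).1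
  have h1 := ((hasSum_nat_add_iff' 1).2 h0)
  simp only [Finset.range_one, Finset.sum_singleton, transition_zero] at h1
  have h2 : HasSum (fun n => transition (n + 1) x y) (stepAverage (fun w => green w y) x) := by
    simp only [transition_succ, stepAverage]
    refine HasSum.div_const (hasSum_sum fun i _ => ?_) _
    exact (hasSum_transition hd _ y).1.add (hasSum_transition hd _ y).1
  rw [← h1.unique h2]
  ring

lemma green_le (hd : 3 ≤ d) : ∃ C : ℝ, 0 < C ∧ ∀ x y : Fin d → ℤ,
    green x y ≤ C / radius (x - y) ^ (d - 2) := by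
  obtain ⟨b, rfl⟩ : ∃ b, d = b + 2 := ⟨d - 2, by omega⟩
  obtain ⟨C, hC0, hC⟩ := integral_heatScale_le (b + 2) b (by omega)
  refine ⟨Real.exp 11 ^ (b + 2 + 1) * C, by positivity, fun x y => ?_⟩
  obtain ⟨h1, h2⟩ := hC (radius (x - y)) (one_le_radius _)
  rw [(hasSum_transition hd x y).2, mul_div_assoc]
  calc _ ≤ ∫ t in Set.Ioi 0, Real.exp 11 ^ (b + 2 + 1) * ((heatScale (b + 2) t)⁻¹ ^ (b + 2)
        * Real.exp (-(radius (x - y) / heatScale (b + 2) t))) :=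
        setIntegral_mono_on (integrable_heatProd hd _).norm (h1.const_mul _) measurableSet_Ioi
          fun t ht => norm_heatProd_le (le_of_lt ht) _
    _ ≤ _ := by
        rw [integral_const_mul]
        exact mul_le_mul_of_nonneg_left h2 (by positivity)

lemma green_add_single_sub_le (hd : 3 ≤ d) : ∃ C : ℝ, 0 < C ∧ ∀ (x y : Fin d → ℤ) (i : Fin d),
    |green (x + Pi.single i 1) y - green x y| ≤ C / radius (x - y) ^ (d - 1) := by
  obtain ⟨b, rfl⟩ : ∃ b, d = b + 2 := ⟨d - 2, by omega⟩
  obtain ⟨C, hC0, hC⟩ := integral_heatScale_le (b + 2) (b + 1) (by omega)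
  refine ⟨Real.exp 11 ^ (b + 2 + 1) * C, by positivity, fun x y i => ?_⟩
  obtain ⟨h1, h2⟩ := hC (radius (x - y)) (one_le_radius _)
  rw [(hasSum_transition hd x y).2, (hasSum_transition hd _ y).2, mul_div_assoc,
    ← integral_sub (integrable_heatProd hd _).norm (integrable_heatProd hd _).norm,
    ← Real.norm_eq_abs]
  refine (norm_integral_le_of_norm_le (h1.const_mul (Real.exp 11 ^ (b + 2 + 1))) ?_).trans ?_
  · filter_upwards [self_mem_ae_restrict measurableSet_Ioi] with t ht
    refine (abs_norm_sub_norm_le _ _).trans ?_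
    rw [show x + Pi.single i 1 - y = x - y + Pi.single i 1 by abel]
    exact norm_heatProd_sub_le (le_of_lt ht) _ i
  · rw [integral_const_mul]
    exact mul_le_mul_of_nonneg_left h2 (by positivity)

/-- Only times of order `r²` are kept: on `(T, 2T]` with `T = d (A r)²`, every coordinate lies in
the range of `kernel_lower`, so each of the `d` factors is at least a constant over `r`. -/
lemma le_green (hd : 3 ≤ d) : ∃ c : ℝ, 0 < c ∧ ∀ x y : Fin d → ℤ,
    c / radius (x - y) ^ (d - 2) ≤ green x y := by
  set A : ℝ := 40 * Real.exp 11 with hA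
  have hA1 : 1 ≤ A := by
    have : (1 : ℝ) ≤ Real.exp 11 := Real.one_le_exp (by norm_num)
    linarith
  have hd0 : (0 : ℝ) < d := by exact_mod_cast Nat.pos_of_ne_zero (NeZero.ne d)
  refine ⟨d * A ^ 2 * ((2 * A)⁻¹ / 40) ^ d, by positivity, fun x y => ?_⟩
  set r := radius (x - y) with hr
  have hr1 : 1 ≤ r := one_le_radius _
  set T : ℝ := d * (A * r) ^ 2 with hT
  have hT0 : 0 < T := by positivity
  have hlow : ∀ t ∈ Set.Ioc T (2 * T), ((2 * (A * r))⁻¹ / 40) ^ d ≤ ‖heatProd t (x - y)‖ := by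
    intro t ht
    have hs1 : (A * r) ^ 2 ≤ t / d := by
      rw [le_div_iff₀ hd0]; linarith [ht.1]
    have hs2 : t / d ≤ (2 * (A * r)) ^ 2 := by
      rw [div_le_iff₀ hd0]
      nlinarith [ht.2]
    have hAr : 1 ≤ A * r := one_le_mul_of_one_le_of_one_le hA1 hr1
    have hs : 1 ≤ t / d := le_trans (by nlinarith) hs1
    have hsq1 : A * r ≤ √(t / d) := Real.le_sqrt_of_sq_le hs1
    have hsq2 : √(t / d) ≤ 2 * (A * r) := (Real.sqrt_le_left (by positivity)).2 hs2
    rw [heatProd, norm_prod]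
    calc _ = ∏ _i : Fin d, ((2 * (A * r))⁻¹ / 40) := by
          rw [Finset.prod_const, Finset.card_univ, Fintype.card_fin]
      _ ≤ _ := by
        refine Finset.prod_le_prod (fun _ _ => by positivity) fun i _ => ?_
        refine le_trans ?_ (kernel_lower hs (m := (x - y) i) ?_)
        · have : 0 < √(t / d) := by linarith
          gcongr
        · have h1 : (|(x - y) i| : ℝ) ≤ r := by
            refine le_trans ?_ (norm_le_radius _)
            have := norm_le_pi_norm (x - y) i
            rwa [Int.norm_eq_abs] at this
          rw [Int.cast_abs]
          calc _ ≤ r * A := by rw [hA]; gcongr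
            _ ≤ _ := by linarith
  have hi : IntegrableOn (fun t => ‖heatProd t (x - y)‖) (Set.Ioi 0) :=
    (integrable_heatProd hd (x - y)).norm
  rw [(hasSum_transition hd x y).2]
  have hsub : Set.Ioc T (2 * T) ⊆ Set.Ioi 0 := fun t ht => hT0.trans ht.1
  calc _ = T * ((2 * (A * r))⁻¹ / 40) ^ d := by
        have h1 : r ^ d = r ^ (d - 2) * r ^ 2 := by rw [← pow_add]; congr 1; omega
        have h2 : (2 * (A * r))⁻¹ / 40 = (2 * A)⁻¹ / 40 * r⁻¹ := by
          rw [← mul_assoc, mul_inv (2 * A) r]; ring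
        rw [hT, h2, mul_pow _ r⁻¹, inv_pow r, h1]
        generalize ((2 * A)⁻¹ / 40) ^ d = B
        field_simp
    _ = ∫ _t in Set.Ioc T (2 * T), ((2 * (A * r))⁻¹ / 40) ^ d := by
        rw [setIntegral_const, measureReal_def, Real.volume_Ioc,
          ENNReal.toReal_ofReal (by linarith), smul_eq_mul]
        ring
    _ ≤ ∫ t in Set.Ioc T (2 * T), ‖heatProd t (x - y)‖ :=
        setIntegral_mono_on (integrableOn_const (by simp)) (hi.mono_set hsub) measurableSet_Ioc hlow
    _ ≤ _ := setIntegral_mono_set hi (Eventually.of_forall fun _ => norm_nonneg _)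
        (Eventually.of_forall hsub)

end Green

/-- A function on `ℤ^d` with increments at most `M` along edges in a ball varies by at most
`M` times the `ℓ^1`-distance to the centre. -/
lemma abs_sub_le_of_increment_le {d : ℕ} {f : (Fin d → ℤ) → ℝ} {b : Fin d → ℤ} {ρ M : ℝ}
    (hf : ∀ w i, ‖w - b‖ ≤ ρ → |f (w + Pi.single i 1) - f w| ≤ M)
    (a : Fin d → ℤ) (ha : ‖a - b‖ ≤ ρ) : |f a - f b| ≤ M * ∑ i, |(a i - b i : ℝ)| := by
  obtain ⟨n, hn⟩ : ∃ n : ℕ, ∑ i, (a i - b i).natAbs = n := ⟨_, rfl⟩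
  induction n generalizing a with
  | zero =>
    have : a = b := by
      ext i
      have := (Finset.sum_eq_zero_iff.1 hn) i (Finset.mem_univ i)
      omega
    subst this
    simp
  | succ n ih =>
    obtain ⟨i, hi⟩ : ∃ i, a i ≠ b i := by
      by_contra! h
      simp [h] at hn
    have hle : ∀ a' : Fin d → ℤ, (∀ j, (a' j - b j).natAbs ≤ (a j - b j).natAbs) → ‖a' - b‖ ≤ ρ := by
      intro a' h
      refine le_trans ((pi_norm_le_iff_of_nonneg (norm_nonneg _)).2 fun j => ?_) ha
      refine le_trans ?_ (norm_le_pi_norm (a - b) j)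
      simp only [Pi.sub_apply, Int.norm_eq_abs, ← Int.cast_abs, Int.abs_eq_natAbs]
      exact_mod_cast h j
    have hsum : ∀ s : ℤ, (a i + s - b i).natAbs + 1 = (a i - b i).natAbs →
        (∑ j, ((a + Pi.single i s : Fin d → ℤ) j - b j).natAbs = n) ∧
        ∑ j, |(((a + Pi.single i s : Fin d → ℤ) j : ℤ) - b j : ℝ)| + 1 = ∑ j, |(a j - b j : ℝ)| := by
      intro s hs
      have e1 : ∑ j, ((a + Pi.single i s : Fin d → ℤ) j - b j).natAbs + 1
          = ∑ j, (a j - b j).natAbs := by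
        rw [← Finset.add_sum_erase _ _ (Finset.mem_univ i),
          ← Finset.add_sum_erase Finset.univ (fun j => (a j - b j).natAbs) (Finset.mem_univ i), ← hs]
        rw [Finset.sum_congr rfl fun j hj => by
          rw [Pi.add_apply, Pi.single_eq_of_ne (Finset.ne_of_mem_erase hj), add_zero]]
        simp only [Pi.add_apply, Pi.single_eq_same]
        ring
      refine ⟨by omega, ?_⟩
      have e2 : ∀ p q : ℤ, |(p - q : ℝ)| = ((p - q).natAbs : ℝ) := fun p q => by
        rw [Nat.cast_natAbs, Int.cast_abs, Int.cast_sub]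
      simp only [e2]
      exact_mod_cast e1
    have hmono : ∀ s : ℤ, (a i + s - b i).natAbs + 1 = (a i - b i).natAbs →
        ∀ j, ((a + Pi.single i s : Fin d → ℤ) j - b j).natAbs ≤ (a j - b j).natAbs := by
      intro s hs j
      by_cases hj : j = i
      · subst hj
        simp only [Pi.add_apply, Pi.single_eq_same]
        omega
      · simp [hj]
    rcases lt_or_gt_of_ne hi with h | h
    · have hs : (a i + 1 - b i).natAbs + 1 = (a i - b i).natAbs := by omega
      have h1 := ih _ (hle _ (hmono 1 hs)) (hsum 1 hs).1
      have h2 := hf a i ha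
      have h3 := abs_sub_le (f a) (f (a + Pi.single i 1)) (f b)
      rw [abs_sub_comm (f a) (f (a + Pi.single i 1))] at h3
      rw [← (hsum 1 hs).2]
      linarith
    · have hs : (a i + (-1) - b i).natAbs + 1 = (a i - b i).natAbs := by omega
      have h1 := ih _ (hle _ (hmono (-1) hs)) (hsum (-1) hs).1
      have h2 := hf (a + Pi.single i (-1)) i (hle _ (hmono (-1) hs))
      rw [add_assoc, ← Pi.single_add, show (-1 : ℤ) + 1 = 0 by norm_num, Pi.single_zero, add_zero] at h2
      have h3 := abs_sub_le (f a) (f (a + Pi.single i (-1))) (f b)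
      rw [← (hsum (-1) hs).2]
      linarith

/-! ### Discrete potential theory -/

section PotentialTheory

variable {d : ℕ} [NeZero d]

/-- The Green function is Lipschitz away from the pole. -/
lemma abs_green_sub_le (hd : 3 ≤ d) : ∃ C : ℝ, 0 < C ∧ ∀ a b y : Fin d → ℤ,
    ‖a - b‖ ≤ ‖b - y‖ / 2 → 0 < ‖b - y‖ → |green a y - green b y| ≤ C * ‖a - b‖ / ‖b - y‖ ^ (d - 1) := by
  obtain ⟨C, hC0, hC⟩ := green_add_single_sub_le (d := d) hd
  refine ⟨C * 2 ^ (d - 1) * d, by have := NeZero.pos d; positivity, fun a b y hab hb => ?_⟩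
  have h := abs_sub_le_of_increment_le (f := fun w => green w y) (b := b) (ρ := ‖b - y‖ / 2)
    (M := C / (‖b - y‖ / 2) ^ (d - 1)) ?_ a hab
  · refine h.trans ?_
    have hs : ∑ i, |(a i - b i : ℝ)| ≤ d * ‖a - b‖ := by
      calc _ ≤ ∑ _i : Fin d, ‖a - b‖ := Finset.sum_le_sum fun i _ => by
            have := norm_le_pi_norm (a - b) i
            rw [Int.norm_eq_abs] at this
            push_cast [Pi.sub_apply] at this
            exact this
        _ = _ := by simp
    calc _ ≤ C / (‖b - y‖ / 2) ^ (d - 1) * (d * ‖a - b‖) := by gcongr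
      _ = _ := by rw [div_pow]; field_simp
  · intro w i hw
    refine (hC w y i).trans ?_
    have : ‖b - y‖ / 2 ≤ radius (w - y) := by
      refine le_trans ?_ (norm_le_radius _)
      have := norm_sub_norm_le (b - y) (b - w)
      rw [show b - y - (b - w) = w - y by abel, norm_sub_rev b w] at this
      linarith
    gcongr

/-- The Green function is asymptotically constant at scales below the distance to the pole. -/
lemma abs_green_sub_le_mul_green (hd : 3 ≤ d) : ∃ C : ℝ, 0 < C ∧ ∀ a b y : Fin d → ℤ,
    ‖a - b‖ ≤ ‖b - y‖ / 2 → 1 ≤ ‖b - y‖ →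
      |green a y - green b y| ≤ C * (‖a - b‖ / ‖b - y‖) * green b y := by
  obtain ⟨C, hC0, hC⟩ := abs_green_sub_le (d := d) hd
  obtain ⟨c, hc0, hc⟩ := le_green (d := d) hd
  refine ⟨C / c, by positivity, fun a b y hab hb => ?_⟩
  have h1 := hC a b y hab (by linarith)
  have h2 := hc b y
  rw [radius, max_eq_right hb] at h2
  have hb0 : 0 < ‖b - y‖ := by linarith
  calc _ ≤ C * ‖a - b‖ / ‖b - y‖ ^ (d - 1) := h1
    _ = C / c * (‖a - b‖ / ‖b - y‖) * (c / ‖b - y‖ ^ (d - 2)) := by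
      have : d - 1 = d - 2 + 1 := by omega
      rw [this, pow_succ]
      field_simp
    _ ≤ _ := by gcongr

/-- First `b` and then `a` is moved; by the gradient bound each move costs a factor `1 + O(ε)`. It
is applied with `ε = 2/K`, to pass from sites of `B_z` to sites of `D_z`. -/
lemma green_le_green_add (hd : 3 ≤ d) : ∃ C : ℝ, 0 < C ∧ ∀ a b a' b' : Fin d → ℤ, ∀ ε : ℝ,
    1 ≤ ‖a - b‖ → ε ≤ 1 / 4 → ‖a' - a‖ ≤ ε * ‖a - b‖ → ‖b' - b‖ ≤ ε * ‖a - b‖ →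
      green a' b' ≤ (1 + C * ε) * green a b := by
  obtain ⟨C, hC0, hC⟩ := abs_green_sub_le_mul_green (d := d) hd
  refine ⟨3 * C + C * C, by positivity, fun a b a' b' ε hab hε ha hb => ?_⟩
  have hε0 : 0 ≤ ε := by
    by_contra! h
    nlinarith [norm_nonneg (a' - a)]
  have hN : 0 < ‖a - b‖ := by linarith
  have h1 := hC b' b a
  rw [norm_sub_rev b a] at h1
  have h1 := h1 (by nlinarith) hab
  rw [green_comm hd b' a, green_comm hd b a] at h1
  have hN2 : 3 / 4 * ‖a - b‖ ≤ ‖a - b'‖ := by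
    have := norm_sub_norm_le (a - b) (b' - b)
    rw [show a - b - (b' - b) = a - b' by abel] at this
    nlinarith
  by_cases h1' : 1 ≤ ‖a - b'‖
  · have h2 := hC a' a b' (by nlinarith) h1'
    have e1 : ‖b' - b‖ / ‖a - b‖ ≤ ε := by rwa [div_le_iff₀ hN]
    have e2 : ‖a' - a‖ / ‖a - b'‖ ≤ 2 * ε := by
      rw [div_le_iff₀ (by linarith)]
      nlinarith
    have hg := green_nonneg a b
    have hg' := green_nonneg a b'
    have f1 : green a b' ≤ (1 + C * ε) * green a b := by
      have := (abs_le.1 h1).2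
      have : C * (‖b' - b‖ / ‖a - b‖) * green a b ≤ C * ε * green a b := by gcongr
      linarith
    have f2 : green a' b' ≤ (1 + C * (2 * ε)) * green a b' := by
      have := (abs_le.1 h2).2
      have : C * (‖a' - a‖ / ‖a - b'‖) * green a b' ≤ C * (2 * ε) * green a b' := by gcongr
      linarith
    calc _ ≤ (1 + C * (2 * ε)) * ((1 + C * ε) * green a b) := f2.trans (by gcongr)
      _ = (1 + (3 * C) * ε + 2 * C * C * (ε * ε)) * green a b := by ring
      _ ≤ (1 + (3 * C) * ε + 2 * C * C * (ε * (1 / 4))) * green a b := by gcongr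
      _ ≤ _ := by
        refine mul_le_mul_of_nonneg_right ?_ hg
        nlinarith [mul_nonneg (mul_nonneg hC0.le hC0.le) hε0]
  -- Lattice points at distance below `1` coincide, which contradicts `‖a - b'‖ ≥ (3/4) ‖a - b‖`.
  · exfalso
    have : a = b' := by
      by_contra hne
      refine h1' ?_
      obtain ⟨i, hi⟩ := Function.ne_iff.1 hne
      refine le_trans ?_ (norm_le_pi_norm (a - b') i)
      rw [Int.norm_eq_abs]
      have : 1 ≤ |a i - b' i| := Int.one_le_abs (sub_ne_zero.2 hi)
      exact_mod_cast this
    rw [this, sub_self, norm_zero] at hN2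
    rw [this] at hN
    nlinarith

/-! ### Exit laws -/

/-- The outer boundary of a finite set. -/
def outerBoundary {d : ℕ} (U : Finset (Fin d → ℤ)) : Finset (Fin d → ℤ) :=
  (U.biUnion fun x => Finset.univ.biUnion fun i : Fin d => {x + Pi.single i 1, x - Pi.single i 1}) \ U

omit [NeZero d] in
lemma add_mem_outerBoundary {U : Finset (Fin d → ℤ)} {x : Fin d → ℤ} (hx : x ∈ U) (i : Fin d) :
    (x + Pi.single i 1 ∉ U → x + Pi.single i 1 ∈ outerBoundary U) ∧
      (x - Pi.single i 1 ∉ U → x - Pi.single i 1 ∈ outerBoundary U) := by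
  simp only [outerBoundary, Finset.mem_sdiff, Finset.mem_biUnion, Finset.mem_univ, true_and,
    Finset.mem_insert, Finset.mem_singleton]
  exact ⟨fun h => ⟨⟨x, hx, i, Or.inl rfl⟩, h⟩, fun h => ⟨⟨x, hx, i, Or.inr rfl⟩, h⟩⟩

omit [NeZero d] in
lemma mem_outerBoundary {U : Finset (Fin d → ℤ)} {y : Fin d → ℤ} (hy : y ∈ outerBoundary U) :
    y ∉ U ∧ ∃ x ∈ U, ∀ i, |y i - x i| ≤ 1 := by
  simp only [outerBoundary, Finset.mem_sdiff, Finset.mem_biUnion, Finset.mem_univ, true_and,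
    Finset.mem_insert, Finset.mem_singleton] at hy
  obtain ⟨⟨x, hx, i, h⟩, hyU⟩ := hy
  refine ⟨hyU, x, hx, fun j => ?_⟩
  by_cases hj : j = i
  · subst hj
    rcases h with rfl | rfl <;> simp
  · rcases h with rfl | rfl <;> simp [hj]

/-- A function that is harmonic in `U` and vanishes on the outer boundary vanishes in `U`. -/
lemma eq_zero_of_harmonic {U : Finset (Fin d → ℤ)} {v : (Fin d → ℤ) → ℝ}
    (hv : ∀ x ∈ U, v x = stepAverage v x) (hb : ∀ x ∈ outerBoundary U, v x = 0)
    {x : Fin d → ℤ} (hx : x ∈ U) : v x = 0 := by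
  classical
  have key : ∀ v : (Fin d → ℤ) → ℝ, (∀ x ∈ U, v x = stepAverage v x) →
      (∀ x ∈ outerBoundary U, v x = 0) → ∀ x ∈ U, v x ≤ 0 := by
    intro v hv hb x hx
    -- Extension by zero outside `U` agrees with `v` at all neighbours of points of `U`, and has
    -- finite superlevel sets, so the maximum principle on the whole lattice applies.
    set u : (Fin d → ℤ) → ℝ := fun y => if y ∈ U then v y else 0 with hu
    have hub : ∀ y, (y ∉ U → y ∈ outerBoundary U) → u y = v y := fun y hy => by
      by_cases h : y ∈ U
      · simp [hu, h]
      · simp [hu, h, hb y (hy h)]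
    have h := nonpos_of_le_stepAverage (v := u) ?_ ?_ x
    · simpa [hu, hx] using h
    · intro ε hε
      refine U.finite_toSet.subset fun y hy => ?_
      by_contra h
      have h' : y ∉ U := h
      have : ε ≤ u y := hy
      simp only [hu, h', if_false] at this
      linarith
    · intro y hy
      have hyU : y ∈ U := by
        by_contra h
        simp [hu, h] at hy
      rw [stepAverage_congr (g := v) fun i => ⟨hub _ (add_mem_outerBoundary hyU i).1,
        hub _ (add_mem_outerBoundary hyU i).2⟩, ← hv y hyU]
      simp [hu, hyU]
  refine le_antisymm (key v hv hb x hx) ?_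
  have hz : ∀ x, stepAverage (fun y => -v y) x = -stepAverage v x := fun x => by
    have := stepAverage_mul_const v x (-1)
    simpa using this
  have := key (fun y => -v y) (fun y hy => by rw [hz, ← hv y hy]) (fun y hy => by simp [hb y hy]) x hx
  linarith

omit [NeZero d] in
lemma measurableSet_coord (n : ℕ) (s : Set (Fin d → ℤ)) :
    MeasurableSet {X : ℕ → Fin d → ℤ | X n ∈ s} :=
  measurable_pi_apply n (Set.to_countable s).measurableSet

omit [NeZero d] in
lemma measurableSet_exit (U : Finset (Fin d → ℤ)) (y : Fin d → ℤ) :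
    MeasurableSet {X : ℕ → Fin d → ℤ | ∃ n : ℕ, X n ∉ U ∧ (∀ m < n, X m ∈ U) ∧ X n = y} := by
  have : {X : ℕ → Fin d → ℤ | ∃ n : ℕ, X n ∉ U ∧ (∀ m < n, X m ∈ U) ∧ X n = y}
      = ⋃ n : ℕ, ({X | X n ∈ ((U : Set (Fin d → ℤ)))ᶜ} ∩ ((⋂ m : ℕ, ⋂ _ : m < n, {X | X m ∈ (U : Set (Fin d → ℤ))})
        ∩ {X | X n ∈ ({y} : Set (Fin d → ℤ))})) := by
    ext X
    simp
  rw [this]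
  exact MeasurableSet.iUnion fun n => (measurableSet_coord _ _).inter
    ((MeasurableSet.iInter fun m => MeasurableSet.iInter fun _ => measurableSet_coord _ _).inter
      (measurableSet_coord _ _))

lemma exitLaw_of_mem {U : Finset (Fin d → ℤ)} {x : Fin d → ℤ} (hx : x ∈ U) (y : Fin d → ℤ) :
    exitLaw U x y = stepAverage (fun w => exitLaw U w y) x := by
  have h := srw_real_shift x (measurableSet_exit U y)
  simp only [exitLaw]
  rw [← h]
  refine measureReal_congr ?_
  filter_upwards [srw_ae_zero x] with X hX
  refine propext ⟨?_, ?_⟩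
  · rintro ⟨n, h1, h2, h3⟩
    cases n with
    | zero => rw [hX] at h1; exact absurd hx h1
    | succ n => exact ⟨n, h1, fun m hm => h2 (m + 1) (by omega), h3⟩
  · rintro ⟨n, h1, h2, h3⟩
    refine ⟨n + 1, h1, fun m hm => ?_, h3⟩
    cases m with
    | zero => rwa [hX]
    | succ m => exact h2 m (by omega)

lemma exitLaw_of_notMem {U : Finset (Fin d → ℤ)} {x : Fin d → ℤ} (hx : x ∉ U) (y : Fin d → ℤ) :
    exitLaw U x y = if x = y then 1 else 0 := by
  classical
  have h := srw_real_zero x (s := {y})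
  rw [Set.indicator_apply] at h
  simp only [Set.mem_singleton_iff, Pi.one_apply] at h
  rw [← h, exitLaw]
  refine measureReal_congr ?_
  filter_upwards [srw_ae_zero x] with X hX
  refine propext ⟨?_, fun h => ⟨0, hX ▸ hx, by simp, h⟩⟩
  rintro ⟨n, h1, h2, h3⟩
  cases n with
  | zero => exact h3
  | succ n => exact absurd (hX ▸ h2 0 (by omega)) hx

omit [NeZero d] in
lemma exitLaw_nonneg (U : Finset (Fin d → ℤ)) (x y : Fin d → ℤ) : 0 ≤ exitLaw U x y :=
  measureReal_nonneg

/-- In the starting point, the exit law is harmonic with zero boundary values. The series defining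
`harmonicAverage` is therefore a finite sum. -/
lemma exitLaw_eq_zero {U : Finset (Fin d → ℤ)} {x y : Fin d → ℤ} (hx : x ∈ U)
    (hy : y ∉ outerBoundary U) : exitLaw U x y = 0 :=
  eq_zero_of_harmonic (v := fun x => exitLaw U x y) (fun _ hx => exitLaw_of_mem hx y) (fun z hz => by
    rw [exitLaw_of_notMem (mem_outerBoundary hz).1, if_neg]
    rintro rfl
    exact hy hz) hx

/-- The Poisson representation of harmonic functions in a finite set. -/
lemma sum_exitLaw_mul {U : Finset (Fin d → ℤ)} {v : (Fin d → ℤ) → ℝ}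
    (hv : ∀ x ∈ U, v x = stepAverage v x) {x : Fin d → ℤ} (hx : x ∈ U) :
    ∑ y ∈ outerBoundary U, exitLaw U x y * v y = v x := by
  have h := eq_zero_of_harmonic (U := U)
    (v := fun x => ∑ y ∈ outerBoundary U, exitLaw U x y * v y - v x) ?_ ?_ hx
  · exact sub_eq_zero.1 h
  · intro x hx
    rw [stepAverage_sub, stepAverage_sum, ← hv x hx]
    congr 1
    refine Finset.sum_congr rfl fun y _ => ?_
    rw [stepAverage_mul_const, exitLaw_of_mem hx]
  · intro x hx
    rw [Finset.sum_eq_single x, exitLaw_of_notMem (mem_outerBoundary hx).1]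
    · simp
    · intro y _ hy
      rw [exitLaw_of_notMem (mem_outerBoundary hx).1, if_neg (Ne.symm hy), zero_mul]
    · exact fun h => absurd hx h

/-- The Poisson representation of the constant `1`; it shows that the walk leaves a finite set
almost surely. -/
lemma sum_exitLaw {U : Finset (Fin d → ℤ)} {x : Fin d → ℤ} (hx : x ∈ U) :
    ∑ y ∈ outerBoundary U, exitLaw U x y = 1 := by
  have := sum_exitLaw_mul (U := U) (v := fun _ => 1) (fun x _ => (stepAverage_const x 1).symm) hx
  simpa using this

/-- The Green function is harmonic away from its pole, which here lies outside `U`. Every covariance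
computation for harmonic averages rests on this identity. -/
lemma sum_exitLaw_green (hd : 3 ≤ d) {U : Finset (Fin d → ℤ)} {x w : Fin d → ℤ} (hx : x ∈ U)
    (hw : w ∉ U) : ∑ y ∈ outerBoundary U, exitLaw U x y * green y w = green x w :=
  sum_exitLaw_mul (v := fun x => green x w) (fun x hx => by
    rw [green_eq hd, if_neg (by rintro rfl; exact hw hx), zero_add]) hx

lemma harmonicAverage_eq_sum {U : Finset (Fin d → ℤ)} {x : Fin d → ℤ} (hx : x ∈ U)
    (φ : (Fin d → ℤ) → ℝ) :
    harmonicAverage U φ x = ∑ y ∈ outerBoundary U, exitLaw U x y * φ y :=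
  tsum_eq_sum fun y hy => by rw [exitLaw_eq_zero hx hy, zero_mul]

/-! ### Equilibrium measures -/

/-- The probability that the walk from `x` visits `A`. -/
noncomputable def hitting {d : ℕ} (A : Finset (Fin d → ℤ)) (x : Fin d → ℤ) : ℝ :=
  (srw x).real {X | ∃ n, X n ∈ A}

omit [NeZero d] in
lemma measurableSet_hit (A : Finset (Fin d → ℤ)) :
    MeasurableSet {X : ℕ → Fin d → ℤ | ∃ n, X n ∈ A} := by
  have : {X : ℕ → Fin d → ℤ | ∃ n, X n ∈ A} = ⋃ n, {X | X n ∈ (A : Set (Fin d → ℤ))} := by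
    ext; simp
  rw [this]
  exact MeasurableSet.iUnion fun n => measurableSet_coord _ _

lemma hitting_of_mem {A : Finset (Fin d → ℤ)} {x : Fin d → ℤ} (hx : x ∈ A) : hitting A x = 1 := by
  have : hitting A x = (srw x).real Set.univ := by
    refine measureReal_congr ?_
    filter_upwards [srw_ae_zero x] with X hX
    exact propext ⟨fun _ => trivial, fun _ => ⟨0, hX ▸ hx⟩⟩
  rw [this]
  simp

/-- Off `A` the hitting probability is harmonic; on `A` it is `1`, and the chance of never returning
is the equilibrium measure. -/
lemma hitting_eq (A : Finset (Fin d → ℤ)) (x : Fin d → ℤ) :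
    hitting A x = equilibrium A x + stepAverage (hitting A) x := by
  have h := srw_real_shift x (measurableSet_hit A)
  have h' : stepAverage (hitting A) x = (srw x).real {X | ∃ n, X (n + 1) ∈ A} := h.symm
  have hm : MeasurableSet {X : ℕ → Fin d → ℤ | ∃ n, X (n + 1) ∈ A} :=
    (show Measurable (fun (X : ℕ → Fin d → ℤ) n => X (n + 1)) by fun_prop) (measurableSet_hit A)
  by_cases hx : x ∈ A
  · rw [hitting_of_mem hx, h', equilibrium, if_pos hx]
    have hc : {X : ℕ → Fin d → ℤ | ∀ n : ℕ, 1 ≤ n → X n ∉ A} = {X | ∃ n, X (n + 1) ∈ A}ᶜ := by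
      ext X
      simp only [Set.mem_ofPred_eq, Set.mem_compl_iff, not_exists]
      refine ⟨fun h n => h (n + 1) (by omega), fun h n hn => ?_⟩
      obtain ⟨k, rfl⟩ : ∃ k, n = k + 1 := ⟨n - 1, by omega⟩
      exact h k
    rw [hc, probReal_compl_eq_one_sub hm]
    ring
  · rw [h', equilibrium, if_neg hx, zero_add]
    refine measureReal_congr ?_
    filter_upwards [srw_ae_zero x] with X hX
    refine propext ⟨?_, fun ⟨n, hn⟩ => ⟨n + 1, hn⟩⟩
    rintro ⟨n, hn⟩
    cases n with
    | zero => rw [hX] at hn; exact absurd hn hx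
    | succ n => exact ⟨n, hn⟩

omit [NeZero d] in
lemma hitting_nonneg (A : Finset (Fin d → ℤ)) (x : Fin d → ℤ) : 0 ≤ hitting A x :=
  measureReal_nonneg

/-- A union bound over sites and times. It supplies the decay at infinity that the maximum principle
requires. -/
lemma hitting_le_sum_green (hd : 3 ≤ d) (A : Finset (Fin d → ℤ)) (x : Fin d → ℤ) :
    hitting A x ≤ ∑ y ∈ A, green x y := by
  have h1 : srw x {X | ∃ n, X n ∈ A} ≤ ∑ y ∈ A, ∑' n, srw x {X | X n = y} := by
    have : {X : ℕ → Fin d → ℤ | ∃ n, X n ∈ A} ⊆ ⋃ y ∈ A, ⋃ n, {X | X n = y} := by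
      rintro X ⟨n, hn⟩
      simp only [Set.mem_iUnion]
      exact ⟨X n, hn, n, rfl⟩
    exact (measure_mono this).trans ((measure_biUnion_finset_le _ _).trans
      (Finset.sum_le_sum fun y _ => measure_iUnion_le _))
  have h2 : ∀ y, ∑' n, srw x {X | X n = y} = ENNReal.ofReal (green x y) := fun y => by
    have h := (hasSum_transition hd x y).1
    rw [← h.tsum_eq, ENNReal.ofReal_tsum_of_nonneg (fun n => transition_nonneg n x y) h.summable]
    exact tsum_congr fun n => (ofReal_measureReal (measure_ne_top _ _)).symm
  simp only [h2] at h1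
  rw [← ENNReal.ofReal_sum_of_nonneg fun y _ => green_nonneg x y] at h1
  exact ENNReal.toReal_le_of_le_ofReal (Finset.sum_nonneg fun y _ => green_nonneg x y) h1

omit [NeZero d] in
lemma equilibrium_nonneg (A : Finset (Fin d → ℤ)) (x : Fin d → ℤ) : 0 ≤ equilibrium A x := by
  rw [equilibrium]; split_ifs
  exacts [measureReal_nonneg, le_rfl]

omit [NeZero d] in
lemma equilibrium_of_notMem {A : Finset (Fin d → ℤ)} {x : Fin d → ℤ} (hx : x ∉ A) :
    equilibrium A x = 0 := if_neg hx

lemma equilibrium_le_one (A : Finset (Fin d → ℤ)) (x : Fin d → ℤ) : equilibrium A x ≤ 1 := by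
  rw [equilibrium]; split_ifs
  exacts [measureReal_le_one, zero_le_one]

lemma equilibrium_anti {A B : Finset (Fin d → ℤ)} (h : A ⊆ B) {x : Fin d → ℤ} (hx : x ∈ A) :
    equilibrium B x ≤ equilibrium A x := by
  rw [equilibrium, equilibrium, if_pos hx, if_pos (h hx)]
  exact measureReal_mono fun X hX n hn hA => hX n hn (h hA)

/-- The Green function tends to `0` at infinity, so a finite sum of its translates exceeds `ε` only
on a bounded set: this is the finiteness hypothesis of the maximum principle. -/
lemma finite_le_sum_green (hd : 3 ≤ d) (A : Finset (Fin d → ℤ)) {ε : ℝ} (hε : 0 < ε) :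
    {x | ε ≤ ∑ y ∈ A, green x y}.Finite := by
  obtain ⟨C, hC0, hC⟩ := green_le (d := d) hd
  have h1 : ∀ y : Fin d → ℤ, ∀ δ > 0, {x | δ ≤ green x y}.Finite := by
    intro y δ hδ
    refine ((isCompact_closedBall y (C / δ)).finite_of_discrete).subset fun x hx => ?_
    have hx' : δ ≤ green x y := hx
    rw [Metric.mem_closedBall, dist_eq_norm]
    have h2 : radius (x - y) ≤ radius (x - y) ^ (d - 2) :=
      le_self_pow₀ (one_le_radius _) (by omega)
    have h3 := hx'.trans (hC x y)
    have hr := radius_pos (x - y)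
    rw [le_div_iff₀ (by positivity)] at h3
    rw [le_div_iff₀ hδ, mul_comm]
    exact (mul_le_mul_of_nonneg_left ((norm_le_radius _).trans h2) hδ.le).trans h3
  refine (A.finite_toSet.biUnion fun y _ => h1 y (ε / (A.card + 1)) (by positivity)).subset
    fun x hx => ?_
  by_contra hcon
  simp only [Set.mem_iUnion, not_exists, Set.mem_ofPred_eq, not_le] at hcon
  have hx' : ε ≤ ∑ y ∈ A, green x y := hx
  have h2 : ∑ y ∈ A, green x y ≤ ∑ _y ∈ A, ε / (A.card + 1) :=
    Finset.sum_le_sum fun y hy => (hcon y hy).le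
  rw [Finset.sum_const, nsmul_eq_mul, ← mul_div_assoc] at h2
  have h3 : A.card * ε / (A.card + 1) < ε := by
    rw [div_lt_iff₀ (by positivity)]
    nlinarith
  linarith

/-- Both sides solve `u = e_A + stepAverage u` and lie between `0` and a finite sum of Green
functions. Their difference is harmonic and vanishes at infinity, and the maximum principle is
applied to it with both signs. -/
lemma sum_green_mul_equilibrium (hd : 3 ≤ d) (A : Finset (Fin d → ℤ)) (x : Fin d → ℤ) :
    ∑ y ∈ A, green x y * equilibrium A y = hitting A x := by
  classical
  set V : (Fin d → ℤ) → ℝ := fun x => ∑ y ∈ A, green x y * equilibrium A y with hV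
  have hVle : ∀ x, V x ≤ ∑ y ∈ A, green x y := fun x => Finset.sum_le_sum fun y _ =>
    mul_le_of_le_one_right (green_nonneg x y) (equilibrium_le_one A y)
  have hV0 : ∀ x, 0 ≤ V x := fun x => Finset.sum_nonneg fun y _ =>
    mul_nonneg (green_nonneg x y) (equilibrium_nonneg A y)
  have hVeq : ∀ x, V x = equilibrium A x + stepAverage V x := by
    intro x
    simp only [hV]
    rw [stepAverage_sum]
    simp only [stepAverage_mul_const]
    have : equilibrium A x = ∑ y ∈ A, (if x = y then 1 else 0) * equilibrium A y := by
      by_cases hx : x ∈ A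
      · simp [hx]
      · simp [hx, equilibrium_of_notMem hx]
    rw [this, ← Finset.sum_add_distrib]
    exact Finset.sum_congr rfl fun y _ => by rw [green_eq hd x y]; ring
  refine le_antisymm (sub_nonpos.1 ?_) (sub_nonpos.1 ?_)
  · refine nonpos_of_le_stepAverage (v := fun x => V x - hitting A x) (fun ε hε => ?_)
      (fun x _ => ?_) x
    · refine (finite_le_sum_green hd A hε).subset fun y hy => ?_
      have hy' : ε ≤ V y - hitting A y := hy
      have h1 := hitting_nonneg A y
      have h2 := hVle y
      show ε ≤ _
      linarith
    · rw [stepAverage_sub]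
      have h1 := hVeq x
      have h2 := hitting_eq A x
      change _ ≤ stepAverage V x - stepAverage (hitting A) x
      linarith
  · refine nonpos_of_le_stepAverage (v := fun x => hitting A x - V x) (fun ε hε => ?_)
      (fun x _ => ?_) x
    · refine (finite_le_sum_green hd A hε).subset fun y hy => ?_
      have hy' : ε ≤ hitting A y - V y := hy
      have h1 := hitting_le_sum_green hd A y
      have h2 := hV0 y
      show ε ≤ _
      linarith
    · rw [stepAverage_sub]
      have h1 := hVeq x
      have h2 := hitting_eq A x
      change _ ≤ stepAverage (hitting A) x - stepAverage V x
      linarith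

lemma sum_green_mul_equilibrium_of_mem (hd : 3 ≤ d) {A : Finset (Fin d → ℤ)} {x : Fin d → ℤ}
    (hx : x ∈ A) : ∑ y ∈ A, green x y * equilibrium A y = 1 := by
  rw [sum_green_mul_equilibrium hd, hitting_of_mem hx]

lemma capacity_pos (hd : 3 ≤ d) {A : Finset (Fin d → ℤ)} (hA : A.Nonempty) : 0 < capacity A := by
  obtain ⟨x, hx⟩ := hA
  have h := sum_green_mul_equilibrium_of_mem hd hx
  by_contra! hc
  have h0 := (Finset.sum_eq_zero_iff_of_nonneg fun y _ => equilibrium_nonneg A y).1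
    (le_antisymm hc (Finset.sum_nonneg fun y _ => equilibrium_nonneg A y))
  rw [Finset.sum_eq_zero fun y hy => by rw [h0 y hy, mul_zero]] at h
  exact zero_ne_one h

end PotentialTheory

/-! ### Gaussian semigroup and exponential moments over a short increment -/

section Concentration

variable {ι : Type*} [Fintype ι]

/-- The heat semigroup of a centered Gaussian measure `μ`. -/
noncomputable def gaussAverage (μ : Measure (ι → ℝ)) (s : ℝ) (G : (ι → ℝ) → ℝ) (x : ι → ℝ) : ℝ :=
  ∫ y, G (x + √s • y) ∂μ

section Integrability

variable (μ : Measure (ι → ℝ)) [IsGaussian μ]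

/-- Fernique's theorem gives an integrable `exp(C ‖y‖²)`; completing the square dominates the linear
exponent. -/
lemma integrable_exp_mul_norm (c : ℝ) : Integrable (fun y => Real.exp (c * ‖y‖)) μ := by
  obtain ⟨C, hC, hint⟩ := IsGaussian.exists_integrable_exp_sq μ
  refine (hint.const_mul (Real.exp (c ^ 2 / (4 * C)))).mono' (by fun_prop) (Eventually.of_forall ?_)
  intro y
  rw [Real.norm_of_nonneg (by positivity), ← Real.exp_add]
  refine Real.exp_le_exp.2 ?_
  have : c ^ 2 / (4 * C) + C * ‖y‖ ^ 2 - c * ‖y‖ = (c - 2 * C * ‖y‖) ^ 2 / (4 * C) := by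
    field_simp
    ring
  have h2 : 0 ≤ (c - 2 * C * ‖y‖) ^ 2 / (4 * C) := by positivity
  linarith

lemma integrable_of_le_exp_norm {f : (ι → ℝ) → ℝ} (hf : Continuous f) {D c : ℝ}
    (h : ∀ y, |f y| ≤ D * Real.exp (c * ‖y‖)) : Integrable f μ :=
  ((integrable_exp_mul_norm μ c).const_mul D).mono' hf.aestronglyMeasurable (Eventually.of_forall h)

lemma integrable_pow_mul_exp_norm (k : ℕ) (a c : ℝ) (ha : 0 ≤ a) :
    Integrable (fun y => (‖y‖ + a) ^ k * Real.exp (c * (‖y‖ + a))) μ := by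
  refine integrable_of_le_exp_norm μ (D := k.factorial * Real.exp ((1 + c) * a)) (c := 1 + c)
    (by fun_prop) fun y => ?_
  have h := Real.pow_div_factorial_le_exp (x := ‖y‖ + a) (by positivity) k
  rw [div_le_iff₀ (by positivity)] at h
  rw [abs_of_nonneg (by positivity)]
  calc _ ≤ Real.exp (‖y‖ + a) * k.factorial * Real.exp (c * (‖y‖ + a)) := by gcongr
    _ = k.factorial * (Real.exp (‖y‖ + a) * Real.exp (c * (‖y‖ + a))) := by ring
    _ = k.factorial * (Real.exp ((1 + c) * a) * Real.exp ((1 + c) * ‖y‖)) := by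
      rw [← Real.exp_add, ← Real.exp_add]; ring_nf
    _ = _ := by ring

lemma integrable_norm_pow (k : ℕ) : Integrable (fun y : ι → ℝ => ‖y‖ ^ k) μ := by
  simpa using integrable_pow_mul_exp_norm μ k 0 0 le_rfl

variable {G : (ι → ℝ) → ℝ} (hG : LipschitzWith 1 G)

include hG in
omit [IsGaussian μ] in
lemma abs_sub_le_of_lipschitz {s : ℝ} (x y : ι → ℝ) : |G (x + √s • y) - G x| ≤ √s * ‖y‖ := by
  have := hG.dist_le_mul (x + √s • y) x
  rwa [NNReal.coe_one, one_mul, Real.dist_eq, dist_eq_norm, add_sub_cancel_left, norm_smul,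
    Real.norm_of_nonneg (Real.sqrt_nonneg s)] at this

include hG in
lemma integrable_lipschitz (s : ℝ) (x : ι → ℝ) : Integrable (fun y => G (x + √s • y)) μ := by
  refine integrable_of_le_exp_norm μ (D := |G x| + √s) (c := 1)
    (hG.continuous.comp (by fun_prop)) fun y => ?_
  have h1 := abs_sub_le_of_lipschitz hG (s := s) x y
  have h2 := abs_sub_abs_le_abs_sub (G (x + √s • y)) (G x)
  have h3 : 1 + ‖y‖ ≤ Real.exp (1 * ‖y‖) := by
    rw [one_mul]; linarith [Real.add_one_le_exp ‖y‖]
  have hs := Real.sqrt_nonneg s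
  have h4 := abs_nonneg (G x)
  have h5 := norm_nonneg y
  calc _ ≤ (|G x| + √s) * (1 + ‖y‖) := by nlinarith [mul_nonneg h4 h5]
    _ ≤ _ := by gcongr

include hG in
lemma integrable_exp_lipschitz (t s : ℝ) (x : ι → ℝ) :
    Integrable (fun y => Real.exp (t * G (x + √s • y))) μ := by
  refine integrable_of_le_exp_norm μ (D := Real.exp (|t| * |G x|)) (c := |t| * √s)
    (Real.continuous_exp.comp (continuous_const.mul (hG.continuous.comp (by fun_prop)))) fun y => ?_
  rw [abs_of_pos (Real.exp_pos _), ← Real.exp_add]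
  refine Real.exp_le_exp.2 ?_
  have h1 := abs_sub_le_of_lipschitz hG (s := s) x y
  have h2 := abs_sub_abs_le_abs_sub (G (x + √s • y)) (G x)
  calc _ ≤ |t| * |G (x + √s • y)| := by rw [← abs_mul]; exact le_abs_self _
    _ ≤ |t| * (|G x| + √s * ‖y‖) := by gcongr; linarith
    _ = _ := by ring

include hG in
lemma lipschitz_gaussAverage (s : ℝ) : LipschitzWith 1 (gaussAverage μ s G) := by
  refine LipschitzWith.of_dist_le_mul fun x x' => ?_
  rw [NNReal.coe_one, one_mul, Real.dist_eq, gaussAverage, gaussAverage,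
    ← integral_sub (integrable_lipschitz μ hG s x) (integrable_lipschitz μ hG s x'), ← Real.norm_eq_abs]
  refine (norm_integral_le_of_norm_le_const (C := dist x x') (Eventually.of_forall fun y => ?_)).trans
    (by simp)
  have := hG.dist_le_mul (x + √s • y) (x' + √s • y)
  rwa [NNReal.coe_one, one_mul, dist_add_right, Real.dist_eq] at this

end Integrability

variable (μ : Measure (ι → ℝ)) [IsGaussian μ] (hμ : ∀ L : StrongDual ℝ (ι → ℝ), μ[L] = 0)

include hμ in
-- The semigroup property. A product of two copies of a centred Gaussian measure is rotation
-- invariant, and the angle is chosen with `√(s+r) cos θ = √s` and `√(s+r) sin θ = √r`.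
lemma gaussAverage_gaussAverage {s r : ℝ} (hs : 0 < s) (hr : 0 ≤ r) {F : (ι → ℝ) → ℝ} (x : ι → ℝ)
    (hF : Integrable (fun y => F (x + √(s + r) • y)) μ) :
    gaussAverage μ s (gaussAverage μ r F) x = gaussAverage μ (s + r) F x ∧
      Integrable (fun y => gaussAverage μ r F (x + √s • y)) μ := by
  set θ := Real.arccos √(s / (s + r)) with hθ
  have hsr : 0 < s + r := by linarith
  have h1 : s / (s + r) ≤ 1 := (div_le_one hsr).2 (by linarith)
  have h0 : 0 ≤ s / (s + r) := by positivity
  have hcos : √(s + r) * Real.cos θ = √s := by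
    rw [hθ, Real.cos_arccos (by linarith [Real.sqrt_nonneg (s / (s + r))]) (Real.sqrt_le_one.2 h1),
      ← Real.sqrt_mul hsr.le]
    congr 1
    field_simp
  have hsin : √(s + r) * Real.sin θ = √r := by
    rw [hθ, Real.sin_arccos, Real.sq_sqrt h0, ← Real.sqrt_mul hsr.le]
    congr 1
    field_simp
    ring
  have hrot := IsGaussian.map_rotation_eq_self_of_forall_strongDual_eq_zero (μ := μ) hμ θ
  have hmp : MeasurePreserving (ContinuousLinearMap.rotation θ : (ι → ℝ) × (ι → ℝ) →L[ℝ] _)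
      (μ.prod μ) (μ.prod μ) := ⟨by fun_prop, hrot⟩
  have hi1 : Integrable (fun p : (ι → ℝ) × (ι → ℝ) => F (x + √(s + r) • p.1)) (μ.prod μ) :=
    hF.comp_fst μ
  have heq : ∀ p : (ι → ℝ) × (ι → ℝ),
      F (x + √(s + r) • (ContinuousLinearMap.rotation θ p).1) = F (x + √s • p.1 + √r • p.2) := by
    intro p
    rw [ContinuousLinearMap.rotation_apply]
    simp only [smul_add, smul_smul, hcos, hsin, add_assoc]
  have hi2 : Integrable (fun p : (ι → ℝ) × (ι → ℝ) => F (x + √s • p.1 + √r • p.2)) (μ.prod μ) := by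
    have := hmp.integrable_comp_of_integrable hi1
    refine this.congr (Eventually.of_forall fun p => heq p)
  refine ⟨?_, hi2.integral_prod_left⟩
  calc gaussAverage μ s (gaussAverage μ r F) x
      = ∫ p, F (x + √s • p.1 + √r • p.2) ∂(μ.prod μ) := (integral_prod _ hi2).symm
    _ = ∫ p, F (x + √(s + r) • (ContinuousLinearMap.rotation θ p).1) ∂(μ.prod μ) := by
        simp only [heq]
    _ = ∫ p, F (x + √(s + r) • p.1) ∂(μ.prod μ) := by
        rw [← integral_map (f := fun p : (ι → ℝ) × (ι → ℝ) => F (x + √(s + r) • p.1))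
          hmp.measurable.aemeasurable (by rw [hrot]; exact hi1.aestronglyMeasurable), hrot]
    _ = _ := by
        rw [integral_prod _ hi1]
        simp [gaussAverage]

lemma exp_le_quadratic_add (w : ℝ) : Real.exp w ≤ 1 + w + w ^ 2 / 2 + |w| ^ 3 * Real.exp |w| := by
  have h := Complex.norm_exp_sub_sum_le_norm_mul_exp (w : ℂ) 3
  simp only [Finset.sum_range_succ, Finset.sum_range_zero, Nat.factorial, pow_zero, pow_one] at h
  have e : Complex.exp w - (0 + 1 / ((1 : ℕ) : ℂ) + (w : ℂ) / ((0 + 1) * 1 : ℕ) +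
      (w : ℂ) ^ 2 / (((1 + 1) * ((0 + 1) * 1) : ℕ) : ℂ))
      = ((Real.exp w - (1 + w + w ^ 2 / 2) : ℝ) : ℂ) := by
    push_cast
    ring
  rw [e, Complex.norm_real, Complex.norm_real, Real.norm_eq_abs, Real.norm_eq_abs] at h
  linarith [(abs_le.1 h).2]

/-- Exponential moments of a smooth Lipschitz function over a short Gaussian increment. -/
lemma integral_exp_increment_le {V M t : ℝ} (ht : 0 ≤ t)
    (hV : ∀ i, ∫ y, y i ^ 2 ∂μ ≤ V) :
    ∃ C : ℝ, ∀ (G : (ι → ℝ) → ℝ) (x v : ι → ℝ), LipschitzWith 1 G → (∀ i, 0 ≤ v i) → ∑ i, v i = 1 →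
      (∀ h, |G (x + h) - G x - ∑ i, v i * h i| ≤ M * ‖h‖ ^ 2) → ∀ s : ℝ, 0 ≤ s → s ≤ 1 →
      gaussAverage μ s (fun z => Real.exp (t * G z)) x
        ≤ Real.exp (t * gaussAverage μ s G x + (t ^ 2 * V / 2 * s + C * (s * √s))) := by
  set m := ∫ y, ‖y‖ ∂μ with hm
  have hm0 : 0 ≤ m := integral_nonneg fun _ => norm_nonneg _
  have hn1 : Integrable (fun y : ι → ℝ => ‖y‖) μ := by simpa using integrable_norm_pow μ 1
  set Q : (ι → ℝ) → ℝ := fun y => 2 * M * ‖y‖ ^ 3 + M ^ 2 * ‖y‖ ^ 4 with hQ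
  set R : (ι → ℝ) → ℝ := fun y => t ^ 3 * ((‖y‖ + m) ^ 3 * Real.exp (t * (‖y‖ + m))) with hR
  have hQi : Integrable Q μ :=
    ((integrable_norm_pow μ 3).const_mul _).add ((integrable_norm_pow μ 4).const_mul _)
  have hRi : Integrable R μ := (integrable_pow_mul_exp_norm μ 3 m t hm0).const_mul _
  -- This constant depends on `μ`, `M` and `t` but not on `G`, `x` or `v`, so it serves at every
  -- stage of the later iteration.
  refine ⟨t ^ 2 / 2 * ∫ y, Q y ∂μ + ∫ y, R y ∂μ, fun G x v hG hv0 hv1 hv s hs0 hs1 => ?_⟩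
  set A := gaussAverage μ s G x with hA
  set X : (ι → ℝ) → ℝ := fun y => G (x + √s • y) - G x with hX
  have hXi : Integrable X μ := (integrable_lipschitz μ hG s x).sub (integrable_const _)
  have hXA : ∫ y, X y ∂μ = A - G x := by
    rw [hX, integral_sub (integrable_lipschitz μ hG s x) (integrable_const _), hA, gaussAverage]
    simp
  set a := A - G x with ha
  have hXle : ∀ y, |X y| ≤ √s * ‖y‖ := fun y => abs_sub_le_of_lipschitz hG x y
  have hale : |a| ≤ √s * m := by
    rw [← hXA, hm, ← integral_const_mul]
    exact norm_integral_le_of_norm_le (f := X) (hn1.const_mul _) (Eventually.of_forall hXle)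
  have hsq : √s ≤ 1 := Real.sqrt_le_one.2 hs1
  have hsq0 := Real.sqrt_nonneg s
  have hss : √s * √s = s := Real.mul_self_sqrt hs0
  -- To first order `X` is `√s ∑ v_i y_i`. Since `v` is a probability vector, the square of this sum
  -- is at most `s ∑ v_i y_i²`; hence only the largest coordinate variance enters, with no
  -- dependence on the number of coordinates.
  have hX2 : ∀ y, X y ^ 2 ≤ s * ∑ i, v i * y i ^ 2 + s * √s * Q y := by
    intro y
    have h1 := hv (√s • y)
    set q := ∑ i, v i * y i with hq
    have e1 : ∑ i, v i * (√s • y) i = √s * q := by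
      rw [hq, Finset.mul_sum]
      exact Finset.sum_congr rfl fun i _ => by simp only [Pi.smul_apply, smul_eq_mul]; ring
    rw [e1, norm_smul, Real.norm_of_nonneg hsq0, mul_pow, Real.sq_sqrt hs0] at h1
    have hqle : |q| ≤ ‖y‖ := by
      calc |q| ≤ ∑ i, |v i * y i| := Finset.abs_sum_le_sum_abs _ _
        _ ≤ ∑ i, v i * ‖y‖ := Finset.sum_le_sum fun i _ => by
            rw [abs_mul, abs_of_nonneg (hv0 i)]
            exact mul_le_mul_of_nonneg_left (norm_le_pi_norm y i) (hv0 i)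
        _ = ‖y‖ := by rw [← Finset.sum_mul, hv1, one_mul]
    have hq2 : q ^ 2 ≤ ∑ i, v i * y i ^ 2 := by
      have := Finset.sum_nonneg (s := Finset.univ) fun i _ => mul_nonneg (hv0 i) (sq_nonneg (y i - q))
      have e : ∑ i, v i * (y i - q) ^ 2 = ∑ i, v i * y i ^ 2 - 2 * q * ∑ i, v i * y i
          + q ^ 2 * ∑ i, v i := by
        rw [Finset.mul_sum _ _ (2 * q), Finset.mul_sum _ _ (q ^ 2), ← Finset.sum_sub_distrib,
          ← Finset.sum_add_distrib]
        exact Finset.sum_congr rfl fun i _ => by ring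
      rw [e, hv1, ← hq] at this
      nlinarith
    set E := X y - √s * q with hE
    have hEle : |E| ≤ M * (s * ‖y‖ ^ 2) := h1
    have e2 : X y = √s * q + E := by ring
    have h3 : |√s * q| ≤ √s * ‖y‖ := by
      rw [abs_mul, abs_of_nonneg hsq0]; gcongr
    have h4 : (√s * q) * E ≤ (√s * ‖y‖) * (M * (s * ‖y‖ ^ 2)) := by
      refine (le_abs_self _).trans ?_
      rw [abs_mul]
      gcongr
    have h5 : E ^ 2 ≤ (M * (s * ‖y‖ ^ 2)) ^ 2 := sq_le_sq' (abs_le.1 hEle).1 (abs_le.1 hEle).2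
    have h6 : (M * (s * ‖y‖ ^ 2)) ^ 2 ≤ s * √s * (M ^ 2 * ‖y‖ ^ 4) := by
      have : s ≤ √s := by nlinarith
      calc (M * (s * ‖y‖ ^ 2)) ^ 2 = (s * s) * (M ^ 2 * ‖y‖ ^ 4) := by ring
        _ ≤ _ := by gcongr
    calc X y ^ 2 = (√s * √s) * q ^ 2 + 2 * ((√s * q) * E) + E ^ 2 := by rw [e2]; ring
      _ ≤ s * ∑ i, v i * y i ^ 2 + 2 * ((√s * ‖y‖) * (M * (s * ‖y‖ ^ 2)))
          + s * √s * (M ^ 2 * ‖y‖ ^ 4) := by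
          rw [hss]
          gcongr
          exact h5.trans h6
      _ = _ := by rw [hQ]; ring
  -- The exponent is centred at its mean `a`, so the linear term integrates to zero and the first
  -- contribution is the quadratic one, of order `s`.
  have hpt : ∀ y, Real.exp (t * (X y - a)) ≤ 1 + t * (X y - a)
      + t ^ 2 / 2 * ((s * ∑ i, v i * y i ^ 2 + s * √s * Q y) - 2 * a * X y + a ^ 2)
      + s * √s * R y := by
    intro y
    have h1 := exp_le_quadratic_add (t * (X y - a))
    have h2 : |t * (X y - a)| ≤ t * (√s * (‖y‖ + m)) := by
      rw [abs_mul, abs_of_nonneg ht]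
      gcongr
      refine (abs_sub _ _).trans ?_
      linarith [hXle y]
    have h3 : |t * (X y - a)| ^ 3 * Real.exp |t * (X y - a)| ≤ s * √s * R y := by
      calc _ ≤ (t * (√s * (‖y‖ + m))) ^ 3 * Real.exp (t * (‖y‖ + m)) := by
            gcongr
            refine h2.trans ?_
            gcongr
            exact mul_le_of_le_one_left (by positivity) hsq
        _ = (√s * √s) * √s * R y := by rw [hR]; ring
        _ = _ := by rw [hss]
    have h4 : (t * (X y - a)) ^ 2 / 2 ≤ t ^ 2 / 2 *
        ((s * ∑ i, v i * y i ^ 2 + s * √s * Q y) - 2 * a * X y + a ^ 2) := by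
      have := mul_le_mul_of_nonneg_left (hX2 y) (show 0 ≤ t ^ 2 / 2 by positivity)
      nlinarith
    linarith
  have hyi : ∀ i, Integrable (fun y : ι → ℝ => y i ^ 2) μ := fun i =>
    (integrable_norm_pow μ 2).mono' ((continuous_apply i).pow 2).aestronglyMeasurable (Eventually.of_forall fun y => by
      rw [norm_pow]; gcongr; exact norm_le_pi_norm y i)
  have hSi : Integrable (fun y : ι → ℝ => ∑ i, v i * y i ^ 2) μ :=
    integrable_finsetSum _ fun i _ => (hyi i).const_mul _
  have hSle : ∫ y, ∑ i, v i * y i ^ 2 ∂μ ≤ V := by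
    rw [integral_finsetSum _ fun i _ => (hyi i).const_mul _]
    calc _ ≤ ∑ i, v i * V := Finset.sum_le_sum fun i _ => by
          rw [integral_const_mul]
          exact mul_le_mul_of_nonneg_left (hV i) (hv0 i)
      _ = V := by rw [← Finset.sum_mul, hv1, one_mul]
  have hXa : Integrable (fun y => t * (X y - a)) μ := (hXi.sub (integrable_const _)).const_mul _
  have hI1 : Integrable (fun y => 1 + t * (X y - a)) μ := (integrable_const _).add hXa
  have hS' : Integrable (fun y : ι → ℝ => s * ∑ i, v i * y i ^ 2) μ := hSi.const_mul _
  have hQ' : Integrable (fun y => s * √s * Q y) μ := hQi.const_mul _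
  have hX' : Integrable (fun y => 2 * a * X y) μ := hXi.const_mul _
  have hR' : Integrable (fun y => s * √s * R y) μ := hRi.const_mul _
  have hI2 : Integrable (fun y => s * ∑ i, v i * y i ^ 2 + s * √s * Q y) μ := hS'.add hQ'
  have hI2' : Integrable (fun y => s * ∑ i, v i * y i ^ 2 + s * √s * Q y - 2 * a * X y) μ :=
    hI2.sub hX'
  have hI3 : Integrable (fun y => t ^ 2 / 2 *
      (s * ∑ i, v i * y i ^ 2 + s * √s * Q y - 2 * a * X y + a ^ 2)) μ :=
    (hI2'.add (integrable_const _)).const_mul _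
  have hI4 : Integrable (fun y => 1 + t * (X y - a) + t ^ 2 / 2 *
      (s * ∑ i, v i * y i ^ 2 + s * √s * Q y - 2 * a * X y + a ^ 2)) μ := hI1.add hI3
  have hexp : ∀ y, Real.exp (t * G (x + √s • y)) = Real.exp (t * A) * Real.exp (t * (X y - a)) := by
    intro y
    rw [← Real.exp_add, hX, ha]
    ring_nf
  have hIe : Integrable (fun y => Real.exp (t * (X y - a))) μ := by
    have := (integrable_exp_lipschitz μ hG t s x).const_mul (Real.exp (t * A))⁻¹
    refine this.congr (Eventually.of_forall fun y => ?_)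
    simp only [hexp]
    field_simp
  have hfin : ∫ y, Real.exp (t * (X y - a)) ∂μ ≤ 1 + (t ^ 2 * V / 2 * s
      + (t ^ 2 / 2 * ∫ y, Q y ∂μ + ∫ y, R y ∂μ) * (s * √s)) := by
    refine (integral_mono hIe (hI4.add hR') hpt).trans ?_
    have e1 : ∫ y, (1 + t * (X y - a)) ∂μ = 1 := by
      rw [integral_add (integrable_const _) hXa,
        integral_const_mul, integral_sub hXi (integrable_const _), hXA]
      simp
    have e2 : ∫ y, ((s * ∑ i, v i * y i ^ 2 + s * √s * Q y) - 2 * a * X y + a ^ 2) ∂μ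
        = s * (∫ y, ∑ i, v i * y i ^ 2 ∂μ) + s * √s * (∫ y, Q y ∂μ) - a ^ 2 := by
      rw [integral_add hI2' (integrable_const _), integral_sub hI2 hX', integral_add hS' hQ',
        integral_const_mul, integral_const_mul, integral_const_mul, hXA]
      simp
      ring
    have e3 : ∫ y, (1 + t * (X y - a)
        + t ^ 2 / 2 * ((s * ∑ i, v i * y i ^ 2 + s * √s * Q y) - 2 * a * X y + a ^ 2)
        + s * √s * R y) ∂μ = 1 + t ^ 2 / 2 * (s * (∫ y, ∑ i, v i * y i ^ 2 ∂μ)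
          + s * √s * (∫ y, Q y ∂μ) - a ^ 2) + s * √s * ∫ y, R y ∂μ := by
      rw [integral_add hI4 hR', integral_add hI1 hI3, e1, integral_const_mul, integral_const_mul, e2]
    refine (le_of_eq e3).trans ?_
    have h1 : t ^ 2 / 2 * (s * ∫ y, ∑ i, v i * y i ^ 2 ∂μ) ≤ t ^ 2 / 2 * (s * V) := by gcongr
    have h2 : 0 ≤ t ^ 2 / 2 * a ^ 2 := by positivity
    nlinarith
  calc gaussAverage μ s (fun z => Real.exp (t * G z)) x
      = Real.exp (t * A) * ∫ y, Real.exp (t * (X y - a)) ∂μ := by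
        rw [gaussAverage, ← integral_const_mul]
        simp only [hexp]
    _ ≤ Real.exp (t * A) * Real.exp (t ^ 2 * V / 2 * s
      + (t ^ 2 / 2 * ∫ y, Q y ∂μ + ∫ y, R y ∂μ) * (s * √s)) := by
        gcongr
        refine hfin.trans ?_
        rw [add_comm]
        exact Real.add_one_le_exp _
    _ = _ := (Real.exp_add _ _).symm

end Concentration

/-! ### Log-sum-exp, a smooth approximation of the maximum -/

section LogSumExp

variable {ι : Type*} [Fintype ι] [Nonempty ι]

/-- The smooth approximation `β⁻¹ log ∑ exp (β xᵢ)` of the maximum. -/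
noncomputable def logSumExp (β : ℝ) (x : ι → ℝ) : ℝ := β⁻¹ * Real.log (∑ i, Real.exp (β * x i))

/-- The gradient of `logSumExp`. -/
noncomputable def softmax (β : ℝ) (x : ι → ℝ) (i : ι) : ℝ :=
  Real.exp (β * x i) / ∑ j, Real.exp (β * x j)

lemma sum_exp_pos (β : ℝ) (x : ι → ℝ) : 0 < ∑ i, Real.exp (β * x i) :=
  Finset.sum_pos (fun _ _ => Real.exp_pos _) Finset.univ_nonempty

omit [Nonempty ι] in
lemma softmax_nonneg (β : ℝ) (x : ι → ℝ) (i : ι) : 0 ≤ softmax β x i := by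
  unfold softmax; positivity

lemma sum_softmax (β : ℝ) (x : ι → ℝ) : ∑ i, softmax β x i = 1 := by
  simp only [softmax]
  rw [← Finset.sum_div, div_self (sum_exp_pos β x).ne']

lemma softmax_le_one (β : ℝ) (x : ι → ℝ) (i : ι) : softmax β x i ≤ 1 :=
  (Finset.single_le_sum (fun j _ => softmax_nonneg β x j) (Finset.mem_univ i)).trans
    (sum_softmax β x).le

lemma continuous_softmax (β : ℝ) (i : ι) : Continuous fun x : ι → ℝ => softmax β x i := by
  unfold softmax
  exact Continuous.div (by fun_prop) (by fun_prop) fun x => (sum_exp_pos β x).ne'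

lemma logSumExp_add_sub {β : ℝ} (x h : ι → ℝ) :
    logSumExp β (x + h) - logSumExp β x
      = β⁻¹ * Real.log (∑ i, softmax β x i * Real.exp (β * h i)) := by
  rw [logSumExp, logSumExp, ← mul_sub, ← Real.log_div (sum_exp_pos _ _).ne' (sum_exp_pos _ _).ne',
    Finset.sum_div]
  congr 2
  refine Finset.sum_congr rfl fun i _ => ?_
  rw [softmax, Pi.add_apply, mul_add, Real.exp_add]
  ring

omit [Nonempty ι] in
lemma exp_sum_le {v u : ι → ℝ} (hv0 : ∀ i, 0 ≤ v i) (hv1 : ∑ i, v i = 1) :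
    Real.exp (∑ i, v i * u i) ≤ ∑ i, v i * Real.exp (u i) := by
  have := convexOn_exp.map_sum_le (t := Finset.univ) (w := v) (p := u) (fun i _ => hv0 i) hv1
    (fun _ _ => Set.mem_univ _)
  simpa using this

omit [Nonempty ι] in
lemma abs_sum_mul_le {v u : ι → ℝ} (hv0 : ∀ i, 0 ≤ v i) (hv1 : ∑ i, v i = 1) :
    |∑ i, v i * u i| ≤ ‖u‖ := by
  calc _ ≤ ∑ i, |v i * u i| := Finset.abs_sum_le_sum_abs _ _
    _ ≤ ∑ i, v i * ‖u‖ := Finset.sum_le_sum fun i _ => by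
        rw [abs_mul, abs_of_nonneg (hv0 i)]
        exact mul_le_mul_of_nonneg_left (norm_le_pi_norm u i) (hv0 i)
    _ = ‖u‖ := by rw [← Finset.sum_mul, hv1, one_mul]

lemma sum_softmax_mul_le {β : ℝ} (hβ : 0 < β) (x h : ι → ℝ) :
    ∑ i, softmax β x i * h i ≤ logSumExp β (x + h) - logSumExp β x := by
  rw [logSumExp_add_sub]
  have h1 := exp_sum_le (u := fun i => β * h i) (softmax_nonneg β x) (sum_softmax β x)
  have h2 := (Real.le_log_iff_exp_le ((Real.exp_pos _).trans_le h1)).2 h1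
  calc _ = β⁻¹ * ∑ i, softmax β x i * (β * h i) := by
        rw [Finset.mul_sum]
        refine Finset.sum_congr rfl fun i _ => ?_
        field_simp
    _ ≤ _ := by gcongr

lemma logSumExp_sub_le_norm {β : ℝ} (hβ : 0 < β) (x h : ι → ℝ) :
    logSumExp β (x + h) - logSumExp β x ≤ ‖h‖ := by
  rw [logSumExp_add_sub]
  have h1 : ∑ i, softmax β x i * Real.exp (β * h i) ≤ Real.exp (β * ‖h‖) := by
    calc _ ≤ ∑ i, softmax β x i * Real.exp (β * ‖h‖) := Finset.sum_le_sum fun i _ => by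
          have := (le_abs_self _).trans (norm_le_pi_norm h i)
          have := softmax_nonneg β x i
          gcongr
      _ = _ := by rw [← Finset.sum_mul, sum_softmax, one_mul]
  have h0 : 0 < ∑ i, softmax β x i * Real.exp (β * h i) :=
    (Real.exp_pos _).trans_le
      (exp_sum_le (u := fun i => β * h i) (softmax_nonneg β x) (sum_softmax β x))
  calc _ ≤ β⁻¹ * (β * ‖h‖) := by
        gcongr
        exact (Real.log_le_iff_le_exp h0).2 h1
    _ = ‖h‖ := by field_simp

lemma lipschitz_logSumExp {β : ℝ} (hβ : 0 < β) : LipschitzWith 1 (logSumExp (ι := ι) β) := by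
  refine LipschitzWith.of_le_add fun x y => ?_
  have := logSumExp_sub_le_norm hβ y (x - y)
  rw [add_sub_cancel, ← dist_eq_norm] at this
  linarith

/-- The lower bound is convexity. When `β ‖h‖ ≥ 1` the Lipschitz bound is already quadratic in `h`;
otherwise expand the exponentials to second order and use `log u ≤ u - 1`. -/
lemma abs_logSumExp_sub_le {β : ℝ} (hβ : 0 < β) (x h : ι → ℝ) :
    |logSumExp β (x + h) - logSumExp β x - ∑ i, softmax β x i * h i| ≤ 2 * β * ‖h‖ ^ 2 := by
  have hlow := sum_softmax_mul_le hβ x h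
  rw [abs_of_nonneg (by linarith)]
  have hs := abs_sum_mul_le (u := h) (softmax_nonneg β x) (sum_softmax β x)
  rcases le_total 1 (β * ‖h‖) with hb | hb
  · have h1 := logSumExp_sub_le_norm hβ x h
    have h2 := (abs_le.1 hs).1
    nlinarith [norm_nonneg h]
  · rw [logSumExp_add_sub]
    have hu : ∀ i, |β * h i| ≤ β * ‖h‖ := fun i => by
      rw [abs_mul, abs_of_pos hβ]
      exact mul_le_mul_of_nonneg_left (norm_le_pi_norm h i) hβ.le
    have h1 : ∑ i, softmax β x i * Real.exp (β * h i)
        ≤ 1 + (β * ∑ i, softmax β x i * h i + (β * ‖h‖) ^ 2) := by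
      calc _ ≤ ∑ i, softmax β x i * (1 + β * h i + (β * ‖h‖) ^ 2) :=
            Finset.sum_le_sum fun i _ => by
              refine mul_le_mul_of_nonneg_left ?_ (softmax_nonneg β x i)
              have := Real.abs_exp_sub_one_sub_id_le ((hu i).trans hb)
              have h2 := (abs_le.1 this).2
              have h3 : (β * h i) ^ 2 ≤ (β * ‖h‖) ^ 2 := sq_le_sq' (abs_le.1 (hu i)).1 (abs_le.1 (hu i)).2
              linarith
        _ = _ := by
            have : ∀ i, softmax β x i * (1 + β * h i + (β * ‖h‖) ^ 2)
                = softmax β x i * (1 + (β * ‖h‖) ^ 2) + β * (softmax β x i * h i) := fun i => by ring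
            rw [Finset.sum_congr rfl fun i _ => this i, Finset.sum_add_distrib, ← Finset.sum_mul,
              sum_softmax, ← Finset.mul_sum]
            ring
    have h0 : 0 < ∑ i, softmax β x i * Real.exp (β * h i) :=
      (Real.exp_pos _).trans_le
        (exp_sum_le (u := fun i => β * h i) (softmax_nonneg β x) (sum_softmax β x))
    have h2 := Real.log_le_sub_one_of_pos h0
    have h3 : β⁻¹ * Real.log (∑ i, softmax β x i * Real.exp (β * h i))
        ≤ β⁻¹ * (β * ∑ i, softmax β x i * h i + (β * ‖h‖) ^ 2) := by
      gcongr
      linarith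
    have h4 : β⁻¹ * (β * ∑ i, softmax β x i * h i + (β * ‖h‖) ^ 2)
        = ∑ i, softmax β x i * h i + β * ‖h‖ ^ 2 := by field_simp
    nlinarith [sq_nonneg ‖h‖]

lemma iSup_le_logSumExp {β : ℝ} (hβ : 0 < β) (x : ι → ℝ) : ⨆ i, x i ≤ logSumExp β x := by
  refine ciSup_le fun i => ?_
  have h1 : Real.exp (β * x i) ≤ ∑ i, Real.exp (β * x i) :=
    Finset.single_le_sum (f := fun i => Real.exp (β * x i)) (fun _ _ => (Real.exp_pos _).le)
      (Finset.mem_univ i)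
  have h2 := (Real.le_log_iff_exp_le (sum_exp_pos β x)).2 h1
  calc x i = β⁻¹ * (β * x i) := by field_simp
    _ ≤ _ := by unfold logSumExp; gcongr

lemma logSumExp_le {β : ℝ} (hβ : 0 < β) (x : ι → ℝ) :
    logSumExp β x ≤ (⨆ i, x i) + β⁻¹ * Real.log (Fintype.card ι) := by
  have h1 : ∑ i, Real.exp (β * x i) ≤ Fintype.card ι * Real.exp (β * ⨆ i, x i) := by
    calc _ ≤ ∑ _i : ι, Real.exp (β * ⨆ i, x i) := Finset.sum_le_sum fun i _ => by
          have := le_ciSup (Set.finite_range x).bddAbove i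
          gcongr
      _ = _ := by simp
  have hc : (0 : ℝ) < Fintype.card ι := by exact_mod_cast Fintype.card_pos
  have h2 := Real.log_le_log (sum_exp_pos β x) h1
  rw [Real.log_mul hc.ne' (Real.exp_pos _).ne', Real.log_exp] at h2
  calc logSumExp β x ≤ β⁻¹ * (Real.log (Fintype.card ι) + β * ⨆ i, x i) := by
        unfold logSumExp; gcongr
    _ = _ := by field_simp; ring

end LogSumExp

/-! ### The Borell–TIS inequality -/

section Concentration

variable {ι : Type*} [Fintype ι] [Nonempty ι] (μ : Measure (ι → ℝ)) [IsGaussian μ]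
  (hμ : ∀ L : StrongDual ℝ (ι → ℝ), μ[L] = 0)

/-- Gaussian averages of `logSumExp` have a second order Taylor expansion. -/
lemma exists_taylor_gaussAverage {β : ℝ} (hβ : 0 < β) (r : ℝ) (x : ι → ℝ) :
    ∃ v : ι → ℝ, (∀ i, 0 ≤ v i) ∧ ∑ i, v i = 1 ∧ ∀ h,
      |gaussAverage μ r (logSumExp β) (x + h) - gaussAverage μ r (logSumExp β) x - ∑ i, v i * h i|
        ≤ 2 * β * ‖h‖ ^ 2 := by
  have hp : ∀ i, Integrable (fun y => softmax β (x + √r • y) i) μ := fun i =>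
    Integrable.of_bound ((continuous_softmax β i).comp
      (by fun_prop : Continuous fun y : ι → ℝ => x + √r • y)).aestronglyMeasurable 1
      (Eventually.of_forall fun y => by
        rw [Real.norm_of_nonneg (softmax_nonneg β _ i)]
        exact softmax_le_one β _ i)
  -- The gradient is the Gaussian average of the softmax vector, hence again a probability vector,
  -- and the quadratic error is preserved by averaging.
  refine ⟨fun i => ∫ y, softmax β (x + √r • y) i ∂μ, fun i => integral_nonneg fun y =>
    softmax_nonneg β _ i, ?_, fun h => ?_⟩
  · rw [← integral_finsetSum _ fun i _ => hp i]
    simp [sum_softmax]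
  · have hL := lipschitz_logSumExp (ι := ι) hβ
    have hsum : ∑ i, (∫ y, softmax β (x + √r • y) i ∂μ) * h i
        = ∫ y, ∑ i, softmax β (x + √r • y) i * h i ∂μ := by
      rw [integral_finsetSum _ fun i _ => (hp i).mul_const _]
      exact Finset.sum_congr rfl fun i _ => (integral_mul_const _ _).symm
    have hd : Integrable
        (fun y => logSumExp β (x + h + √r • y) - logSumExp β (x + √r • y)) μ :=
      (integrable_lipschitz μ hL r (x + h)).sub (integrable_lipschitz μ hL r x)
    have hq : Integrable (fun y => ∑ i, softmax β (x + √r • y) i * h i) μ :=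
      integrable_finsetSum _ fun i _ => (hp i).mul_const _
    rw [hsum, gaussAverage, gaussAverage,
      ← integral_sub (integrable_lipschitz μ hL r (x + h)) (integrable_lipschitz μ hL r x),
      ← integral_sub hd hq, ← Real.norm_eq_abs]
    refine (norm_integral_le_of_norm_le_const (C := 2 * β * ‖h‖ ^ 2)
      (Eventually.of_forall fun y => ?_)).trans (by simp)
    rw [Real.norm_eq_abs, add_right_comm]
    exact abs_logSumExp_sub_le hβ _ h

include hμ in
-- Unit time is divided into `n + 1` Gaussian increments of length `s = 1/(n+1)`. Averages of
-- log-sum-exp keep the Lipschitz and Taylor bounds, so every increment multiplies the exponential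
-- moment by at most `exp(t² V s / 2 + C s^{3/2})`; the errors add up to `C √s`, which tends to `0`.
lemma integral_exp_logSumExp_le {V t β : ℝ} (ht : 0 ≤ t) (hβ : 0 < β)
    (hV : ∀ i, ∫ y, y i ^ 2 ∂μ ≤ V) :
    ∫ y, Real.exp (t * logSumExp β y) ∂μ
      ≤ Real.exp (t * ∫ y, logSumExp β y ∂μ + t ^ 2 * V / 2) := by
  obtain ⟨C, hC⟩ := integral_exp_increment_le μ (M := 2 * β) ht hV
  set G : (ι → ℝ) → ℝ := logSumExp β with hG
  have hL : LipschitzWith 1 G := lipschitz_logSumExp hβ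
  have hstep : ∀ (s : ℝ), 0 < s → s ≤ 1 → ∀ (k : ℕ) (x : ι → ℝ),
      gaussAverage μ (k * s) (fun z => Real.exp (t * G z)) x
        ≤ Real.exp (t * gaussAverage μ (k * s) G x + k * (t ^ 2 * V / 2 * s + C * (s * √s))) := by
    intro s hs0 hs1 k
    induction k with
    | zero => intro x; simp [gaussAverage]
    | succ k ih =>
      intro x
      have hk : (0 : ℝ) ≤ k * s := by positivity
      have e : ((k + 1 : ℕ) : ℝ) * s = s + k * s := by push_cast; ring
      set δ := t ^ 2 * V / 2 * s + C * (s * √s) with hδ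
      obtain ⟨e1, i1⟩ := gaussAverage_gaussAverage μ hμ hs0 hk (F := fun z => Real.exp (t * G z)) x
        (integrable_exp_lipschitz μ hL t _ x)
      obtain ⟨e2, -⟩ := gaussAverage_gaussAverage μ hμ hs0 hk (F := G) x
        (integrable_lipschitz μ hL _ x)
      obtain ⟨v, hv0, hv1, hv⟩ := exists_taylor_gaussAverage μ hβ (k * s) x
      have hH := lipschitz_gaussAverage μ hL (k * s)
      have h1 := hC _ x v hH hv0 hv1 hv s hs0.le hs1
      rw [e2] at h1
      rw [e, ← e1]
      calc gaussAverage μ s (gaussAverage μ (k * s) fun z => Real.exp (t * G z)) x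
          ≤ ∫ y, Real.exp (k * δ) * Real.exp (t * gaussAverage μ (k * s) G (x + √s • y)) ∂μ := by
            refine integral_mono i1 ((integrable_exp_lipschitz μ hH t s x).const_mul _) fun y => ?_
            refine (ih _).trans (le_of_eq ?_)
            rw [← Real.exp_add, add_comm]
        _ = Real.exp (k * δ) * gaussAverage μ s (fun z => Real.exp (t * gaussAverage μ (k * s) G z)) x := by
            rw [integral_const_mul, gaussAverage]
        _ ≤ Real.exp (k * δ) * Real.exp (t * gaussAverage μ (s + k * s) G x + δ) := by gcongr
        _ = _ := by
            rw [← Real.exp_add]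
            congr 1
            push_cast
            ring
  have hN : ∀ n : ℕ, ∫ y, Real.exp (t * G y) ∂μ
      ≤ Real.exp (t * ∫ y, G y ∂μ + (t ^ 2 * V / 2 + C * √(1 / (n + 1 : ℝ)))) := by
    intro n
    have hn : (0 : ℝ) < n + 1 := by positivity
    have h := hstep (1 / (n + 1)) (by positivity) ((div_le_one hn).2 (by linarith)) (n + 1) 0
    have e : ((n + 1 : ℕ) : ℝ) * (1 / (n + 1)) = 1 := by push_cast; field_simp
    rw [e] at h
    simp only [gaussAverage, Real.sqrt_one, one_smul, zero_add] at h
    refine h.trans (le_of_eq ?_)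
    congr 2
    push_cast
    field_simp
  have hlim : Tendsto (fun n : ℕ => Real.exp (t * ∫ y, G y ∂μ
      + (t ^ 2 * V / 2 + C * √(1 / (n + 1 : ℝ))))) atTop
      (𝓝 (Real.exp (t * ∫ y, G y ∂μ + (t ^ 2 * V / 2 + C * √0)))) := by
    have h0 : Tendsto (fun n : ℕ => √(1 / (n + 1 : ℝ))) atTop (𝓝 √0) :=
      (Real.continuous_sqrt.tendsto 0).comp tendsto_one_div_add_atTop_nhds_zero_nat
    exact (Real.continuous_exp.tendsto _).comp
      (tendsto_const_nhds.add (tendsto_const_nhds.add (h0.const_mul C)))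
  have := ge_of_tendsto' hlim hN
  simpa using this

lemma lipschitz_iSup : LipschitzWith 1 fun y : ι → ℝ => ⨆ i, y i := by
  refine LipschitzWith.of_le_add fun x y => ciSup_le fun i => ?_
  have h1 := le_ciSup (Set.finite_range y).bddAbove i
  have h2 := (le_abs_self _).trans (norm_le_pi_norm (x - y) i)
  rw [Pi.sub_apply] at h2
  rw [dist_eq_norm]
  linarith

include hμ in
/-- The exponential moment form of the Borell--TIS inequality for a finite Gaussian vector. -/
theorem integral_exp_iSup_le {V t : ℝ} (ht : 0 ≤ t) (hV : ∀ i, ∫ y, y i ^ 2 ∂μ ≤ V) :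
    ∫ y, Real.exp (t * ⨆ i, y i) ∂μ ≤ Real.exp (t * ∫ y, ⨆ i, y i ∂μ + t ^ 2 * V / 2) := by
  have hS := lipschitz_iSup (ι := ι)
  have iS : Integrable (fun y : ι → ℝ => ⨆ i, y i) μ := by
    simpa using integrable_lipschitz μ hS 1 0
  have iSe : Integrable (fun y : ι → ℝ => Real.exp (t * ⨆ i, y i)) μ := by
    simpa using integrable_exp_lipschitz μ hS t 1 0
  -- With inverse temperature `β = n + 1`, the smoothing error `log |ι| / β` disappears in the
  -- limit.
  have hβ : ∀ n : ℕ, ∫ y, Real.exp (t * ⨆ i, y i) ∂μ ≤ Real.exp (t * (∫ y, ⨆ i, y i ∂μ +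
      1 / (n + 1 : ℝ) * Real.log (Fintype.card ι)) + t ^ 2 * V / 2) := by
    intro n
    have hn : (0 : ℝ) < n + 1 := by positivity
    have hL := lipschitz_logSumExp (ι := ι) hn
    have iL : Integrable (logSumExp (ι := ι) (n + 1)) μ := by
      simpa using integrable_lipschitz μ hL 1 0
    have iLe : Integrable (fun y : ι → ℝ => Real.exp (t * logSumExp (n + 1) y)) μ := by
      simpa using integrable_exp_lipschitz μ hL t 1 0
    calc _ ≤ ∫ y, Real.exp (t * logSumExp (n + 1) y) ∂μ :=
          integral_mono iSe iLe fun y => Real.exp_le_exp.2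
            (mul_le_mul_of_nonneg_left (iSup_le_logSumExp hn y) ht)
      _ ≤ Real.exp (t * ∫ y, logSumExp (n + 1) y ∂μ + t ^ 2 * V / 2) :=
          integral_exp_logSumExp_le μ hμ ht hn hV
      _ ≤ _ := by
          gcongr
          calc _ ≤ ∫ y, ((⨆ i, y i) + (n + 1 : ℝ)⁻¹ * Real.log (Fintype.card ι)) ∂μ :=
                integral_mono iL (iS.add (integrable_const _)) fun y => logSumExp_le hn y
            _ = _ := by
                rw [integral_add iS (integrable_const _)]
                simp
  have hlim : Tendsto (fun n : ℕ => Real.exp (t * (∫ y, ⨆ i, y i ∂μ +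
      1 / (n + 1 : ℝ) * Real.log (Fintype.card ι)) + t ^ 2 * V / 2)) atTop
      (𝓝 (Real.exp (t * (∫ y, ⨆ i, y i ∂μ + 0 * Real.log (Fintype.card ι)) + t ^ 2 * V / 2))) :=
    (Real.continuous_exp.tendsto _).comp (((tendsto_const_nhds.add
      (tendsto_one_div_add_atTop_nhds_zero_nat.mul_const _)).const_mul t).add_const _)
  have := ge_of_tendsto' hlim hβ
  simpa using this

include hμ in
/-- The Borell--TIS inequality for a finite Gaussian vector. -/
theorem measureReal_iSup_ge_le {V : ℝ} (hV0 : 0 < V) (hV : ∀ i, ∫ y, y i ^ 2 ∂μ ≤ V) (a : ℝ) :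
    μ.real {y | a ≤ ⨆ i, y i} ≤ Real.exp (-(max (a - ∫ y, ⨆ i, y i ∂μ) 0 ^ 2 / (2 * V))) := by
  set m := ∫ y, ⨆ i, y i ∂μ with hm
  set b := max (a - m) 0 with hb
  have hb0 : 0 ≤ b := le_max_right _ _
  -- The Chernoff parameter `b / V` is the optimal one; it is zero when `a` does not exceed the
  -- mean, and the bound is then trivial.
  have ht : 0 ≤ b / V := by positivity
  have iSe : Integrable (fun y : ι → ℝ => Real.exp (b / V * ⨆ i, y i)) μ := by
    simpa using integrable_exp_lipschitz μ (lipschitz_iSup (ι := ι)) (b / V) 1 0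
  have h1 := measure_ge_le_exp_mul_mgf (X := fun y : ι → ℝ => ⨆ i, y i) a ht iSe
  refine h1.trans ?_
  have h2 := integral_exp_iSup_le μ hμ ht hV
  rw [mgf]
  calc _ ≤ Real.exp (-(b / V) * a) * Real.exp (b / V * m + (b / V) ^ 2 * V / 2) := by gcongr
    _ = Real.exp (-(b / V * (a - m)) + b ^ 2 / (2 * V)) := by
      rw [← Real.exp_add]
      congr 1
      field_simp
      ring
    _ = _ := by
      congr 1
      have : b * (a - m) = b ^ 2 := by
        rcases le_total (a - m) 0 with h | h
        · rw [hb, max_eq_right h]; ring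
        · rw [hb, max_eq_left h]; ring
      rw [div_mul_eq_mul_div, this]
      field_simp
      ring

end Concentration

/-! ### Dyadic chaining on a box -/

section Chaining

/-- The dyadic approximation of `x` at scale `2 ^ k`, relative to the corner `b`. -/
def dyadicApprox {d : ℕ} (b : Fin d → ℤ) (k : ℕ) (x : Fin d → ℤ) : Fin d → ℤ :=
  fun i => b i + 2 ^ k * ((x i - b i) / 2 ^ k)

variable {d : ℕ} (b : Fin d → ℤ)

lemma dyadicApprox_zero (x : Fin d → ℤ) : dyadicApprox b 0 x = x := by
  ext i; simp [dyadicApprox]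

/-- Each coarser approximation is a function of the finer one. The links at level `k` are thus
indexed by the approximations at level `k` alone, which is what the union bound counts. -/
lemma dyadicApprox_succ_dyadicApprox (k : ℕ) (x : Fin d → ℤ) :
    dyadicApprox b (k + 1) (dyadicApprox b k x) = dyadicApprox b (k + 1) x := by
  ext i
  have h2 : (0 : ℤ) < 2 ^ k := by positivity
  simp only [dyadicApprox, add_sub_cancel_left]
  rw [pow_succ, Int.mul_ediv_mul_of_pos _ _ h2, Int.ediv_ediv_of_nonneg h2.le]

lemma norm_dyadicApprox_succ_sub (k : ℕ) (x : Fin d → ℤ) :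
    ‖dyadicApprox b (k + 1) x - dyadicApprox b k x‖ ≤ 2 ^ k := by
  refine (pi_norm_le_iff_of_nonneg (by positivity)).2 fun i => ?_
  have h2 : (0 : ℤ) < 2 ^ k := by positivity
  set q := (x i - b i) / 2 ^ k with hq
  have e : dyadicApprox b (k + 1) x i - dyadicApprox b k x i = -(2 ^ k * (q % 2)) := by
    simp only [dyadicApprox]
    rw [pow_succ, ← Int.ediv_ediv_of_nonneg h2.le, ← hq]
    have := Int.emod_add_mul_ediv q 2
    linear_combination (2 : ℤ) ^ k * this
  rw [Pi.sub_apply, e, norm_neg, Int.norm_eq_abs, abs_of_nonneg (by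
    have := Int.emod_nonneg q (show (2 : ℤ) ≠ 0 by norm_num)
    exact_mod_cast mul_nonneg h2.le this)]
  have h3 : q % 2 ≤ 1 := by omega
  have : (2 : ℤ) ^ k * (q % 2) ≤ 2 ^ k := mul_le_of_le_one_right h2.le h3
  exact_mod_cast this

/-- The box with corner `b` and side `R`. -/
noncomputable def cornerBox (R : ℕ) : Finset (Fin d → ℤ) :=
  Fintype.piFinset fun i => Finset.Ico (b i) (b i + R)

lemma mem_cornerBox {R : ℕ} {x : Fin d → ℤ} :
    x ∈ cornerBox b R ↔ ∀ i, b i ≤ x i ∧ x i < b i + R := by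
  simp [cornerBox]

lemma dyadicApprox_mem {R : ℕ} {x : Fin d → ℤ} (hx : x ∈ cornerBox b R) (k : ℕ) :
    dyadicApprox b k x ∈ cornerBox b R := by
  rw [mem_cornerBox] at *
  intro i
  have h2 : (0 : ℤ) < 2 ^ k := by positivity
  have h3 := Int.mul_ediv_self_le (x := x i - b i) (k := 2 ^ k) h2.ne'
  have h4 : 0 ≤ (x i - b i) / 2 ^ k := Int.ediv_nonneg (by have := (hx i).1; omega) h2.le
  have h5 : 0 ≤ 2 ^ k * ((x i - b i) / 2 ^ k) := mul_nonneg h2.le h4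
  have := hx i
  simp only [dyadicApprox]
  omega

lemma dyadicApprox_eq_corner {R m : ℕ} (hm : R ≤ 2 ^ m) {x : Fin d → ℤ} (hx : x ∈ cornerBox b R) :
    dyadicApprox b m x = b := by
  rw [mem_cornerBox] at hx
  ext i
  have hm' : (R : ℤ) ≤ 2 ^ m := by exact_mod_cast hm
  have := hx i
  simp only [dyadicApprox]
  rw [Int.ediv_eq_zero_of_lt (by omega) (by omega)]
  simp

lemma card_image_dyadicApprox_le {R m k : ℕ} (hm : R ≤ 2 ^ m) (hk : k ≤ m) :
    ((cornerBox b R).image (dyadicApprox b k)).card ≤ (2 ^ (m - k)) ^ d := by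
  classical
  have hsub : (cornerBox b R).image (dyadicApprox b k) ⊆
      (Fintype.piFinset fun _ : Fin d => Finset.Ico (0 : ℤ) (2 ^ (m - k))).image
        (fun q i => b i + 2 ^ k * q i) := by
    intro y hy
    obtain ⟨x, hx, rfl⟩ := Finset.mem_image.1 hy
    rw [mem_cornerBox] at hx
    refine Finset.mem_image.2 ⟨fun i => (x i - b i) / 2 ^ k, ?_, rfl⟩
    rw [Fintype.mem_piFinset]
    intro i
    have h2 : (0 : ℤ) < 2 ^ k := by positivity
    have hm' : (R : ℤ) ≤ 2 ^ m := by exact_mod_cast hm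
    have := hx i
    refine Finset.mem_Ico.2 ⟨Int.ediv_nonneg (by omega) h2.le, Int.ediv_lt_of_lt_mul h2 ?_⟩
    rw [← pow_add, Nat.sub_add_cancel hk]
    omega
  refine (Finset.card_le_card hsub).trans (Finset.card_image_le.trans ?_)
  rw [Fintype.card_piFinset]
  have h : ((2 : ℤ) ^ (m - k)).toNat = 2 ^ (m - k) := by
    rw [show (2 : ℤ) ^ (m - k) = ((2 ^ (m - k) : ℕ) : ℤ) by push_cast; rfl]
    exact Int.toNat_natCast _
  simp [h]

/-- The constant of the chaining bound. -/
noncomputable def chainingConst (d : ℕ) : ℝ :=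
  ∑' j : ℕ, (d * ((j + 1 : ℕ) * (3 / 4 : ℝ) ^ (j + 1)) + (2 / 3 : ℝ) ^ (j + 1))

lemma summable_chaining (d : ℕ) :
    Summable fun j : ℕ => d * ((j + 1 : ℕ) * (3 / 4 : ℝ) ^ (j + 1)) + (2 / 3 : ℝ) ^ (j + 1) := by
  have h1 : Summable fun j : ℕ => (j : ℝ) * (3 / 4 : ℝ) ^ j := by
    simpa using summable_pow_mul_geometric_of_norm_lt_one 1 (r := (3 / 4 : ℝ)) (by norm_num)
  have h2 := (summable_nat_add_iff 1).2 h1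
  have h3 := (summable_nat_add_iff 1).2
    (summable_geometric_of_lt_one (r := (2 / 3 : ℝ)) (by norm_num) (by norm_num))
  exact (h2.mul_left _).add h3

lemma chainingConst_pos (d : ℕ) : 0 < chainingConst d :=
  (summable_chaining d).tsum_pos (fun j => by positivity) 0 (by positivity)

variable {Ω : Type*} [MeasurableSpace Ω] {P : Measure Ω} [IsProbabilityMeasure P]

/-- Dyadic chaining: the expected supremum of a field on a box of side `R` whose increments have
sub-Gaussian variance proxy `V ‖x - y‖` is of order `√(V R)`. -/
theorem integral_iSup_sub_le {X : (Fin d → ℤ) → Ω → ℝ} {V : ℝ} (hV : 0 < V) {R : ℕ} (hR : 1 ≤ R)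
    (hX : ∀ x ∈ cornerBox b R, ∀ y ∈ cornerBox b R, ∀ τ : ℝ,
      Integrable (fun ω => Real.exp (τ * (X x ω - X y ω))) P ∧
      ∫ ω, Real.exp (τ * (X x ω - X y ω)) ∂P ≤ Real.exp (τ ^ 2 * (V * ‖x - y‖) / 2)) :
    ∫ ω, ⨆ x : {x // x ∈ cornerBox b R}, (X b ω - X x.1 ω) ∂P
      ≤ chainingConst d * √(V * (2 * R)) := by
  classical
  set D := cornerBox b R with hD
  have hbD : b ∈ D := (mem_cornerBox b).2 fun i => ⟨le_rfl, by omega⟩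
  obtain ⟨m, hm1, hm2⟩ : ∃ m : ℕ, R ≤ 2 ^ m ∧ (2 : ℝ) ^ m ≤ 2 * R := by
    obtain ⟨n, h1, h2⟩ := exists_nat_pow_near (x := R) (y := 2) hR (by norm_num)
    refine ⟨n + 1, h2.le, ?_⟩
    have : ((2 ^ n : ℕ) : ℝ) ≤ R := by exact_mod_cast h1
    push_cast at this
    rw [pow_succ]; linarith
  set A := √(V * 2 ^ m) with hA
  have hA0 : 0 < A := Real.sqrt_pos.2 (by positivity)
  have hA2 : A ^ 2 = V * 2 ^ m := Real.sq_sqrt (by positivity)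
  set I : ℕ → Finset (Fin d → ℤ) := fun k => D.image (dyadicApprox b k) with hI
  -- The ratio `4/3` lies strictly between `1` and `2`: with `j = m - k`, the entropy terms `j
  -- (3/4)^j` and the variance terms `(2/3)^j` are then both summable.
  set τ : ℕ → ℝ := fun k => (4 / 3 : ℝ) ^ (m - k) / A with hτ
  have hτ0 : ∀ k, 0 < τ k := fun k => by rw [hτ]; positivity
  set v : ℕ → ℝ := fun k => V * 2 ^ k with hv
  set c : ℕ → ℝ := fun k => (m - k : ℕ) * d * Real.log 2 + τ k ^ 2 * v k / 2 with hc
  set W : ℕ → (Fin d → ℤ) → Ω → ℝ := fun k y ω => X (dyadicApprox b (k + 1) y) ω - X y ω with hW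
  -- From `1 + u ≤ exp u` at `u = τ w - c`, each link `w` satisfies `τ w ≤ c - 1 + exp(τ w - c)`.
  -- Summing the exponentials over all links makes the bound uniform, and `c` is the log-cardinality
  -- plus the log-Laplace bound, so that this sum has mean at most `1`.
  set g : ℕ → Ω → ℝ := fun k ω =>
    (τ k)⁻¹ * (c k - 1 + ∑ y ∈ I k, Real.exp (-c k) * Real.exp (τ k * W k y ω)) with hg
  have hImem : ∀ k, ∀ y ∈ I k, y ∈ D ∧ dyadicApprox b (k + 1) y ∈ D ∧
      ‖dyadicApprox b (k + 1) y - y‖ ≤ 2 ^ k := by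
    intro k y hy
    obtain ⟨x, hx, rfl⟩ := Finset.mem_image.1 hy
    refine ⟨dyadicApprox_mem b hx k, dyadicApprox_mem b (dyadicApprox_mem b hx k) _, ?_⟩
    rw [dyadicApprox_succ_dyadicApprox]
    exact norm_dyadicApprox_succ_sub b k x
  have hWi : ∀ k, ∀ y ∈ I k, Integrable (fun ω => Real.exp (τ k * W k y ω)) P := fun k y hy =>
    (hX _ (hImem k y hy).2.1 _ (hImem k y hy).1 (τ k)).1
  have hgi : ∀ k, Integrable (g k) P := fun k =>
    ((integrable_const _).add (integrable_finsetSum _ fun y hy =>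
      (hWi k y hy).const_mul _)).const_mul _
  have hgle : ∀ k, k < m → ∫ ω, g k ω ∂P ≤ c k / τ k := by
    intro k hk
    have hs : Integrable (fun ω => ∑ y ∈ I k, Real.exp (-c k) * Real.exp (τ k * W k y ω)) P :=
      integrable_finsetSum _ fun y hy => (hWi k y hy).const_mul _
    have h1 : ∫ ω, ∑ y ∈ I k, Real.exp (-c k) * Real.exp (τ k * W k y ω) ∂P ≤ 1 := by
      rw [integral_finsetSum _ fun y hy => (hWi k y hy).const_mul _]
      have h2 : ∀ y ∈ I k, ∫ ω, Real.exp (-c k) * Real.exp (τ k * W k y ω) ∂P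
          ≤ ((2 ^ (m - k)) ^ d : ℝ)⁻¹ := by
        intro y hy
        rw [integral_const_mul]
        have h3 := (hX _ (hImem k y hy).2.1 _ (hImem k y hy).1 (τ k)).2
        have h4 := (hImem k y hy).2.2
        calc _ ≤ Real.exp (-c k) * Real.exp (τ k ^ 2 * v k / 2) := by
              gcongr
              refine h3.trans ?_
              gcongr
              rw [hv]
              exact mul_le_mul_of_nonneg_left h4 hV.le
          _ = Real.exp (-((m - k : ℕ) * d * Real.log 2)) := by
              rw [← Real.exp_add, hc]; congr 1; ring
          _ = _ := by
              rw [Real.exp_neg, show ((m - k : ℕ) : ℝ) * d * Real.log 2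
                = ((m - k) * d : ℕ) * Real.log 2 by push_cast; ring, Real.exp_nat_mul,
                Real.exp_log (by norm_num), pow_mul]
      refine (Finset.sum_le_sum h2).trans ?_
      rw [Finset.sum_const, nsmul_eq_mul]
      have h5 : ((I k).card : ℝ) ≤ (2 ^ (m - k)) ^ d := by
        exact_mod_cast card_image_dyadicApprox_le b hm1 hk.le
      calc _ ≤ ((2 ^ (m - k)) ^ d : ℝ) * ((2 ^ (m - k)) ^ d : ℝ)⁻¹ := by gcongr
        _ = 1 := mul_inv_cancel₀ (by positivity)
    rw [hg]
    simp only
    rw [integral_const_mul, integral_add (integrable_const _) hs, div_eq_inv_mul]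
    have := hτ0 k
    gcongr
    simp only [integral_const, probReal_univ, smul_eq_mul, one_mul]
    linarith
  have hpt : ∀ ω, ⨆ x : {x // x ∈ D}, (X b ω - X x.1 ω) ≤ ∑ k ∈ Finset.range m, g k ω := by
    intro ω
    have : Nonempty {x // x ∈ D} := ⟨⟨b, hbD⟩⟩
    refine ciSup_le fun ⟨x, hx⟩ => ?_
    have htel : X b ω - X x ω = ∑ k ∈ Finset.range m,
        (X (dyadicApprox b (k + 1) x) ω - X (dyadicApprox b k x) ω) := by
      rw [Finset.sum_range_sub (fun k => X (dyadicApprox b k x) ω), dyadicApprox_zero,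
        dyadicApprox_eq_corner b hm1 hx]
    rw [htel]
    refine Finset.sum_le_sum fun k _ => ?_
    have hy : dyadicApprox b k x ∈ I k := Finset.mem_image_of_mem _ hx
    rw [← dyadicApprox_succ_dyadicApprox]
    change W k (dyadicApprox b k x) ω ≤ _
    set w := W k (dyadicApprox b k x) ω with hw
    have h1 := Finset.single_le_sum
      (f := fun y => Real.exp (-c k) * Real.exp (τ k * W k y ω)) (fun y _ => by positivity) hy
    have h2 := Real.add_one_le_exp (-c k + τ k * w)
    rw [Real.exp_add] at h2
    rw [hg]
    simp only at h1 ⊢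
    rw [← div_eq_inv_mul, le_div_iff₀ (hτ0 k)]
    linarith
  have hterm : ∀ k ∈ Finset.range m, c k / τ k ≤ A * (d * ((m - 1 - k + 1 : ℕ) *
      (3 / 4 : ℝ) ^ (m - 1 - k + 1)) + (2 / 3 : ℝ) ^ (m - 1 - k + 1)) := by
    intro k hk
    have hk' := Finset.mem_range.1 hk
    have e : m - 1 - k + 1 = m - k := by omega
    rw [e]
    set j := m - k with hj
    have hlog : Real.log 2 ≤ 1 := by linarith [Real.log_two_lt_d9]
    have e1 : (2 : ℝ) ^ m = 2 ^ k * 2 ^ j := by rw [← pow_add]; congr 1; omega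
    have e2 : (τ k)⁻¹ = A * (3 / 4 : ℝ) ^ j := by
      rw [hτ]; simp only; rw [inv_div, ← hj, div_eq_mul_inv, ← inv_pow]; norm_num
    have e3 : τ k * v k / 2 = A * (2 / 3 : ℝ) ^ j / 2 := by
      have : v k = A ^ 2 * (1 / 2 : ℝ) ^ j := by
        rw [hA2, e1, hv, one_div, inv_pow]; field_simp
      rw [this, hτ]
      simp only
      rw [← hj, show (2 / 3 : ℝ) = 4 / 3 * (1 / 2) by norm_num, mul_pow]
      field_simp
    calc c k / τ k = (j * d * Real.log 2) * (τ k)⁻¹ + τ k * v k / 2 := by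
          have := (hτ0 k).ne'
          rw [hc]
          simp only
          rw [← hj]
          field_simp
      _ ≤ (j * d * 1) * (τ k)⁻¹ + τ k * v k := by
          have h0 : 0 ≤ τ k * v k := by have := hτ0 k; rw [hv]; positivity
          have := hτ0 k
          gcongr
          linarith
      _ = _ := by
          have : τ k * v k = A * (2 / 3 : ℝ) ^ j := by linarith
          rw [e2, this]; ring
  calc _ ≤ ∫ ω, ∑ k ∈ Finset.range m, g k ω ∂P := by
        refine integral_mono_of_nonneg (Eventually.of_forall fun ω => ?_)
          (integrable_finsetSum _ fun k _ => hgi k) (Eventually.of_forall hpt)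
        have := le_ciSup (Set.finite_range fun x : {x // x ∈ D} => X b ω - X x.1 ω).bddAbove ⟨b, hbD⟩
        simpa using this
    _ = ∑ k ∈ Finset.range m, ∫ ω, g k ω ∂P := integral_finsetSum _ fun k _ => hgi k
    _ ≤ ∑ k ∈ Finset.range m, A * (d * ((m - 1 - k + 1 : ℕ) *
      (3 / 4 : ℝ) ^ (m - 1 - k + 1)) + (2 / 3 : ℝ) ^ (m - 1 - k + 1)) :=
        Finset.sum_le_sum fun k hk => (hgle k (Finset.mem_range.1 hk)).trans (hterm k hk)
    _ = A * ∑ j ∈ Finset.range m, (d * ((j + 1 : ℕ) *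
      (3 / 4 : ℝ) ^ (j + 1)) + (2 / 3 : ℝ) ^ (j + 1)) := by
        rw [← Finset.mul_sum, Finset.sum_range_reflect (fun j => (d * ((j + 1 : ℕ) *
          (3 / 4 : ℝ) ^ (j + 1)) + (2 / 3 : ℝ) ^ (j + 1)))]
    _ ≤ A * chainingConst d := by
        gcongr
        exact (summable_chaining d).sum_le_tsum _ fun j _ => by positivity
    _ ≤ √(V * (2 * R)) * chainingConst d := by
        have := chainingConst_pos d
        gcongr
        exact Real.sqrt_le_sqrt (by gcongr)
    _ = _ := mul_comm _ _

end Chaining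

/-! ### Finite linear functionals of the free field -/

section Pairing

variable {d : ℕ}

/-- The pairing of a field with the coefficients `c` on the finite set `S`. -/
noncomputable def pairing (S : Finset (Fin d → ℤ)) (c : (Fin d → ℤ) → ℝ)
    (φ : (Fin d → ℤ) → ℝ) : ℝ :=
  ∑ y ∈ S, c y * φ y

lemma measurable_pairing (S : Finset (Fin d → ℤ)) (c : (Fin d → ℤ) → ℝ) :
    Measurable (pairing S c) :=
  Finset.measurable_fun_sum _ fun y _ => (measurable_pi_apply y).const_mul _

lemma sum_mul_pairing {ι : Type*} (s : Finset ι) (S : Finset (Fin d → ℤ)) (w : ι → ℝ)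
    (c : ι → (Fin d → ℤ) → ℝ) (φ : (Fin d → ℤ) → ℝ) :
    ∑ i ∈ s, w i * pairing S (c i) φ = pairing S (fun y => ∑ i ∈ s, w i * c i y) φ := by
  simp only [pairing, Finset.mul_sum, Finset.sum_mul]
  rw [Finset.sum_comm]
  simp only [mul_assoc]

lemma pairing_sub (S : Finset (Fin d → ℤ)) (c c' : (Fin d → ℤ) → ℝ) (φ : (Fin d → ℤ) → ℝ) :
    pairing S c φ - pairing S c' φ = pairing S (fun y => c y - c' y) φ := by
  simp only [pairing, ← Finset.sum_sub_distrib, sub_mul]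

variable {P : Measure ((Fin d → ℤ) → ℝ)} (hP : IsGaussianFreeField P)

include hP

lemma IsGaussianFreeField.isProbabilityMeasure : IsProbabilityMeasure P :=
  hP.gaussian.isProbabilityMeasure

lemma IsGaussianFreeField.memLp_eval (x : Fin d → ℤ) :
    MemLp (fun φ : (Fin d → ℤ) → ℝ => φ x) 2 P :=
  (hP.gaussian.hasGaussianLaw_eval x).memLp_two

lemma IsGaussianFreeField.memLp_pairing (S : Finset (Fin d → ℤ)) (c : (Fin d → ℤ) → ℝ) :
    MemLp (pairing S c) 2 P :=
  memLp_finsetSum S fun y _ => (hP.memLp_eval y).const_mul _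

lemma IsGaussianFreeField.integrable_pairing (S : Finset (Fin d → ℤ)) (c : (Fin d → ℤ) → ℝ) :
    Integrable (pairing S c) P :=
  have := hP.isProbabilityMeasure
  (hP.memLp_pairing S c).integrable (by norm_num)

lemma IsGaussianFreeField.integral_pairing (S : Finset (Fin d → ℤ)) (c : (Fin d → ℤ) → ℝ) :
    ∫ φ, pairing S c φ ∂P = 0 := by
  have := hP.isProbabilityMeasure
  simp only [pairing]
  rw [integral_finsetSum _ fun y _ => ((hP.memLp_eval y).integrable (by norm_num)).const_mul _]
  simp [integral_const_mul, hP.centered]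

lemma IsGaussianFreeField.integral_pairing_mul_pairing (S S' : Finset (Fin d → ℤ))
    (c c' : (Fin d → ℤ) → ℝ) :
    ∫ φ, pairing S c φ * pairing S' c' φ ∂P
      = ∑ y ∈ S, ∑ y' ∈ S', c y * c' y' * green y y' := by
  have h : ∀ y y', Integrable (fun φ : (Fin d → ℤ) → ℝ => c y * φ y * (c' y' * φ y')) P :=
    fun y y' => ((hP.memLp_eval y).const_mul _).integrable_mul ((hP.memLp_eval y').const_mul _)
  simp only [pairing, Finset.sum_mul_sum]
  rw [integral_finsetSum _ fun y _ => integrable_finsetSum _ fun y' _ => h y y']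
  refine Finset.sum_congr rfl fun y _ => ?_
  rw [integral_finsetSum _ fun y' _ => h y y']
  refine Finset.sum_congr rfl fun y' _ => ?_
  rw [← hP.covariance, ← integral_const_mul]
  congr 1; ext φ; ring

lemma IsGaussianFreeField.hasGaussianLaw_pairing {ι : Type*} [Fintype ι]
    (S : Finset (Fin d → ℤ)) (c : ι → (Fin d → ℤ) → ℝ) :
    HasGaussianLaw (fun φ (j : ι) => pairing S (c j) φ) P := by
  have h := (hP.gaussian.hasGaussianLaw S).map_fun
    (ContinuousLinearMap.pi fun j : ι =>
      ∑ y : S, c j y • (ContinuousLinearMap.proj (R := ℝ) (φ := fun _ : S => ℝ) y))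
  refine h.congr (Eventually.of_forall fun φ => funext fun j => ?_)
  simpa [pairing, Finset.restrict] using Finset.sum_attach S fun y => c j y * φ y

lemma IsGaussianFreeField.hasGaussianLaw_pairing_real (S : Finset (Fin d → ℤ))
    (c : (Fin d → ℤ) → ℝ) : HasGaussianLaw (pairing S c) P :=
  (hP.hasGaussianLaw_pairing (ι := Unit) S fun _ => c).eval ()

lemma IsGaussianFreeField.variance_pairing (S : Finset (Fin d → ℤ)) (c : (Fin d → ℤ) → ℝ) :
    variance (pairing S c) P = ∫ φ, pairing S c φ ^ 2 ∂P :=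
  variance_of_integral_eq_zero (measurable_pairing S c).aemeasurable (hP.integral_pairing S c)

lemma IsGaussianFreeField.exp_pairing (S : Finset (Fin d → ℤ)) (c : (Fin d → ℤ) → ℝ) (τ : ℝ) :
    Integrable (fun φ => Real.exp (τ * pairing S c φ)) P ∧
      ∫ φ, Real.exp (τ * pairing S c φ) ∂P
        = Real.exp (τ ^ 2 * (∫ φ, pairing S c φ ^ 2 ∂P) / 2) := by
  have h := (hP.hasGaussianLaw_pairing_real S c).map_eq_gaussianReal
  constructor
  · have h2 := integrable_exp_mul_gaussianReal (μ := P[pairing S c])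
      (v := Var[pairing S c; P].toNNReal) τ
    rw [← h] at h2
    exact h2.comp_measurable (measurable_pairing S c)
  · have h2 := mgf_gaussianReal h τ
    rw [mgf, hP.integral_pairing, Real.coe_toNNReal _ (variance_nonneg _ _),
      hP.variance_pairing] at h2
    rw [h2]; congr 1; ring

omit hP in
lemma abs_ciInf_le_sum {ι : Type*} [Fintype ι] [Nonempty ι] (F : ι → ℝ) :
    |⨅ i, F i| ≤ ∑ i, |F i| := by
  obtain ⟨i, hi⟩ := exists_eq_ciInf_of_finite (f := F)
  rw [← hi]
  exact Finset.single_le_sum (f := fun i => |F i|) (fun i _ => abs_nonneg _) (Finset.mem_univ i)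

omit hP in
lemma iSup_neg_eq {ι : Type*} [Finite ι] [Nonempty ι] (F : ι → ℝ) : ⨆ i, -F i = -⨅ i, F i := by
  refine le_antisymm (ciSup_le fun i => neg_le_neg (ciInf_le (Set.finite_range F).bddBelow i)) ?_
  obtain ⟨i, hi⟩ := exists_eq_ciInf_of_finite (f := F)
  rw [← hi]
  exact le_ciSup (f := fun i => -F i) (Set.finite_range _).bddAbove i

lemma IsGaussianFreeField.integrable_iInf_pairing {ι : Type*} [Fintype ι] [Nonempty ι]
    (S : Finset (Fin d → ℤ)) (c : ι → (Fin d → ℤ) → ℝ) :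
    Integrable (fun φ => ⨅ i, pairing S (c i) φ) P := by
  refine Integrable.mono' (integrable_finsetSum Finset.univ fun i _ =>
    (hP.integrable_pairing S (c i)).abs)
    (Measurable.iInf fun i => measurable_pairing S (c i)).aestronglyMeasurable
    (Eventually.of_forall fun φ => ?_)
  exact abs_ciInf_le_sum _

/-- The Borell--TIS inequality for finitely many linear functionals of the field. -/
lemma IsGaussianFreeField.measureReal_iInf_pairing_le {ι : Type*} [Fintype ι] [Nonempty ι]
    (S : Finset (Fin d → ℤ)) (c : ι → (Fin d → ℤ) → ℝ) {V : ℝ} (hV0 : 0 < V)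
    (hV : ∀ i, ∫ φ, pairing S (c i) φ ^ 2 ∂P ≤ V) (a : ℝ) :
    P.real {φ | ⨅ i, pairing S (c i) φ ≤ -a} ≤
      Real.exp (-(max (a + ∫ φ, ⨅ i, pairing S (c i) φ ∂P) 0 ^ 2 / (2 * V))) := by
  -- The coefficients are negated so that the infimum becomes the supremum of a centred Gaussian
  -- vector.
  set T : ((Fin d → ℤ) → ℝ) → ι → ℝ := fun φ i => pairing S (fun y => -c i y) φ with hT
  have hneg : ∀ φ i, T φ i = -pairing S (c i) φ := fun φ i => by
    simp [hT, pairing]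
  have hsup : ∀ φ, ⨆ i, T φ i = -⨅ i, pairing S (c i) φ := fun φ => by
    simp only [hneg, iSup_neg_eq]
  have hTm : Measurable T := measurable_pi_iff.2 fun i => measurable_pairing S _
  have hG : IsGaussian (P.map T) :=
    (hP.hasGaussianLaw_pairing S fun i y => -c i y).isGaussian_map
  have hc : ∀ L : StrongDual ℝ (ι → ℝ), (P.map T)[L] = 0 := by
    intro L
    rw [integral_map hTm.aemeasurable L.continuous.measurable.aestronglyMeasurable]
    classical
    have : ∀ φ, L (T φ) = ∑ i, T φ i * L (Pi.single i 1) := fun φ => by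
      conv_lhs => rw [pi_eq_sum_univ' (T φ)]
      simp [map_sum, map_smul]
    simp only [this]
    rw [integral_finsetSum _ fun i _ => (hP.integrable_pairing S _).mul_const _]
    simp only [integral_mul_const, hP.integral_pairing, zero_mul, Finset.sum_const_zero]
  have hm : Measurable fun y : ι → ℝ => ⨆ i, y i := Measurable.iSup fun i => measurable_pi_apply i
  have key := measureReal_iSup_ge_le (P.map T) hc hV0 (fun i => by
    rw [integral_map hTm.aemeasurable
      ((measurable_pi_apply i).pow_const 2).aestronglyMeasurable]
    simp only [hneg, neg_sq]
    exact hV i) a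
  rw [integral_map hTm.aemeasurable hm.aestronglyMeasurable,
    map_measureReal_apply hTm (measurableSet_le measurable_const hm)] at key
  simp only [hsup, integral_neg, sub_neg_eq_add] at key
  refine le_trans (le_of_eq ?_) key
  congr 1
  ext φ
  simp only [Set.mem_ofPred_eq, Set.mem_preimage, hsup]
  exact le_neg.symm

end Pairing

/-! ### Infima over selections -/

section Infimum

/-- The infimum over selections of a nonnegatively weighted sum is attained coordinatewise. -/
lemma iInf_sum_mul {ι : Type*} [Fintype ι] {β : ι → Type*} [∀ i, Finite (β i)]
    [∀ i, Nonempty (β i)] (w : ι → ℝ) (hw : ∀ i, 0 ≤ w i) (F : ∀ i, β i → ℝ) :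
    ⨅ f : ∀ i, β i, ∑ i, w i * F i (f i) = ∑ i, w i * ⨅ x, F i x := by
  apply le_antisymm
  · choose f hf using fun i => exists_eq_ciInf_of_finite (f := F i)
    have := ciInf_le (Set.finite_range fun f : ∀ i, β i => ∑ i, w i * F i (f i)).bddBelow f
    simpa only [hf] using this
  · exact le_ciInf fun f => Finset.sum_le_sum fun i _ =>
      mul_le_mul_of_nonneg_left (ciInf_le (Set.finite_range _).bddBelow _) (hw i)

end Infimum

/-! ### Geometry of the boxes `B`, `D` and `U` -/

section Geometry

variable {d : ℕ} {L K : ℕ} {z z' x y u : Fin d → ℤ}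

lemma abs_apply_le_norm (m : Fin d → ℤ) (i : Fin d) : ((|m i| : ℤ) : ℝ) ≤ ‖m‖ := by
  have := norm_le_pi_norm m i
  rwa [Int.norm_eq_abs, ← Int.cast_abs] at this

lemma norm_le_of_abs_apply_le {m : Fin d → ℤ} {n : ℤ} (hn : 0 ≤ n) (h : ∀ i, |m i| ≤ n) :
    ‖m‖ ≤ n := by
  refine (pi_norm_le_iff_of_nonneg (by exact_mod_cast hn)).2 fun i => ?_
  rw [Int.norm_eq_abs]
  exact_mod_cast h i

lemma mem_boxB : x ∈ boxB L z ↔ ∀ i, z i ≤ x i ∧ x i < z i + L := by simp [boxB]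

lemma mem_boxD : x ∈ boxD L z ↔ ∀ i, z i - 3 * L ≤ x i ∧ x i < z i + 4 * L := by simp [boxD]

lemma mem_boxU : x ∈ boxU L K z ↔
    ∀ i, z i - K * L + 1 ≤ x i ∧ x i < z i + L + K * L - 1 := by simp [boxU]

lemma boxD_eq_cornerBox (L : ℕ) (z : Fin d → ℤ) :
    boxD L z = cornerBox (fun i => z i - 3 * L) (7 * L) := by
  ext x
  rw [mem_boxD, mem_cornerBox]
  refine forall_congr' fun i => ?_
  push_cast
  omega

lemma boxB_subset_boxD (L : ℕ) (z : Fin d → ℤ) : boxB L z ⊆ boxD L z := fun x hx => by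
  rw [mem_boxD]
  intro i
  have := mem_boxB.1 hx i
  omega

lemma boxB_nonempty (hL : 1 ≤ L) (z : Fin d → ℤ) : (boxB L z).Nonempty :=
  ⟨z, mem_boxB.2 fun i => by omega⟩

lemma mul_cast_le (hK : 100 ≤ K) : (100 : ℤ) * L ≤ K * L := by
  exact_mod_cast Nat.mul_le_mul_right L hK

lemma boxD_subset_boxU (hL : 1 ≤ L) (hK : 100 ≤ K) (z : Fin d → ℤ) :
    boxD L z ⊆ boxU L K z := fun x hx => by
  rw [mem_boxU]
  intro i
  have := mem_boxD.1 hx i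
  have := mul_cast_le (L := L) hK
  omega

/-- The true gap is at least `KL - 3L`; the halved form follows from `K ≥ 100`. -/
lemma le_norm_sub_of_notMem_boxU (hK : 100 ≤ K) (hx : x ∈ boxD L z) (hu : u ∉ boxU L K z) :
    (K * L : ℝ) / 2 ≤ ‖x - u‖ := by
  rw [mem_boxU] at hu
  push Not at hu
  obtain ⟨i, hi⟩ := hu
  have h1 := mem_boxD.1 hx i
  have h2 := mul_cast_le (L := L) hK
  have h3 : (K * L : ℤ) - 3 * L ≤ |x i - u i| := by
    rcases le_or_gt (z i - K * L + 1) (u i) with h | h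
    · have := hi h
      rw [abs_sub_comm]
      exact le_trans (by omega) (le_abs_self _)
    · exact le_trans (by omega) (le_abs_self _)
  have h4 := abs_apply_le_norm (x - u) i
  have h5 : ((K * L : ℤ) - 3 * L : ℝ) ≤ ((|x i - u i| : ℤ) : ℝ) := by exact_mod_cast h3
  have h6 : (100 : ℝ) * L ≤ K * L := by exact_mod_cast h2
  have h7 : (0 : ℝ) ≤ L := L.cast_nonneg
  push_cast at h5
  simp only [Pi.sub_apply, Int.cast_abs, Int.cast_sub] at h4
  linarith

lemma norm_sub_le_of_mem_boxD (hL : 1 ≤ L) (hx : x ∈ boxD L z) (hy : y ∈ boxD L z) :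
    ‖x - y‖ ≤ 7 * L := by
  have : ‖x - y‖ ≤ ((7 * L : ℤ) : ℝ) := norm_le_of_abs_apply_le (by omega) fun i => by
    have h1 := mem_boxD.1 hx i
    have h2 := mem_boxD.1 hy i
    rw [Pi.sub_apply, abs_le]
    omega
  exact_mod_cast this

lemma norm_sub_le_of_mem_boxD_boxB (hx : x ∈ boxD L z) (hy : y ∈ boxB L z) :
    ‖x - y‖ ≤ 4 * L := by
  have : ‖x - y‖ ≤ ((4 * L : ℤ) : ℝ) := norm_le_of_abs_apply_le (by omega) fun i => by
    have h1 := mem_boxD.1 hx i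
    have h2 := mem_boxB.1 hy i
    rw [Pi.sub_apply, abs_le]
    omega
  exact_mod_cast this

lemma norm_sub_le_of_mem_boxB (hL : 1 ≤ L) (hx : x ∈ boxB L z) (hy : y ∈ boxB L z) :
    ‖x - y‖ ≤ L := by
  have : ‖x - y‖ ≤ ((L : ℤ) : ℝ) := norm_le_of_abs_apply_le (by omega) fun i => by
    have h1 := mem_boxB.1 hx i
    have h2 := mem_boxB.1 hy i
    rw [Pi.sub_apply, abs_le]
    omega
  exact_mod_cast this

lemma exists_le_abs_sub (hL : 1 ≤ L) (h : (L : ℝ) + 2 * K * L ≤ ‖z - z'‖) :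
    ∃ i, (L : ℤ) + 2 * (K * L) ≤ |z i - z' i| := by
  by_contra! hc
  have hpos : (0 : ℝ) < (L : ℝ) + 2 * K * L := by positivity
  refine h.not_gt ((pi_norm_lt_iff hpos).2 fun i => ?_)
  have := hc i
  rw [Int.norm_eq_abs, ← Int.cast_abs]
  have h2 : ((|z i - z' i| : ℤ) : ℝ) < ((L + 2 * (K * L) : ℤ) : ℝ) := by exact_mod_cast this
  push_cast at h2 ⊢
  simp only [Pi.sub_apply, Int.cast_sub]
  linarith

/-- The separation `L + 2KL` keeps the shrunken boxes `U` apart even after one of them is enlarged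
by a site. The outer boundary of one therefore avoids the other, as the covariance formula demands.
-/
lemma notMem_boxU_of_close (hL : 1 ≤ L) (h : (L : ℝ) + 2 * K * L ≤ ‖z - z'‖)
    (hy : y ∈ boxU L K z') (hu : ∀ i, |u i - y i| ≤ 1) : u ∉ boxU L K z := by
  intro hu'
  obtain ⟨i, hi⟩ := exists_le_abs_sub hL h
  have h1 := mem_boxU.1 hy i
  have h2 := mem_boxU.1 hu' i
  have h3 := abs_le.1 (hu i)
  rcases le_abs'.1 hi with hi | hi <;> omega

lemma le_norm_sub_of_mem_boxB (hL : 1 ≤ L) (h : (L : ℝ) + 2 * K * L ≤ ‖z - z'‖)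
    (hx : x ∈ boxB L z) (hy : y ∈ boxB L z') : (2 * (K * L) : ℝ) ≤ ‖x - y‖ := by
  obtain ⟨i, hi⟩ := exists_le_abs_sub hL h
  have h1 := mem_boxB.1 hx i
  have h2 := mem_boxB.1 hy i
  have h3 : (2 * (K * L) : ℤ) ≤ |x i - y i| := by
    rw [le_abs'] at hi ⊢
    omega
  have h4 := abs_apply_le_norm (x - y) i
  refine le_trans ?_ h4
  exact_mod_cast h3

end Geometry

/-! ### Covariances of harmonic averages and the Green function at scale `L` -/

section Covariance

variable {d : ℕ} [NeZero d] {P : Measure ((Fin d → ℤ) → ℝ)}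

lemma harmonicAverage_eq_pairing {U S : Finset (Fin d → ℤ)} {x : Fin d → ℤ} (hx : x ∈ U)
    (hS : outerBoundary U ⊆ S) (φ : (Fin d → ℤ) → ℝ) :
    harmonicAverage U φ x = pairing S (exitLaw U x) φ := by
  rw [harmonicAverage_eq_sum hx, pairing]
  exact Finset.sum_subset hS fun y _ hy => by rw [exitLaw_eq_zero hx hy, zero_mul]

/-- Sum first over the exit point from `U`: for fixed `u` outside `U`, the function `g(·, u)` is
harmonic in `U`. The choice `U' = U` is allowed and gives variances. -/
lemma IsGaussianFreeField.integral_harmonicAverage_mul (hP : IsGaussianFreeField P) (hd : 3 ≤ d)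
    {U U' : Finset (Fin d → ℤ)} {x x' : Fin d → ℤ} (hx : x ∈ U) (hx' : x' ∈ U')
    (h : ∀ u ∈ outerBoundary U', u ∉ U) :
    ∫ φ, harmonicAverage U φ x * harmonicAverage U' φ x' ∂P
      = ∑ u ∈ outerBoundary U', exitLaw U' x' u * green x u := by
  simp only [harmonicAverage_eq_pairing hx subset_rfl, harmonicAverage_eq_pairing hx' subset_rfl]
  rw [hP.integral_pairing_mul_pairing, Finset.sum_comm]
  refine Finset.sum_congr rfl fun u hu => ?_
  rw [← sum_exitLaw_green hd hx (h u hu), Finset.mul_sum]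
  exact Finset.sum_congr rfl fun y _ => by ring

/-- Harmonic averages over domains far apart have the covariance of the field itself. -/
lemma IsGaussianFreeField.integral_harmonicAverage_mul_of_disjoint (hP : IsGaussianFreeField P)
    (hd : 3 ≤ d) {U U' : Finset (Fin d → ℤ)} {x x' : Fin d → ℤ} (hx : x ∈ U) (hx' : x' ∈ U')
    (h : ∀ u ∈ outerBoundary U', u ∉ U) (hxU : x ∉ U') :
    ∫ φ, harmonicAverage U φ x * harmonicAverage U' φ x' ∂P = green x x' := by
  rw [hP.integral_harmonicAverage_mul hd hx hx' h, green_comm hd x x',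
    ← sum_exitLaw_green hd hx' hxU]
  exact Finset.sum_congr rfl fun u _ => by rw [green_comm hd x u]

lemma IsGaussianFreeField.integral_sq_harmonicAverage_le (hP : IsGaussianFreeField P) (hd : 3 ≤ d)
    {U : Finset (Fin d → ℤ)} {x : Fin d → ℤ} (hx : x ∈ U) {M : ℝ}
    (hM : ∀ u ∈ outerBoundary U, green x u ≤ M) :
    ∫ φ, harmonicAverage U φ x ^ 2 ∂P ≤ M := by
  simp only [sq]
  rw [hP.integral_harmonicAverage_mul hd hx hx fun u hu => (mem_outerBoundary hu).1]
  calc _ ≤ ∑ u ∈ outerBoundary U, exitLaw U x u * M :=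
        Finset.sum_le_sum fun u hu => mul_le_mul_of_nonneg_left (hM u hu) (exitLaw_nonneg _ _ _)
    _ = M := by rw [← Finset.sum_mul, sum_exitLaw hx, one_mul]

/-- The variance of the difference equals `∑_u (exitLaw U x u - exitLaw U y u) (g(x,u) - g(y,u))`,
and the first factor has total absolute mass at most `2`. -/
lemma IsGaussianFreeField.integral_sq_harmonicAverage_sub_le (hP : IsGaussianFreeField P)
    (hd : 3 ≤ d) {U : Finset (Fin d → ℤ)} {x y : Fin d → ℤ} (hx : x ∈ U) (hy : y ∈ U) {M : ℝ}
    (hM : ∀ u ∈ outerBoundary U, |green x u - green y u| ≤ M) :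
    ∫ φ, pairing (outerBoundary U) (fun u => exitLaw U x u - exitLaw U y u) φ ^ 2 ∂P ≤ 2 * M := by
  simp only [sq]
  rw [hP.integral_pairing_mul_pairing, Finset.sum_comm]
  have h1 : ∀ u ∈ outerBoundary U, ∑ v ∈ outerBoundary U,
      (exitLaw U x v - exitLaw U y v) * (exitLaw U x u - exitLaw U y u) * green v u
        = (exitLaw U x u - exitLaw U y u) * (green x u - green y u) := by
    intro u hu
    rw [← sum_exitLaw_green hd hx (mem_outerBoundary hu).1,
      ← sum_exitLaw_green hd hy (mem_outerBoundary hu).1, ← Finset.sum_sub_distrib,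
      Finset.mul_sum]
    exact Finset.sum_congr rfl fun v _ => by ring
  rw [Finset.sum_congr rfl h1]
  calc _ ≤ ∑ u ∈ outerBoundary U, (exitLaw U x u + exitLaw U y u) * M := by
        refine Finset.sum_le_sum fun u hu => ?_
        refine (le_abs_self _).trans ?_
        rw [abs_mul]
        have hx0 := exitLaw_nonneg U x u
        have hy0 := exitLaw_nonneg U y u
        refine mul_le_mul ?_ (hM u hu) (abs_nonneg _) (by positivity)
        rw [abs_le]
        constructor <;> linarith
    _ = 2 * M := by
        rw [← Finset.sum_mul, Finset.sum_add_distrib, sum_exitLaw hx, sum_exitLaw hy]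
        norm_num

variable {L K : ℕ}

lemma IsGaussianFreeField.integral_sq_boxAverage_le (hd : 3 ≤ d) : ∃ C : ℝ, 0 < C ∧
    ∀ P : Measure ((Fin d → ℤ) → ℝ), IsGaussianFreeField P → ∀ L K : ℕ, 1 ≤ L → 100 ≤ K →
      ∀ z, ∀ x ∈ boxD L z, ∫ φ, boxAverage L K z φ x ^ 2 ∂P ≤ C / (K * L : ℝ) ^ (d - 2) := by
  obtain ⟨C, hC0, hC⟩ := green_le (d := d) hd
  refine ⟨C * 2 ^ (d - 2), by positivity, fun P hP L K hL hK z x hx => ?_⟩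
  refine hP.integral_sq_harmonicAverage_le hd (boxD_subset_boxU hL hK z hx) fun u hu => ?_
  have h := le_norm_sub_of_notMem_boxU hK hx (mem_outerBoundary hu).1
  have hKL : (0 : ℝ) < K * L := by positivity
  calc green x u ≤ C / radius (x - u) ^ (d - 2) := hC x u
    _ ≤ C / ((K * L : ℝ) / 2) ^ (d - 2) := by
        gcongr
        exact h.trans (norm_le_radius _)
    _ = _ := by rw [div_pow]; field_simp

/-- Only one of the two differences is estimated by the gradient of `g`, hence a bound linear in `‖x
- y‖`. That is enough: chaining over a box of side `7L` yields order `K^{-(d-1)/2} L^{-(d-2)/2}`. -/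
lemma IsGaussianFreeField.integral_sq_boxAverage_sub_le (hd : 3 ≤ d) : ∃ C : ℝ, 0 < C ∧
    ∀ P : Measure ((Fin d → ℤ) → ℝ), IsGaussianFreeField P → ∀ L K : ℕ, 1 ≤ L → 100 ≤ K →
      ∀ z, ∀ x ∈ boxD L z, ∀ y ∈ boxD L z,
        ∫ φ, pairing (outerBoundary (boxU L K z))
          (fun u => exitLaw (boxU L K z) x u - exitLaw (boxU L K z) y u) φ ^ 2 ∂P
          ≤ C / (K * L : ℝ) ^ (d - 1) * ‖x - y‖ := by
  obtain ⟨C, hC0, hC⟩ := abs_green_sub_le (d := d) hd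
  refine ⟨2 * (C * 2 ^ (d - 1)), by positivity, fun P hP L K hL hK z x hx y hy => ?_⟩
  have hKL : (0 : ℝ) < K * L := by positivity
  have hL0 : (0 : ℝ) < L := by positivity
  have h100 : (100 : ℝ) * L ≤ K * L := by exact_mod_cast mul_cast_le (L := L) hK
  refine (hP.integral_sq_harmonicAverage_sub_le hd (boxD_subset_boxU hL hK z hx)
    (boxD_subset_boxU hL hK z hy) (M := C * 2 ^ (d - 1) / (K * L : ℝ) ^ (d - 1) * ‖x - y‖)
    fun u hu => ?_).trans (le_of_eq (by ring))
  have h := le_norm_sub_of_notMem_boxU hK hy (mem_outerBoundary hu).1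
  have hxy := norm_sub_le_of_mem_boxD hL hx hy
  calc _ ≤ C * ‖x - y‖ / ‖y - u‖ ^ (d - 1) := hC x y u (by linarith) (by linarith)
    _ ≤ C * ‖x - y‖ / ((K * L : ℝ) / 2) ^ (d - 1) := by gcongr
    _ = _ := by rw [div_pow]; field_simp

/-- The equilibrium potential is `1` on the box, while `g ≥ c L^{2-d}` there. -/
lemma capacity_boxB_le (hd : 3 ≤ d) : ∃ C : ℝ, 0 < C ∧ ∀ L : ℕ, 1 ≤ L → ∀ z : Fin d → ℤ,
    capacity (boxB L z) ≤ C * (L : ℝ) ^ (d - 2) := by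
  obtain ⟨c, hc0, hc⟩ := le_green (d := d) hd
  refine ⟨c⁻¹, by positivity, fun L hL z => ?_⟩
  have hz : z ∈ boxB L z := mem_boxB.2 fun i => by omega
  have hL1 : (1 : ℝ) ≤ L := by exact_mod_cast hL
  have h1 : c / (L : ℝ) ^ (d - 2) * capacity (boxB L z) ≤ 1 := by
    rw [← sum_green_mul_equilibrium_of_mem hd hz, capacity, Finset.mul_sum]
    refine Finset.sum_le_sum fun y hy => mul_le_mul_of_nonneg_right ?_ (equilibrium_nonneg _ _)
    refine le_trans ?_ (hc z y)
    have := radius_pos (z - y)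
    gcongr
    exact max_le hL1 (norm_sub_le_of_mem_boxB hL hz hy)
  rw [div_mul_eq_mul_div, div_le_one (by positivity)] at h1
  rw [inv_mul_eq_div, le_div_iff₀ hc0]
  linarith

lemma green_boxD_le (hd : 3 ≤ d) : ∃ C : ℝ, 0 < C ∧ ∀ L K : ℕ, 1 ≤ L → 100 ≤ K →
    ∀ z z' : Fin d → ℤ, (L : ℝ) + 2 * K * L ≤ ‖z - z'‖ → ∀ f ∈ boxD L z, ∀ f' ∈ boxD L z',
      ∀ x ∈ boxB L z, ∀ x' ∈ boxB L z', green f f' ≤ (1 + C / K) * green x x' := by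
  obtain ⟨C, hC0, hC⟩ := green_le_green_add (d := d) hd
  refine ⟨2 * C, by positivity, fun L K hL hK z z' hz f hf f' hf' x hx x' hx' => ?_⟩
  have h := le_norm_sub_of_mem_boxB hL hz hx hx'
  have hK1 : (100 : ℝ) ≤ K := by exact_mod_cast hK
  have hL1 : (1 : ℝ) ≤ L := by exact_mod_cast hL
  -- Displacements of at most `4L` against distances of at least `2KL` give the relative size `ε =
  -- 2/K`.
  have h4 : (4 * L : ℝ) ≤ 2 / K * ‖x - x'‖ := by
    calc (4 * L : ℝ) = 2 / K * (2 * (K * L)) := by field_simp; norm_num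
      _ ≤ _ := by gcongr
  have := hC x x' f f' (2 / K) (by nlinarith) (by rw [div_le_iff₀ (by linarith)]; linarith)
    ((norm_sub_le_of_mem_boxD_boxB hf hx).trans h4) ((norm_sub_le_of_mem_boxD_boxB hf' hx').trans h4)
  refine this.trans (le_of_eq ?_)
  ring

end Covariance

lemma integral_sq_sum_mul {Ω ι : Type*} [Fintype ι] [MeasurableSpace Ω] {μ : Measure Ω}
    {X : ι → Ω → ℝ} (hX : ∀ i, MemLp (X i) 2 μ) (w : ι → ℝ) :
    ∫ ω, (∑ i, w i * X i ω) ^ 2 ∂μ = ∑ i, ∑ j, w i * w j * ∫ ω, X i ω * X j ω ∂μ := by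
  have h : ∀ i j, Integrable (fun ω => w i * X i ω * (w j * X j ω)) μ :=
    fun i j => ((hX i).const_mul _).integrable_mul ((hX j).const_mul _)
  simp only [sq, Finset.sum_mul_sum]
  rw [integral_finsetSum _ fun i _ => integrable_finsetSum _ fun j _ => h i j]
  refine Finset.sum_congr rfl fun i _ => ?_
  rw [integral_finsetSum _ fun j _ => h i j]
  refine Finset.sum_congr rfl fun j _ => ?_
  rw [← integral_const_mul]
  congr 1; ext ω; ring

lemma iSup_const_sub {ι : Type*} [Finite ι] [Nonempty ι] (a : ℝ) (F : ι → ℝ) :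
    ⨆ i, (a - F i) = a - ⨅ i, F i := by
  refine le_antisymm (ciSup_le fun i =>
    sub_le_sub_left (ciInf_le (Set.finite_range F).bddBelow i) a) ?_
  obtain ⟨i, hi⟩ := exists_eq_ciInf_of_finite (f := F)
  rw [← hi]
  exact le_ciSup (f := fun i => a - F i) (Set.finite_range _).bddAbove i

/-! ### Variance and mean of the weighted averages over a collection -/

section Collection

variable {d : ℕ} {L K : ℕ} {𝒞 : Finset (Fin d → ℤ)}

lemma IsBoxCollection.pairwiseDisjoint (hC : IsBoxCollection L K 𝒞) (hL : 1 ≤ L) (hK : 100 ≤ K) :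
    (𝒞 : Set (Fin d → ℤ)).PairwiseDisjoint (boxB L) := by
  intro z hz z' hz' hne
  refine Finset.disjoint_left.2 fun x hx hx' => ?_
  have h := le_norm_sub_of_mem_boxB hL (hC.separated z hz z' hz' hne) hx hx'
  have : (0 : ℝ) < 2 * (K * L) := by positivity
  rw [sub_self, norm_zero] at h
  linarith

lemma IsBoxCollection.sum_boxUnion (hC : IsBoxCollection L K 𝒞) (hL : 1 ≤ L) (hK : 100 ≤ K)
    (F : (Fin d → ℤ) → ℝ) :
    ∑ x ∈ boxUnion L 𝒞, F x = ∑ z : {z // z ∈ 𝒞}, ∑ x ∈ boxB L z.1, F x := by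
  rw [boxUnion, Finset.sum_biUnion (hC.pairwiseDisjoint hL hK)]
  exact (Finset.sum_coe_sort 𝒞 fun z => ∑ x ∈ boxB L z, F x).symm

lemma IsBoxCollection.boxUnion_nonempty (hC : IsBoxCollection L K 𝒞) (hL : 1 ≤ L) :
    (boxUnion L 𝒞).Nonempty :=
  hC.nonempty.biUnion fun z _ => boxB_nonempty hL z

variable [NeZero d]

lemma boxWeight_nonneg (hd : 3 ≤ d) (hC : IsBoxCollection L K 𝒞) (hL : 1 ≤ L) (z : Fin d → ℤ) :
    0 ≤ boxWeight L 𝒞 z :=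
  div_nonneg (Finset.sum_nonneg fun x _ => equilibrium_nonneg _ x)
    (capacity_pos hd (hC.boxUnion_nonempty hL)).le

lemma sum_boxWeight (hd : 3 ≤ d) (hC : IsBoxCollection L K 𝒞) (hL : 1 ≤ L) (hK : 100 ≤ K) :
    ∑ z : {z // z ∈ 𝒞}, boxWeight L 𝒞 z.1 = 1 := by
  have h := capacity_pos hd (hC.boxUnion_nonempty hL)
  simp only [boxWeight]
  rw [← Finset.sum_div, ← hC.sum_boxUnion hL hK, ← capacity, div_self h.ne']

lemma sum_equilibrium_boxUnion_le {z : Fin d → ℤ} (hz : z ∈ 𝒞) :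
    ∑ x ∈ boxB L z, equilibrium (boxUnion L 𝒞) x ≤ capacity (boxB L z) :=
  Finset.sum_le_sum fun _ hx => equilibrium_anti (Finset.subset_biUnion_of_mem (boxB L) hz) hx

lemma capacity_boxUnion_le (hd : 3 ≤ d) : ∃ C : ℝ, 0 < C ∧ ∀ L K : ℕ, 1 ≤ L → 100 ≤ K →
    ∀ 𝒞 : Finset (Fin d → ℤ), IsBoxCollection L K 𝒞 →
      capacity (boxUnion L 𝒞) ≤ 𝒞.card * (C * (L : ℝ) ^ (d - 2)) := by
  obtain ⟨C, hC0, hC⟩ := capacity_boxB_le (d := d) hd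
  refine ⟨C, hC0, fun L K hL hK 𝒞 h𝒞 => ?_⟩
  rw [capacity, h𝒞.sum_boxUnion hL hK]
  calc _ ≤ ∑ z : {z // z ∈ 𝒞}, C * (L : ℝ) ^ (d - 2) :=
        Finset.sum_le_sum fun z _ => (sum_equilibrium_boxUnion_le z.2).trans (hC L hL z.1)
    _ = _ := by simp

/-- The coefficients of `Z_f` as a linear functional of the field. -/
noncomputable def selectionCoeff (L K : ℕ) (𝒞 : Finset (Fin d → ℤ)) (f : Selection L 𝒞)
    (y : Fin d → ℤ) : ℝ :=
  ∑ z : {z // z ∈ 𝒞}, boxWeight L 𝒞 z.1 * exitLaw (boxU L K z.1) (f z).1 y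

/-- The sites that carry the harmonic averages of a collection. -/
noncomputable def collectionBoundary (L K : ℕ) (𝒞 : Finset (Fin d → ℤ)) : Finset (Fin d → ℤ) :=
  𝒞.biUnion fun z => outerBoundary (boxU L K z)

lemma boxAverage_eq_pairing (hL : 1 ≤ L) (hK : 100 ≤ K) {z x : Fin d → ℤ} (hx : x ∈ boxD L z) :
    (fun φ => boxAverage L K z φ x)
      = pairing (outerBoundary (boxU L K z)) (exitLaw (boxU L K z) x) :=
  funext fun φ => harmonicAverage_eq_pairing (boxD_subset_boxU hL hK z hx) subset_rfl φ

lemma weightedAverage_eq_pairing (hL : 1 ≤ L) (hK : 100 ≤ K) (f : Selection L 𝒞) :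
    weightedAverage L K 𝒞 f = pairing (collectionBoundary L K 𝒞) (selectionCoeff L K 𝒞 f) := by
  ext φ
  rw [weightedAverage]
  unfold selectionCoeff
  rw [← sum_mul_pairing]
  refine Finset.sum_congr rfl fun z _ => ?_
  rw [boxAverage, harmonicAverage_eq_pairing (boxD_subset_boxU hL hK z.1 (f z).2)]
  exact Finset.subset_biUnion_of_mem (fun z => outerBoundary (boxU L K z)) z.2

variable {P : Measure ((Fin d → ℤ) → ℝ)}

/-- The variance of `Z_f` is at most `(1 + O(1 / K)) / cap C`. -/
lemma IsGaussianFreeField.integral_sq_weightedAverage_le (hd : 3 ≤ d) : ∃ C : ℝ, 0 < C ∧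
    ∀ P : Measure ((Fin d → ℤ) → ℝ), IsGaussianFreeField P → ∀ L K : ℕ, 1 ≤ L → 100 ≤ K →
      ∀ 𝒞 : Finset (Fin d → ℤ), IsBoxCollection L K 𝒞 → ∀ f : Selection L 𝒞,
        (∫ φ, weightedAverage L K 𝒞 f φ ^ 2 ∂P) * capacity (boxUnion L 𝒞) ≤ 1 + C / K := by
  classical
  obtain ⟨C₁, hC₁, h₁⟩ := green_boxD_le (d := d) hd
  obtain ⟨C₂, hC₂, h₂⟩ := IsGaussianFreeField.integral_sq_boxAverage_le (d := d) hd
  obtain ⟨C₃, hC₃, h₃⟩ := capacity_boxB_le (d := d) hd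
  refine ⟨C₁ + C₂ * C₃, by positivity, fun P hP L K hL hK 𝒞 h𝒞 f => ?_⟩
  have hcap := capacity_pos hd (h𝒞.boxUnion_nonempty hL)
  set e := equilibrium (boxUnion L 𝒞) with he
  have he0 : ∀ x, 0 ≤ e x := equilibrium_nonneg _
  set E : {z // z ∈ 𝒞} → ℝ := fun z => ∑ x ∈ boxB L z.1, e x with hE
  have hE0 : ∀ z, 0 ≤ E z := fun z => Finset.sum_nonneg fun x _ => he0 x
  -- The mutual energy of the equilibrium measure between two boxes; summed over all pairs it gives
  -- `cap(C)`.
  set G : {z // z ∈ 𝒞} → {z // z ∈ 𝒞} → ℝ := fun z z' =>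
    ∑ x ∈ boxB L z.1, ∑ x' ∈ boxB L z'.1, e x * e x' * green x x' with hG
  have hG0 : ∀ z z', 0 ≤ G z z' := fun z z' => Finset.sum_nonneg fun x _ =>
    Finset.sum_nonneg fun x' _ => mul_nonneg (mul_nonneg (he0 x) (he0 x')) (green_nonneg _ _)
  have hK0 : (0 : ℝ) < K := by positivity
  have hK1 : (1 : ℝ) ≤ K := by exact_mod_cast (by omega : 1 ≤ K)
  have hL0 : (0 : ℝ) < L := by positivity
  -- Off the diagonal the covariance is compared with `g` on the boxes. On the diagonal the powers
  -- of `L` in `E z = O(L^{d-2})` and in the variance `O((KL)^{2-d})` cancel, leaving `K^{2-d} ≤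
  -- 1/K`; the nonnegative energy `G z z` is added for free.
  have hcov : ∀ z z' : {z // z ∈ 𝒞}, E z * E z' *
      (∫ φ, boxAverage L K z.1 φ (f z).1 * boxAverage L K z'.1 φ (f z').1 ∂P)
        ≤ (1 + C₁ / K) * G z z' + if z = z' then E z * (C₂ * C₃ / K) else 0 := by
    intro z z'
    by_cases hzz : z = z'
    · subst hzz
      rw [if_pos rfl]
      have hv := h₂ P hP L K hL hK z.1 (f z).1 (f z).2
      have hEle : E z ≤ C₃ * (L : ℝ) ^ (d - 2) :=
        (sum_equilibrium_boxUnion_le z.2).trans (h₃ L hL z.1)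
      have hKp : (K : ℝ) ≤ (K : ℝ) ^ (d - 2) := le_self_pow₀ hK1 (by omega)
      simp only [← sq]
      calc E z ^ 2 * (∫ φ, boxAverage L K z.1 φ (f z).1 ^ 2 ∂P)
          ≤ E z ^ 2 * (C₂ / (K * L : ℝ) ^ (d - 2)) := by gcongr
        _ ≤ E z * (C₃ * (L : ℝ) ^ (d - 2)) * (C₂ / (K * L : ℝ) ^ (d - 2)) := by
            rw [sq]
            have := hE0 z
            gcongr
        _ = E z * (C₂ * C₃ / (K : ℝ) ^ (d - 2)) := by rw [mul_pow]; field_simp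
        _ ≤ E z * (C₂ * C₃ / K) := by
            have := hE0 z
            gcongr
        _ ≤ _ := le_add_of_nonneg_left (mul_nonneg (by positivity) (hG0 z z))
    · rw [if_neg hzz, add_zero]
      have hne : z.1 ≠ z'.1 := fun h => hzz (Subtype.ext h)
      have hsep := h𝒞.separated z.1 z.2 z'.1 z'.2 hne
      have hf := boxD_subset_boxU hL hK z.1 (f z).2
      have hf' := boxD_subset_boxU hL hK z'.1 (f z').2
      have hc := hP.integral_harmonicAverage_mul_of_disjoint hd hf hf' (fun u hu => by
        obtain ⟨-, y, hy, huy⟩ := mem_outerBoundary hu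
        exact notMem_boxU_of_close hL hsep hy huy)
        (notMem_boxU_of_close hL (by rw [norm_sub_rev]; exact hsep) hf (fun i => by simp))
      simp only [boxAverage]
      rw [hc, hE, hG]
      simp only
      rw [Finset.sum_mul_sum, Finset.sum_mul, Finset.mul_sum]
      refine Finset.sum_le_sum fun x hx => ?_
      rw [Finset.sum_mul, Finset.mul_sum]
      refine Finset.sum_le_sum fun x' hx' => ?_
      have := h₁ L K hL hK z.1 z'.1 hsep _ (f z).2 _ (f z').2 x hx x' hx'
      calc _ ≤ e x * e x' * ((1 + C₁ / K) * green x x') :=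
            mul_le_mul_of_nonneg_left this (mul_nonneg (he0 x) (he0 x'))
        _ = _ := by ring
  -- The equilibrium potential equals `1` on `C`, so the energy is the total mass.
  have hGsum : ∑ z, ∑ z', G z z' = capacity (boxUnion L 𝒞) := by
    have h : ∀ x ∈ boxUnion L 𝒞, ∑ x' ∈ boxUnion L 𝒞, e x * e x' * green x x' = e x := by
      intro x hx
      have := sum_green_mul_equilibrium_of_mem hd hx
      rw [← he] at this
      calc _ = e x * ∑ y ∈ boxUnion L 𝒞, green x y * e y := by
            rw [Finset.mul_sum]
            exact Finset.sum_congr rfl fun y _ => by ring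
        _ = e x := by rw [this, mul_one]
    rw [capacity, ← Finset.sum_congr rfl h, h𝒞.sum_boxUnion hL hK]
    refine Finset.sum_congr rfl fun z _ => ?_
    rw [Finset.sum_comm]
    refine Finset.sum_congr rfl fun x _ => ?_
    rw [h𝒞.sum_boxUnion hL hK]
  have hEsum : ∑ z, E z = capacity (boxUnion L 𝒞) := (h𝒞.sum_boxUnion hL hK e).symm
  have hsq := integral_sq_sum_mul (μ := P)
    (X := fun (z : {z // z ∈ 𝒞}) φ => boxAverage L K z.1 φ (f z).1) (fun z => by
      rw [boxAverage_eq_pairing hL hK (f z).2]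
      exact hP.memLp_pairing _ _) fun z => boxWeight L 𝒞 z.1
  have key : ∑ z, ∑ z', E z * E z' *
      (∫ φ, boxAverage L K z.1 φ (f z).1 * boxAverage L K z'.1 φ (f z').1 ∂P)
        ≤ (1 + (C₁ + C₂ * C₃) / K) * capacity (boxUnion L 𝒞) := by
    calc _ ≤ ∑ z, ∑ z', ((1 + C₁ / K) * G z z' + if z = z' then E z * (C₂ * C₃ / K) else 0) :=
          Finset.sum_le_sum fun z _ => Finset.sum_le_sum fun z' _ => hcov z z'
      _ = (1 + C₁ / K) * ∑ z, ∑ z', G z z' + (∑ z, E z) * (C₂ * C₃ / K) := by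
          simp only [Finset.sum_add_distrib, Finset.mul_sum, Finset.sum_mul, Finset.sum_ite_eq,
            Finset.mem_univ, if_true]
      _ = _ := by rw [hGsum, hEsum]; ring
  have hw : ∀ z : {z // z ∈ 𝒞}, boxWeight L 𝒞 z.1 = E z / capacity (boxUnion L 𝒞) :=
    fun z => rfl
  simp only [weightedAverage]
  rw [hsq]
  calc _ = (∑ z, ∑ z', E z * E z' *
      (∫ φ, boxAverage L K z.1 φ (f z).1 * boxAverage L K z'.1 φ (f z').1 ∂P))
        / capacity (boxUnion L 𝒞) := by
        simp only [Finset.sum_div, Finset.sum_mul, hw]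
        refine Finset.sum_congr rfl fun z _ => Finset.sum_congr rfl fun z' _ => ?_
        field_simp
    _ ≤ _ := (div_le_iff₀ hcap).2 key

/-- The expected minimum of a box average is of order `K⁻¹ L^{-(d-2)/2}`. -/
lemma IsGaussianFreeField.integral_iInf_boxAverage_bounds (hd : 3 ≤ d) : ∃ C : ℝ, 0 < C ∧
    ∀ P : Measure ((Fin d → ℤ) → ℝ), IsGaussianFreeField P → ∀ L K : ℕ, 1 ≤ L → 100 ≤ K →
      ∀ z : Fin d → ℤ,
        Integrable (fun φ => ⨅ x : {x // x ∈ boxD L z}, boxAverage L K z φ x.1) P ∧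
        ∫ φ, (⨅ x : {x // x ∈ boxD L z}, boxAverage L K z φ x.1) ∂P ≤ 0 ∧
        -(∫ φ, (⨅ x : {x // x ∈ boxD L z}, boxAverage L K z φ x.1) ∂P)
          ≤ C / K * √(1 / (L : ℝ) ^ (d - 2)) := by
  obtain ⟨C, hC0, hC⟩ := IsGaussianFreeField.integral_sq_boxAverage_sub_le (d := d) hd
  have hch := chainingConst_pos d
  refine ⟨chainingConst d * √(14 * C), by positivity, fun P hP L K hL hK z => ?_⟩
  have := hP.isProbabilityMeasure
  set b : Fin d → ℤ := fun i => z i - 3 * L with hb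
  have hbD : b ∈ boxD L z := mem_boxD.2 fun i => by simp only [hb]; omega
  have hne : Nonempty {x // x ∈ boxD L z} := ⟨⟨b, hbD⟩⟩
  have hpair : ∀ (x : {x // x ∈ boxD L z}) φ, boxAverage L K z φ x.1
      = pairing (outerBoundary (boxU L K z)) (exitLaw (boxU L K z) x.1) φ :=
    fun x φ => congrFun (boxAverage_eq_pairing hL hK x.2) φ
  have hint : Integrable (fun φ => ⨅ x : {x // x ∈ boxD L z}, boxAverage L K z φ x.1) P := by
    simp only [hpair]
    exact hP.integrable_iInf_pairing _ _
  have hbint : Integrable (fun φ => boxAverage L K z φ b) P := by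
    rw [boxAverage_eq_pairing hL hK hbD]
    exact hP.integrable_pairing _ _
  have hb0 : ∫ φ, boxAverage L K z φ b ∂P = 0 := by
    rw [boxAverage_eq_pairing hL hK hbD]
    exact hP.integral_pairing _ _
  refine ⟨hint, ?_, ?_⟩
  · rw [← hb0]
    exact integral_mono hint hbint fun φ =>
      ciInf_le (f := fun x : {x // x ∈ boxD L z} => boxAverage L K z φ x.1)
        (Set.finite_range _).bddBelow ⟨b, hbD⟩
  · have hK0 : (0 : ℝ) < K := by positivity
    have hK1 : (1 : ℝ) ≤ K := by exact_mod_cast (by omega : 1 ≤ K)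
    have hL0 : (0 : ℝ) < L := by positivity
    -- Chaining starts from the corner `b` of `D_z`, where the average has mean zero.
    have hmain := integral_iSup_sub_le (P := P) b (X := fun x φ => boxAverage L K z φ x)
      (V := C / (K * L : ℝ) ^ (d - 1)) (by positivity) (R := 7 * L) (by omega) (by
        rw [hb, ← boxD_eq_cornerBox]
        intro x hx y hy τ
        have hsub : ∀ φ, boxAverage L K z φ x - boxAverage L K z φ y
            = pairing (outerBoundary (boxU L K z))
              (fun u => exitLaw (boxU L K z) x u - exitLaw (boxU L K z) y u) φ := fun φ => by
          rw [← pairing_sub, hpair ⟨x, hx⟩, hpair ⟨y, hy⟩]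
        simp only [hsub]
        obtain ⟨h1, h2⟩ := hP.exp_pairing (outerBoundary (boxU L K z))
          (fun u => exitLaw (boxU L K z) x u - exitLaw (boxU L K z) y u) τ
        refine ⟨h1, h2.le.trans ?_⟩
        have := hC P hP L K hL hK z x hx y hy
        gcongr)
    rw [show cornerBox b (7 * L) = boxD L z from (boxD_eq_cornerBox L z).symm] at hmain
    simp only [iSup_const_sub] at hmain
    rw [integral_sub hbint hint, hb0, zero_sub] at hmain
    refine (hmain.trans (mul_le_mul_of_nonneg_left (c := √(14 * C) / K *
      √(1 / (L : ℝ) ^ (d - 2))) ?_ hch.le)).trans (le_of_eq (by ring))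
    have hs : √(14 * C) / K * √(1 / (L : ℝ) ^ (d - 2))
        = √(14 * C / ((K : ℝ) ^ 2 * 1 * (L : ℝ) ^ (d - 2))) := by
      rw [mul_one, ← div_div, Real.sqrt_div zero_le_one, Real.sqrt_one,
        Real.sqrt_div (x := 14 * C / (K : ℝ) ^ 2) (by positivity),
        Real.sqrt_div (x := 14 * C) (by positivity), Real.sqrt_sq hK0.le]
      ring
    rw [hs]
    refine Real.sqrt_le_sqrt ?_
    -- The power of `K` in the variance proxy is `d - 1 ≥ 2`; the surplus `K^{d-3}` is discarded, so
    -- the square root gives the factor `1/K`.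
    obtain ⟨n, rfl⟩ : ∃ n, d = n + 3 := ⟨d - 3, by omega⟩
    have e1 : n + 3 - 1 = n + 2 := by omega
    have e2 : n + 3 - 2 = n + 1 := by omega
    rw [e1, e2]
    have hKn : (1 : ℝ) ≤ (K : ℝ) ^ n := one_le_pow₀ hK1
    push_cast
    calc _ = 14 * C / ((K : ℝ) ^ 2 * (K : ℝ) ^ n * (L : ℝ) ^ (n + 1)) := by
          rw [mul_pow, pow_succ (L : ℝ) (n + 1), pow_add (K : ℝ) n 2]
          field_simp
          norm_num
      _ ≤ 14 * C / ((K : ℝ) ^ 2 * 1 * (L : ℝ) ^ (n + 1)) := by gcongr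

/-- The weights are nonnegative and the choices in different boxes are free, so the infimum is taken
box by box. The mean of `Z` thus needs chaining in one box only, never over all selections. -/
lemma iInf_weightedAverage (hd : 3 ≤ d) (h𝒞 : IsBoxCollection L K 𝒞) (hL : 1 ≤ L)
    (φ : (Fin d → ℤ) → ℝ) :
    ⨅ f : Selection L 𝒞, weightedAverage L K 𝒞 f φ = ∑ z : {z // z ∈ 𝒞},
      boxWeight L 𝒞 z.1 * ⨅ x : {x // x ∈ boxD L z.1}, boxAverage L K z.1 φ x.1 := by
  have : ∀ z : {z // z ∈ 𝒞}, Nonempty {x // x ∈ boxD L z.1} := fun z =>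
    ⟨⟨z.1, boxB_subset_boxD L z.1 (mem_boxB.2 fun i => by omega)⟩⟩
  exact iInf_sum_mul (fun z : {z // z ∈ 𝒞} => boxWeight L 𝒞 z.1)
    (fun z => boxWeight_nonneg hd h𝒞 hL z.1)
    (fun z (x : {x // x ∈ boxD L z.1}) => boxAverage L K z.1 φ x.1)

/-- A `λ`-average of the single-box bounds is again of order `K^{-1} L^{-(d-2)/2}`, and `cap(C) ≤ C₂
|𝒞| L^{d-2}` replaces the power of `L` by `|𝒞| / cap(C)`. -/
lemma IsGaussianFreeField.integral_iInf_weightedAverage_bounds (hd : 3 ≤ d) : ∃ C : ℝ, 0 < C ∧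
    ∀ P : Measure ((Fin d → ℤ) → ℝ), IsGaussianFreeField P → ∀ L K : ℕ, 1 ≤ L → 100 ≤ K →
      ∀ 𝒞 : Finset (Fin d → ℤ), IsBoxCollection L K 𝒞 →
        ∫ φ, (⨅ f : Selection L 𝒞, weightedAverage L K 𝒞 f φ) ∂P ≤ 0 ∧
        -(∫ φ, (⨅ f : Selection L 𝒞, weightedAverage L K 𝒞 f φ) ∂P)
          ≤ C / K * √(𝒞.card / capacity (boxUnion L 𝒞)) := by
  obtain ⟨C₁, hC₁, h₁⟩ := IsGaussianFreeField.integral_iInf_boxAverage_bounds (d := d) hd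
  obtain ⟨C₂, hC₂, h₂⟩ := capacity_boxUnion_le (d := d) hd
  refine ⟨C₁ * √C₂, by positivity, fun P hP L K hL hK 𝒞 h𝒞 => ?_⟩
  have hcap := capacity_pos hd (h𝒞.boxUnion_nonempty hL)
  have hL0 : (0 : ℝ) < L := by positivity
  have hw := boxWeight_nonneg hd h𝒞 hL
  simp only [iInf_weightedAverage hd h𝒞 hL]
  rw [integral_finsetSum _ fun z _ => (h₁ P hP L K hL hK z.1).1.const_mul _]
  simp only [integral_const_mul]
  constructor
  · exact Finset.sum_nonpos fun z _ =>
      mul_nonpos_of_nonneg_of_nonpos (hw z.1) (h₁ P hP L K hL hK z.1).2.1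
  · rw [← Finset.sum_neg_distrib]
    calc _ ≤ ∑ z : {z // z ∈ 𝒞}, boxWeight L 𝒞 z.1 * (C₁ / K * √(1 / (L : ℝ) ^ (d - 2))) := by
          refine Finset.sum_le_sum fun z _ => ?_
          rw [← mul_neg]
          exact mul_le_mul_of_nonneg_left (h₁ P hP L K hL hK z.1).2.2 (hw z.1)
      _ = C₁ / K * √(1 / (L : ℝ) ^ (d - 2)) := by
          rw [← Finset.sum_mul, sum_boxWeight hd h𝒞 hL hK, one_mul]
      _ ≤ C₁ / K * √(C₂ * (𝒞.card / capacity (boxUnion L 𝒞))) := by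
          gcongr
          rw [div_le_iff₀ (by positivity), mul_div_assoc', div_mul_eq_mul_div, le_div_iff₀ hcap]
          linarith [h₂ L K hL hK 𝒞 h𝒞]
      _ = _ := by rw [Real.sqrt_mul hC₂.le]; ring

/-- The Borell--TIS bound for the event that all box averages go below `-a`. -/
lemma IsGaussianFreeField.measureReal_lowEvent_le (hP : IsGaussianFreeField P) (hd : 3 ≤ d)
    (h𝒞 : IsBoxCollection L K 𝒞) (hL : 1 ≤ L) (hK : 100 ≤ K) {V m : ℝ} (hV0 : 0 < V)
    (hV : ∀ f : Selection L 𝒞, ∫ φ, weightedAverage L K 𝒞 f φ ^ 2 ∂P ≤ V)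
    (hm : -(∫ φ, (⨅ f : Selection L 𝒞, weightedAverage L K 𝒞 f φ) ∂P) ≤ m) (a : ℝ) :
    P.real (lowEvent L K 𝒞 a) ≤ Real.exp (-(max (a - m) 0 ^ 2 / (2 * V))) := by
  classical
  have := hP.isProbabilityMeasure
  have hne : Nonempty (Selection L 𝒞) :=
    ⟨fun z => ⟨z.1, boxB_subset_boxD L z.1 (mem_boxB.2 fun i => by omega)⟩⟩
  simp only [weightedAverage_eq_pairing hL hK] at hV hm
  have key := hP.measureReal_iInf_pairing_le (collectionBoundary L K 𝒞)
    (selectionCoeff L K 𝒞) hV0 hV a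
  -- On the event every box infimum is at most `-a`; averaging against the probability weights puts
  -- `Z` below `-a`.
  refine (measureReal_mono fun φ hφ => ?_).trans (key.trans ?_)
  · have h := iInf_weightedAverage (K := K) hd h𝒞 hL φ
    simp only [weightedAverage_eq_pairing hL hK] at h
    rw [Set.mem_ofPred_eq, h]
    calc _ ≤ ∑ z : {z // z ∈ 𝒞}, boxWeight L 𝒞 z.1 * -a :=
          Finset.sum_le_sum fun z _ =>
            mul_le_mul_of_nonneg_left (hφ z.1 z.2) (boxWeight_nonneg hd h𝒞 hL z.1)
      _ = -a := by rw [← Finset.sum_mul, sum_boxWeight hd h𝒞 hL hK, one_mul]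
  · refine Real.exp_le_exp.2 (neg_le_neg ?_)
    gcongr
    linarith

end Collection

end LatticeGFF

/-! ### Conclusion -/

open LatticeGFF

theorem corollary4p4 (d : ℕ) (hd : 3 ≤ d) :
    ∃ (c₄ : ℝ) (α : ℕ → ℝ),
      0 < c₄ ∧ (∀ K : ℕ, 100 ≤ K → 1 < α K) ∧ Tendsto α atTop (𝓝 1) ∧
      ∀ P : Measure ((Fin d → ℤ) → ℝ), IsGaussianFreeField P →
        -- `α(K)` is an asymptotic bound for the variances of the `Z_f`
        (∀ K : ℕ, 100 ≤ K →
          limsup (fun L : ℕ =>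
            ⨆ (𝒞 : Finset (Fin d → ℤ)) (_ : IsBoxCollection L K 𝒞) (f : Selection L 𝒞),
              ((variance (weightedAverage L K 𝒞 f) P * capacity (boxUnion L 𝒞) : ℝ) : EReal))
            atTop < (α K : EReal)) ∧
        -- `c₄ / K` bounds the normalized expectation of `Z = inf_f Z_f`
        (∀ K L : ℕ, 100 ≤ K → 1 ≤ L → ∀ 𝒞 : Finset (Fin d → ℤ), IsBoxCollection L K 𝒞 →
          |∫ φ, (⨅ f : Selection L 𝒞, weightedAverage L K 𝒞 f φ) ∂P| *
            ((𝒞.card : ℝ) / capacity (boxUnion L 𝒞)) ^ (-(1 / 2) : ℝ) ≤ c₄ / K) ∧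
        -- the probability bound, with these `c₄` and `α(K)`
        (∀ (a : ℝ) (K : ℕ), 0 < a → 100 ≤ K →
          limsup (fun L : ℕ =>
            ⨆ (𝒞 : Finset (Fin d → ℤ)) (_ : IsBoxCollection L K 𝒞),
              (ENNReal.log (P (lowEvent L K 𝒞 a)) +
                ((1 / 2 *
                  max (a - c₄ / K * √((𝒞.card : ℝ) / capacity (boxUnion L 𝒞))) 0 ^ 2 *
                  (capacity (boxUnion L 𝒞) / α K) : ℝ) : EReal)))
            atTop ≤ 0) := by
  have : NeZero d := ⟨by omega⟩
  obtain ⟨C₁, hC₁, h₁⟩ := IsGaussianFreeField.integral_sq_weightedAverage_le (d := d) hd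
  obtain ⟨C₂, hC₂, h₂⟩ := IsGaussianFreeField.integral_iInf_weightedAverage_bounds (d := d) hd
  have hα : ∀ K : ℕ, 100 ≤ K → 1 < 1 + (C₁ + 1) / (K : ℝ) := fun K hK =>
    lt_add_of_pos_right 1 (by positivity)
  -- The variance bound is `1 + C₁/K`; the extra `1/K` makes the limsup inequality strict.
  refine ⟨C₂, fun K => 1 + (C₁ + 1) / K, hC₂, hα, ?_, fun P hP => ⟨fun K hK => ?_,
    fun K L hK hL 𝒞 h𝒞 => ?_, fun a K ha hK => ?_⟩⟩
  · simpa using (tendsto_const_div_atTop_nhds_zero_nat (C₁ + 1)).const_add 1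
  · have hlt : ((1 + C₁ / K : ℝ) : EReal) < ((1 + (C₁ + 1) / K : ℝ) : EReal) := by
      have : (0 : ℝ) < K := by positivity
      exact EReal.coe_lt_coe_iff.2 (by gcongr; linarith)
    -- The bound holds for each `L ≥ 1` and every collection, so only the degenerate value `L = 0`
    -- has to be discarded in the limsup.
    refine lt_of_le_of_lt (limsup_le_of_le (h := ?_)) hlt
    filter_upwards [eventually_ge_atTop 1] with L hL
    refine iSup_le fun 𝒞 => iSup_le fun h𝒞 => iSup_le fun f => EReal.coe_le_coe_iff.2 ?_
    have h := h₁ P hP L K hL hK 𝒞 h𝒞 f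
    rw [weightedAverage_eq_pairing hL hK] at h ⊢
    rwa [hP.variance_pairing]
  · obtain ⟨h3, h4⟩ := h₂ P hP L K hL hK 𝒞 h𝒞
    have hr : 0 < (𝒞.card : ℝ) / capacity (boxUnion L 𝒞) :=
      div_pos (by exact_mod_cast h𝒞.nonempty.card_pos)
        (capacity_pos hd (h𝒞.boxUnion_nonempty hL))
    rw [abs_of_nonpos h3, Real.rpow_neg hr.le, ← Real.sqrt_eq_rpow, ← div_eq_mul_inv,
      div_le_iff₀ (Real.sqrt_pos.2 hr)]
    exact h4
  · refine limsup_le_of_le (h := ?_)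
    filter_upwards [eventually_ge_atTop 1] with L hL
    refine iSup_le fun 𝒞 => iSup_le fun h𝒞 => ?_
    have := hP.isProbabilityMeasure
    have hcap := capacity_pos hd (h𝒞.boxUnion_nonempty hL)
    have hα0 : 0 < 1 + (C₁ + 1) / (K : ℝ) := zero_lt_one.trans (hα K hK)
    have h := hP.measureReal_lowEvent_le hd h𝒞 hL hK
      (V := (1 + (C₁ + 1) / (K : ℝ)) / capacity (boxUnion L 𝒞)) (by positivity) (fun f => by
        rw [le_div_iff₀ hcap]
        refine (h₁ P hP L K hL hK 𝒞 h𝒞 f).trans ?_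
        gcongr
        linarith) (h₂ P hP L K hL hK 𝒞 h𝒞).2 a
    set y : ℝ := 1 / 2 * max (a - C₂ / K * √((𝒞.card : ℝ) / capacity (boxUnion L 𝒞))) 0 ^ 2 *
      (capacity (boxUnion L 𝒞) / (1 + (C₁ + 1) / K)) with hy
    -- The estimate is moved to extended values before taking `ENNReal.log`, which is monotone; an
    -- event of probability zero needs no separate treatment.
    have hexp : P (lowEvent L K 𝒞 a) ≤ ENNReal.ofReal (Real.exp (-y)) := by
      rw [← ofReal_measureReal]
      refine ENNReal.ofReal_le_ofReal (h.trans (le_of_eq ?_))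
      rw [hy]
      congr 2
      field_simp
    have hlog := ENNReal.log_le_log hexp
    rw [ENNReal.log_ofReal_of_pos (Real.exp_pos _), Real.log_exp] at hlog
    calc _ ≤ ((-y : ℝ) : EReal) + (y : EReal) := by gcongr
      _ = 0 := by rw [← EReal.coe_add]; simp
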